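/- **Setting.** Let $\mathbb S=\{\tfrac12,1,\tfrac32,\dots\}$. For $j\in\mathbb S$ the positive discrete series representation $\mathcal H_j$ of $\mathfrak{su}(1,1)$ has orthonormal basis $|j,m\rangle$, $m\in j+\mathbb N$, with $J_z|j,m\rangle=m|j,m\rangle$ and $J_\pm|j,m\rangle=\pm\sqrt{(m\pm j)(m\mp j\pm1)}\,|j,m\pm1\rangle$. A triad $(j_1j_2j)$ is admissible if $j-j_1-j_2\in\mathbb N=\{0,1,2,\dots\}$. For admissible triads, with $m=m_1+m_2$ and $m_1-j_1,\,m_2-j_2,\,m-j\in\mathbb N$, put $$\left[\begin{array}{ccc} j_1&j_2&j\\ m_1&m_2&m\end{array}\right]=(-1)^{m_1-j_1}\Delta(j_1j_2j)\sqrt{\frac{(2j-1)(m-j)!(m_1-j_1)!(m_2-j_2)!(m_1+j_1-1)!(m_2+j_2-1)!}{(m+j-1)!}}$$ $$\times\sum_z\frac{(-1)^z}{z!(m-j-z)!(m_1-j_1-z)!(m_1+j_1-z-1)!(j-j_2-m_1+z)!(j+j_2-m_1+z-1)!},$$ with $\Delta(j_1j_2j)=\sqrt{(j-j_1-j_2)!(j-j_1+j_2-1)!(j+j_1-j_2-1)!(j+j_1+j_2-2)!}$,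 the sum being over all $z$ for which every factorial is that of a natural number; in all other cases the coefficient is $0$. The SU(1,1) $6j$ symbol $\left\{\begin{array}{ccc}a&b&c\\d&e&f\end{array}\right\}$ ($a,\dots,f\in\mathbb S$) is the function that is $0$ unless the triads $(abc),(cde),(bdf),(afe)$ are all admissible, and satisfies, for all $j_1,j_2,j_3,j,j_{23}\in\mathbb S$ and all $m_1,m_2,m_3$, with $m=m_1+m_2+m_3$, $$\sum_{j_{12}\in\mathbb S}(-1)^{j_1+j_2+j_3+j}\sqrt{(2j_{12}-1)(2j_{23}-1)}\left\{\begin{array}{ccc}j_1&j_2&j_{12}\\j_3&j&j_{23}\end{array}\right\}\left[\begin{array}{ccc}j_1&j_2&j_{12}\\m_1&m_2&m_1+m_2\end{array}\right]\left[\begin{array}{ccc}j_{12}&j_3&j\\m_1+m_2&m_3&m\end{array}\right]$$ $$=\left[\begin{array}{ccc}j_2&j_3&j_{23}\\m_2&m_3&m_2+m_3\end{array}\right]\left[\begin{array}{ccc}j_1&j_{23}&j\\m_1&m_2+m_3&m\end{array}\right].$$ The extended symbol is $\left\{\begin{array}{ccc}a&b&c\\d&e&f\end{array}\right\}_{ext}=\left\{\begin{array}{ccc}\frac{a+b-d+e}2&\frac{-a-b-d+e}2-1&c\\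 \frac{-a+b+d+e}2&\frac{a-b+d+e}2&f\end{array}\right\}_{SU(2)}$, where the SU(2) $6j$ symbol is given by Racah's formula $$\left\{\begin{array}{ccc}a&b&c\\d&e&f\end{array}\right\}_{SU(2)}=\Delta'(abc)\Delta'(cde)\Delta'(bdf)\Delta'(aef)\sum_n\frac{(-1)^n(n+1)!}{(n-a-b-c)!(n-c-d-e)!(n-b-d-f)!(n-a-e-f)!}$$ $$\times\frac1{(a+b+d+e-n)!(a+c+d+f-n)!(b+c+e+f-n)!},\qquad \Delta'(abc)=\sqrt{\frac{(a+b-c)!(a-b+c)!(-a+b+c)!}{(a+b+c+1)!}},$$ and is $0$ when a factorial in one of the $\Delta'$ is undefined. **Proposition (Biedenharn–Elliot relation for SU(1,1)).** (0) The coefficients $[\,\cdot\,]$ are normalised Clebsch–Gordan coefficients of the positive discrete series: for every admissible triad $(j_1j_2j)$ the linear map $|j,m\rangle\mapsto\sum_{m_1+m_2=m}\left[\begin{array}{ccc} j_1&j_2&j\\ m_1&m_2&m\end{array}\right]|j_1,m_1\rangle\otimes|j_2,m_2\rangle$ commutes with $J_z,J_+,J_-$, and $\sum_{m_1+m_2=m}\left[\begin{array}{ccc}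 j_1&j_2&j\\ m_1&m_2&m\end{array}\right]^2=1$ for all $m\in j+\mathbb N$. The recoupling identity above has exactly one solution with the stated vanishing, namely the one obtained by contracting the identity at lowest weight $m=j$ with the normalised coupled vector on its left side. Thus the SU(1,1) $6j$ symbol is well defined. (1) For all $a,b,c,d,e,f,p,q,r\in\mathbb S$, with $R=a+b+c+d+e+f+p+q+r+X$, $$\sum_{X\in\mathbb S}(-1)^R(2X-1)\left\{\begin{array}{ccc}b&c&X\\d&f&e\end{array}\right\}\left\{\begin{array}{ccc}a&X&q\\d&r&f\end{array}\right\}\left\{\begin{array}{ccc}a&b&p\\c&q&X\end{array}\right\}=\left\{\begin{array}{ccc}a&b&p\\e&r&f\end{array}\right\}\left\{\begin{array}{ccc}p&c&q\\d&r&e\end{array}\right\}.$$ (2) For all $a,b,c,d,e,f,p,q,r\in\tfrac12\mathbb Z$, $$\sum_{X\in\frac12\mathbb Z}(-1)^{f+q-r+X+1}(2X+1)\left\{\begin{array}{ccc}b&c&X\\d&f&e\end{array}\right\}_{ext}\left\{\begin{array}{ccc}a&X&q\\d&r&f\end{array}\right\}_{ext}\left\{\begin{array}{ccc}a&b&p\\c&q&X\end{array}\right\}_{ext}=\left\{\begin{array}{ccc}a&b&p\\e&r&f\end{array}\right\}_{ext}\left\{\begin{array}{ccc}p&c&q\\d&r&e\end{array}\right\}_{ext}.$$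 In (1) and (2) only finitely many terms of the sum are nonzero, and the exponent of $-1$ is an integer in each of these (terms in which the product of $6j$ symbols vanishes are $0$). -/

import Mathlib

namespace SU11

open scoped TensorProduct Classical

noncomputable section

/-! ### Labels and factorials -/

/-- The labels `1/2, 1, 3/2, …` of the positive discrete series. -/
abbrev Spin : Type := {j : ℚ // ∃ n : ℕ, 0 < n ∧ j = (n : ℚ) / 2}

/-- All integers and half-integers, the possible labels of the extended symbol. -/
abbrev HalfInt : Type := {x : ℚ // ∃ n : ℤ, x = (n : ℚ) / 2}

/-- `x` is a natural number, i.e. `x !` is defined. -/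
def IsNat (x : ℚ) : Prop := ∃ n : ℕ, x = n

/-- `x !`, meaningful for `IsNat x`. -/
def fac (x : ℚ) : ℝ := (Nat.factorial ⌊x⌋₊ : ℝ)

/-- `1 / x !`, read as `0` when `x !` is undefined. -/
def invFac (x : ℚ) : ℝ := if IsNat x then 1 / fac x else 0

/-- `(-1) ^ x`, meaningful for integral `x`. -/
def sgn (x : ℚ) : ℝ := (-1 : ℝ) ^ ⌊x⌋

/-! ### The positive discrete series -/

/-- The dense subspace of `ℋ_j` spanned by the orthonormal basis `|j, j + k⟩`, `k = 0, 1, 2, …`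
(all three generators preserve it). -/
abbrev Rep : Type := ℕ →₀ ℂ

/-- The basis vector `|j, j + k⟩`. -/
def ket (k : ℕ) : Rep := Finsupp.single k 1

/-- `J_z |j, m⟩ = m |j, m⟩`, with `m = j + k`. -/
def Jz (j : Spin) : Rep →ₗ[ℂ] Rep :=
  Finsupp.linearCombination ℂ fun k : ℕ => (((j : ℚ) + k : ℚ) : ℂ) • ket k

/-- `J_+ |j, m⟩ = √((m + j) (m - j + 1)) |j, m + 1⟩`, with `m = j + k`. -/
def Jplus (j : Spin) : Rep →ₗ[ℂ] Rep :=
  Finsupp.linearCombination ℂ fun k : ℕ =>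
    ((√(((2 * (j : ℚ) + k) * (k + 1) : ℚ) : ℝ) : ℝ) : ℂ) • ket (k + 1)

/-- `J_- |j, m⟩ = -√((m - j) (m + j - 1)) |j, m - 1⟩`, with `m = j + k`
(the coefficient vanishes for `k = 0`). -/
def Jminus (j : Spin) : Rep →ₗ[ℂ] Rep :=
  Finsupp.linearCombination ℂ fun k : ℕ =>
    (-(√((k * (2 * (j : ℚ) + k - 1) : ℚ) : ℝ) : ℝ) : ℂ) • ket (k - 1)

/-- The action `A ⊗ 1 + 1 ⊗ B` of a Lie algebra element on a tensor product. -/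
def coproduct (A B : Rep →ₗ[ℂ] Rep) : (Rep ⊗[ℂ] Rep) →ₗ[ℂ] (Rep ⊗[ℂ] Rep) :=
  TensorProduct.map A LinearMap.id + TensorProduct.map LinearMap.id B

/-- The triad condition: `ℋ_j` occurs in `ℋ_{j₁} ⊗ ℋ_{j₂}`, i.e. `j = j₁ + j₂ + n`, `n ∈ ℕ`. -/
def Triad (j₁ j₂ j : Spin) : Prop := IsNat ((j : ℚ) - j₁ - j₂)

/-! ### Clebsch-Gordan coefficients -/

/-- `Δ(j₁ j₂ j)` for SU(1,1). -/
def triDelta (j₁ j₂ j : Spin) : ℝ :=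
  √(fac ((j : ℚ) - j₁ - j₂) * fac ((j : ℚ) - j₁ + j₂ - 1) *
    fac ((j : ℚ) + j₁ - j₂ - 1) * fac ((j : ℚ) + j₁ + j₂ - 2))

/-- The Clebsch-Gordan coefficient `[j₁ j₂ j; m₁ m₂ m]` of the positive discrete series. It is zero
unless `j` occurs in `j₁ ⊗ j₂`, `m = m₁ + m₂`, and `m₁, m₂, m` are weights of `j₁, j₂, j`. -/
def cg (j₁ j₂ j : Spin) (m₁ m₂ m : ℚ) : ℝ :=
  if Triad j₁ j₂ j ∧ m₁ + m₂ = m ∧ IsNat (m₁ - j₁) ∧ IsNat (m₂ - j₂) ∧ IsNat (m - j) then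
    sgn (m₁ - j₁) * triDelta j₁ j₂ j *
      √(((2 * (j : ℚ) - 1 : ℚ) : ℝ) * fac (m - j) * fac (m₁ - j₁) * fac (m₂ - j₂) *
        fac (m₁ + j₁ - 1) * fac (m₂ + j₂ - 1) / fac (m + j - 1)) *
      ∑ z ∈ Finset.range (⌊m - (j : ℚ)⌋₊ + 1),
        (-1 : ℝ) ^ z * (invFac z * invFac (m - j - z) * invFac (m₁ - j₁ - z) *
          invFac (m₁ + j₁ - z - 1) * invFac (j - j₂ - m₁ + z) * invFac (j + j₂ - m₁ + z - 1))
  else 0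

/-- The vector `∑ [j₁ j₂ j; m₁ m₂ m] |j₁, m₁⟩ ⊗ |j₂, m₂⟩` for `m = j + k`, with coefficients `C`. -/
def coupled (C : Spin → Spin → Spin → ℚ → ℚ → ℚ → ℝ) (j₁ j₂ j : Spin) (k : ℕ) : Rep ⊗[ℂ] Rep :=
  ∑ x ∈ Finset.HasAntidiagonal.antidiagonal ⌊(k : ℚ) + j - j₁ - j₂⌋₊,
    (C j₁ j₂ j (j₁ + x.1) (j₂ + x.2) (j + k) : ℂ) • (ket x.1 ⊗ₜ[ℂ] ket x.2)

/-- The linear map `|j, m⟩ ↦ ∑ [j₁ j₂ j; m₁ m₂ m] |j₁, m₁⟩ ⊗ |j₂, m₂⟩`. -/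
def coupling (C : Spin → Spin → Spin → ℚ → ℚ → ℚ → ℝ) (j₁ j₂ j : Spin) :
    Rep →ₗ[ℂ] (Rep ⊗[ℂ] Rep) :=
  Finsupp.linearCombination ℂ (coupled C j₁ j₂ j)

/-- `C` is a family of (real, normalised) Clebsch-Gordan coefficients: whenever `ℋ_j` occurs in
`ℋ_{j₁} ⊗ ℋ_{j₂}`, the map `coupling C j₁ j₂ j` commutes with the generators and sends each basis
vector to a unit vector. -/
def IsClebschGordan (C : Spin → Spin → Spin → ℚ → ℚ → ℚ → ℝ) : Prop :=
  ∀ j₁ j₂ j : Spin, Triad j₁ j₂ j →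
    coupling C j₁ j₂ j ∘ₗ Jz j = coproduct (Jz j₁) (Jz j₂) ∘ₗ coupling C j₁ j₂ j ∧
    coupling C j₁ j₂ j ∘ₗ Jplus j = coproduct (Jplus j₁) (Jplus j₂) ∘ₗ coupling C j₁ j₂ j ∧
    coupling C j₁ j₂ j ∘ₗ Jminus j = coproduct (Jminus j₁) (Jminus j₂) ∘ₗ coupling C j₁ j₂ j ∧
    ∀ k : ℕ, ∑ x ∈ Finset.HasAntidiagonal.antidiagonal ⌊(k : ℚ) + j - j₁ - j₂⌋₊,
      C j₁ j₂ j (j₁ + x.1) (j₂ + x.2) (j + k) ^ 2 = 1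

/-! ### The SU(1,1) 6j symbol -/

/-- The four triad conditions on the six labels of `{a b c; d e f}`. -/
def Tetrad (a b c d e f : Spin) : Prop :=
  Triad a b c ∧ Triad c d e ∧ Triad b d f ∧ Triad a f e

/-- `W` satisfies the recoupling identity that defines the SU(1,1) 6j symbol, and is zero on labels
that do not satisfy the triad conditions. -/
def IsSixJ (W : Spin → Spin → Spin → Spin → Spin → Spin → ℝ) : Prop :=
  (∀ a b c d e f : Spin, ¬ Tetrad a b c d e f → W a b c d e f = 0) ∧
  ∀ (j₁ j₂ j₃ j j₂₃ : Spin) (m₁ m₂ m₃ : ℚ),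
    ∑ᶠ j₁₂ : Spin, sgn ((j₁ : ℚ) + j₂ + j₃ + j) *
        √(((2 * (j₁₂ : ℚ) - 1) * (2 * (j₂₃ : ℚ) - 1) : ℚ) : ℝ) * W j₁ j₂ j₁₂ j₃ j j₂₃ *
        cg j₁ j₂ j₁₂ m₁ m₂ (m₁ + m₂) * cg j₁₂ j₃ j (m₁ + m₂) m₃ (m₁ + m₂ + m₃) =
      cg j₂ j₃ j₂₃ m₂ m₃ (m₂ + m₃) * cg j₁ j₂₃ j m₁ (m₂ + m₃) (m₁ + m₂ + m₃)

/-- The SU(1,1) 6j symbol `{a b c; d e f}`: the recoupling identity solved for the symbol, by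
contracting it at the lowest weight `m = e` with the normalised coupled vector on its left side. -/
def sixJ (a b c d e f : Spin) : ℝ :=
  if Tetrad a b c d e f then
    sgn ((a : ℚ) + b + d + e) / √(((2 * (c : ℚ) - 1) * (2 * (f : ℚ) - 1) : ℚ) : ℝ) *
      ∑ k ∈ Finset.range (⌊(e : ℚ) - a - b - d⌋₊ + 1),
        ∑ l ∈ Finset.range (⌊(e : ℚ) - a - b - d⌋₊ + 1),
          cg a b c (a + k) (b + l) (a + k + (b + l)) *
          cg c d e (a + k + (b + l)) (e - (a + k) - (b + l)) e *
          cg b d f (b + l) (e - (a + k) - (b + l)) (e - (a + k)) *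
          cg a f e (a + k) (e - (a + k)) e
  else 0

/-! ### The SU(2) 6j symbol and its extension -/

/-- All factorials in `Δ(abc)` for SU(2) are defined. -/
def TriangleSU2 (a b c : ℚ) : Prop :=
  IsNat (a + b - c) ∧ IsNat (a - b + c) ∧ IsNat (-a + b + c) ∧ IsNat (a + b + c + 1)

/-- `Δ(abc)` for SU(2). -/
def triDeltaSU2 (a b c : ℚ) : ℝ :=
  √(fac (a + b - c) * fac (a - b + c) * fac (-a + b + c) / fac (a + b + c + 1))

/-- The SU(2) 6j symbol by Racah's formula, zero when a factorial in a `Δ` is undefined. -/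
def sixJSU2 (a b c d e f : ℚ) : ℝ :=
  if TriangleSU2 a b c ∧ TriangleSU2 c d e ∧ TriangleSU2 b d f ∧ TriangleSU2 a e f then
    triDeltaSU2 a b c * triDeltaSU2 c d e * triDeltaSU2 b d f * triDeltaSU2 a e f *
      ∑ n ∈ Finset.range (⌊a + b + d + e⌋₊ + 1),
        (-1 : ℝ) ^ n * (Nat.factorial (n + 1) : ℝ) *
          (invFac (n - a - b - c) * invFac (n - c - d - e) * invFac (n - b - d - f) *
            invFac (n - a - e - f) * invFac (a + b + d + e - n) * invFac (a + c + d + f - n) *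
            invFac (b + c + e + f - n))
  else 0

/-- The extension `{a b c; d e f}_ext` of the SU(2) 6j symbol to the SU(1,1) region. -/
def sixJExt (a b c d e f : ℚ) : ℝ :=
  sixJSU2 ((a + b - d + e) / 2) ((-a - b - d + e) / 2 - 1) c
    ((-a + b + d + e) / 2) ((a - b + d + e) / 2) f

end

end SU11

/-!
The representation with label `j` is modelled on polynomials in `x`, with `|j, j + k⟩` proportional
to `x ^ k` and `J_+` acting as multiplication by `x`; then `-J_-` is `x ∂ₓ² + 2 j ∂ₓ`. In the tensor
product the lowest weight vectors are explicit homogeneous polynomials in `x, y`, and the component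
`j` is spanned by their multiples by powers of `x + y`. The coefficients `kap` of these multiples
are the Clebsch-Gordan coefficients up to normalisation (`cg_eq_ncg`). The two laws `kap_step` and
`kap_lower` express the intertwining property, and the adjointness of `J_+` and `-J_-` yields
orthonormality by induction from a Chu-Vandermonde sum (`sum_ncg_mul_ncg`).

Recoupling. A lowest weight vector of a triple product is determined by its monomials without the
second variable (`IsTripleTower.eq_zero`). On this slice the vectors of the scheme `((j₁ j₂) j₃)`
form a triangular matrix with an explicit inverse (`sum_triangular_inverse`), so that the vectors of
the scheme `(j₁ (j₂ j₃))` are combinations of them with explicit coefficients (`kapRight_eq_sum`).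
By orthonormality the coefficients are recovered by contraction (`contraction_eq`), which gives both
existence and uniqueness of the 6j symbol (`isSixJ_iff`).

The Biedenharn-Elliott relation for SU(1,1) compares the two paths from `(a (b (c d)))` to
`(((a b) c) d)` along the recoupling identity; the vectors of the last scheme are linearly
independent (`pentagon`).

The relation for the extended symbol follows from the one for SU(1,1). Two applications of the sum
of Saalschütz give Whipple's transformation (`whipple`), which turns the recoupling coefficients
into Racah's formula: up to a sign, the SU(1,1) symbol is the extended symbol with all labels
lowered by one (`sixJ_eq_sixJExt`). Under a reflection `x ↦ -1 - x` of its first, second or fourth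
label the factorials in the extended symbol are permuted, so that the symbol is invariant; its
other three labels are nonnegative wherever it does not vanish. Hence all labels may be taken from
the region of the SU(1,1) symbol (`hasSum_sixJExt`).
-/

namespace SU11
open scoped TensorProduct

noncomputable section

/-! ### Factorials of integers -/

/-- `k !` for a natural number `k`, and `1` for a negative integer. -/
def zfac (k : ℤ) : ℝ := (k.toNat.factorial : ℝ)

/-- `1 / k !`, with the value `0` at the negative integers. -/
def zinv (k : ℤ) : ℝ := if 0 ≤ k then 1 / zfac k else 0

lemma zfac_pos (k : ℤ) : 0 < zfac k := by
  unfold zfac; positivity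

lemma zfac_ne_zero (k : ℤ) : zfac k ≠ 0 := (zfac_pos k).ne'

lemma zfac_natCast (k : ℕ) : zfac k = (k.factorial : ℝ) := by simp [zfac]

lemma zfac_succ {k : ℤ} (hk : 0 ≤ k) : zfac (k + 1) = (k + 1) * zfac k := by
  obtain ⟨n, rfl⟩ := Int.eq_ofNat_of_zero_le hk
  have : ((n : ℤ) + 1) = ((n + 1 : ℕ) : ℤ) := by push_cast; ring
  rw [this, zfac_natCast, zfac_natCast, Nat.factorial_succ]
  push_cast; ring

lemma zfac_pred {k : ℤ} (hk : 0 < k) : zfac k = k * zfac (k - 1) := by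
  have := zfac_succ (k := k - 1) (by omega)
  rw [sub_add_cancel] at this
  rw [this]; push_cast; ring

lemma zinv_neg {k : ℤ} (hk : k < 0) : zinv k = 0 := by
  simp [zinv, not_le.mpr hk]

lemma zinv_nonneg {k : ℤ} (hk : 0 ≤ k) : zinv k = 1 / zfac k := by simp [zinv, hk]

lemma zinv_zero : zinv 0 = 1 := by simp [zinv, zfac]

lemma zfac_mul_zinv {k : ℤ} (hk : 0 ≤ k) : zfac k * zinv k = 1 := by
  rw [zinv_nonneg hk]; exact mul_one_div_cancel (zfac_ne_zero k)

/-- The recursion of `1 / k !`, valid at every integer. -/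
lemma mul_zinv (k : ℤ) : (k : ℝ) * zinv k = zinv (k - 1) := by
  rcases lt_trichotomy k 0 with h | h | h
  · rw [zinv_neg h, zinv_neg (by omega), mul_zero]
  · subst h; rw [zinv_neg (k := 0 - 1) (by omega)]; simp
  · rw [zinv_nonneg h.le, zinv_nonneg (by omega), zfac_pred h]
    have : (k : ℝ) ≠ 0 := by exact_mod_cast h.ne'
    have := zfac_ne_zero (k - 1)
    field_simp

lemma add_one_mul_zinv (k : ℤ) : ((k : ℝ) + 1) * zinv (k + 1) = zinv k := by
  have := mul_zinv (k + 1)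
  push_cast at this
  rwa [add_sub_cancel_right] at this

/-- The Chu-Vandermonde sum that gives the norm of a lowest weight vector. -/
lemma sum_zinv_vandermonde {α β : ℤ} (hα : 1 ≤ α) (hβ : 1 ≤ β) (n : ℕ) :
    ∑ x ∈ Finset.HasAntidiagonal.antidiagonal n,
      zinv x.1 * zinv x.2 * zinv (α + x.1 - 1) * zinv (β + x.2 - 1) =
    zfac (α + β + 2 * n - 2) * zinv n * zinv (α + β + n - 2) * zinv (β + n - 1) *
      zinv (α + n - 1) := by
  obtain ⟨a, rfl⟩ : ∃ a : ℕ, α = a + 1 := ⟨(α - 1).toNat, by omega⟩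
  obtain ⟨b, rfl⟩ : ∃ b : ℕ, β = b + 1 := ⟨(β - 1).toNat, by omega⟩
  have hZ : ∀ k : ℕ, zinv (k : ℤ) = 1 / (k.factorial : ℝ) := fun k => by
    rw [zinv_nonneg (by positivity), zfac_natCast]
  have key := Nat.add_choose_eq (n + b) (n + a) n
  have key' : (((n + b + (n + a)).choose n : ℕ) : ℝ) =
      ∑ x ∈ Finset.HasAntidiagonal.antidiagonal n,
        ((n + b).choose x.1 : ℝ) * ((n + a).choose x.2 : ℝ) := by
    exact_mod_cast key
  have e1 : ((a : ℤ) + 1 + (b + 1) + 2 * n - 2) = ((n + b + (n + a) : ℕ) : ℤ) := by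
    push_cast; ring
  have e2 : ((a : ℤ) + 1 + (b + 1) + n - 2) = ((n + b + a : ℕ) : ℤ) := by push_cast; ring
  have e3 : ((b : ℤ) + 1 + n - 1) = ((n + b : ℕ) : ℤ) := by push_cast; ring
  have e4 : ((a : ℤ) + 1 + n - 1) = ((n + a : ℕ) : ℤ) := by push_cast; ring
  rw [e1, e2, e3, e4, zfac_natCast, hZ, hZ, hZ, hZ]
  rw [Nat.cast_choose ℝ (by omega : n ≤ n + b + (n + a))] at key'
  rw [show n + b + (n + a) - n = n + b + a by omega] at key'
  have : ((n + b + (n + a)).factorial : ℝ) * (1 / (n.factorial : ℝ)) *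
      (1 / ((n + b + a).factorial : ℝ)) * (1 / ((n + b).factorial : ℝ)) *
      (1 / ((n + a).factorial : ℝ)) =
      (1 / ((n + b).factorial : ℝ)) * (1 / ((n + a).factorial : ℝ)) *
      (((n + b + (n + a)).factorial : ℝ) / (n.factorial * (n + b + a).factorial)) := by
    field_simp
  rw [this, key', Finset.mul_sum]
  refine Finset.sum_congr rfl fun x hx => ?_
  obtain ⟨s, t⟩ := x
  obtain rfl : s + t = n := Finset.HasAntidiagonal.mem_antidiagonal.mp hx
  have e5 : ((a : ℤ) + 1 + s - 1) = ((a + s : ℕ) : ℤ) := by push_cast; ring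
  have e6 : ((b : ℤ) + 1 + t - 1) = ((b + t : ℕ) : ℤ) := by push_cast; ring
  simp only [e5, e6, hZ]
  rw [Nat.cast_choose ℝ (by omega : s ≤ s + t + b), Nat.cast_choose ℝ (by omega : t ≤ s + t + a)]
  rw [show s + t + b - s = b + t by omega, show s + t + a - t = a + s by omega]
  have := (Nat.factorial_pos (s+t+b)).ne'
  have := (Nat.factorial_pos (s+t+a)).ne'
  field_simp

/-! ### The polynomial model of a tensor product -/

/-- The coefficient of `x ^ s * y ^ t` in the lowest weight vector of degree `n`, in the model
where `|j, j + k⟩` is proportional to `x ^ k` and `J_+` is multiplication by `x`. -/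
def lowest (α β n s t : ℤ) : ℝ :=
  if s + t = n then (-1) ^ s * (zinv s * zinv t * zinv (α + s - 1) * zinv (β + t - 1)) else 0

/-- The coefficient of `x ^ s * y ^ t` in `(x + y) ^ N` times the lowest weight vector of degree
`n`. -/
def raised (α β n : ℤ) : ℕ → ℤ → ℤ → ℝ
  | 0, s, t => lowest α β n s t
  | N + 1, s, t => raised α β n N (s - 1) t + raised α β n N s (t - 1)

/-- The coefficient of `x ^ s * y ^ t` in `(x + y) ^ (s + t - n)` times the lowest weight vector of
degree `n` of the tensor product of the representations with labels `α / 2` and `β / 2`. It is an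
unnormalised Clebsch-Gordan coefficient. -/
def kap (α β n s t : ℤ) : ℝ := raised α β n (s + t - n).toNat s t

lemma raised_eq_zero {α β n : ℤ} (N : ℕ) {s t : ℤ} (h : s + t ≠ n + N ∨ s < 0 ∨ t < 0) :
    raised α β n N s t = 0 := by
  induction N generalizing s t with
  | zero =>
    simp only [raised, lowest]
    split_ifs with h1
    · rcases h with h | h | h
      · push_cast at h; omega
      · rw [zinv_neg h]; ring
      · rw [zinv_neg h]; ring
    · rfl
  | succ N ih =>
    simp only [raised]
    push_cast at h
    rw [ih (by omega), ih (by omega), add_zero]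

lemma kap_eq_zero {α β n s t : ℤ} (h : s + t < n ∨ s < 0 ∨ t < 0) : kap α β n s t = 0 :=
  raised_eq_zero _ (by omega)

lemma kap_base {α β n s t : ℤ} (h : s + t = n) : kap α β n s t =
    (-1) ^ s * (zinv s * zinv t * zinv (α + s - 1) * zinv (β + t - 1)) := by
  simp [kap, h, raised, lowest]

/-- `J_+` acts as multiplication by `x + y`. -/
lemma kap_step {α β n s t : ℤ} (h : n < s + t) :
    kap α β n s t = kap α β n (s - 1) t + kap α β n s (t - 1) := by
  unfold kap
  obtain ⟨N, hN⟩ : ∃ N : ℕ, s + t - n = N + 1 := ⟨(s + t - n - 1).toNat, by omega⟩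
  rw [show (s + t - n).toNat = N + 1 by omega, show (s - 1 + t - n).toNat = N by omega,
    show (s + (t - 1) - n).toNat = N by omega, raised]

/-- `-J_-` acts as the differential operator `x ∂ₓ² + α ∂ₓ + y ∂ᵧ² + β ∂ᵧ`, which lowers the power
of `x + y` and kills the lowest weight vector. -/
lemma kap_lower (α β n s t : ℤ) :
    ((s : ℝ) + 1) * (s + α) * kap α β n (s + 1) t + (t + 1) * (t + β) * kap α β n s (t + 1) =
      (s + t - n + 1) * (s + t + n + α + β) * kap α β n s t := by
  obtain h | ⟨N, hN⟩ : s + t + 1 < n ∨ ∃ N : ℕ, s + t + 1 = n + N := by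
    by_cases h : s + t + 1 < n
    · exact .inl h
    · exact .inr ⟨(s + t + 1 - n).toNat, by omega⟩
  · rw [kap_eq_zero (by omega), kap_eq_zero (by omega), kap_eq_zero (by omega)]; ring
  induction N generalizing s t with
  | zero =>
    have h1 : s + 1 + t = n := by push_cast at hN; omega
    have h2 : s + (t + 1) = n := by omega
    rw [kap_base h1, kap_base h2, zpow_add_one₀ (by norm_num : (-1 : ℝ) ≠ 0),
      ← add_one_mul_zinv s, ← add_one_mul_zinv t]
    have h3 := mul_zinv (α + (s + 1) - 1)
    have h4 := mul_zinv (β + (t + 1) - 1)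
    rw [show α + (s + 1) - 1 - 1 = α + s - 1 by ring] at h3
    rw [show β + (t + 1) - 1 - 1 = β + t - 1 by ring] at h4
    rw [← h3, ← h4]
    have h5 : ((s : ℝ) + t - n + 1) = 0 := by
      have : (s : ℝ) + 1 + t = n := by exact_mod_cast h1
      linarith
    rw [h5]; push_cast; ring
  | succ N ih =>
    push_cast at hN
    have i1 := ih (s - 1) t (by omega)
    have i2 := ih s (t - 1) (by omega)
    rw [sub_add_cancel] at i1 i2
    rw [show kap α β n (s + 1) t = kap α β n s t + kap α β n (s + 1) (t - 1) by
        rw [kap_step (by omega)]; simp,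
      show kap α β n s (t + 1) = kap α β n (s - 1) (t + 1) + kap α β n s t by
        rw [kap_step (by omega)]; simp]
    push_cast at i1 i2
    by_cases hz : N = 0
    · have h1 : s + t = n := by omega
      have e1 : kap α β n (s - 1) t = 0 := kap_eq_zero (by omega)
      have e2 : kap α β n s (t - 1) = 0 := kap_eq_zero (by omega)
      rw [e1] at i1
      rw [e2] at i2
      have h5 : ((s : ℝ) + t) = n := by exact_mod_cast h1
      rw [← h5]
      rw [← h5] at i1 i2
      linear_combination i1 + i2
    · have e := kap_step (α := α) (β := β) (n := n) (s := s) (t := t) (by omega)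
      linear_combination i1 + i2 + (s + t - n) * (s + t + n + α + β - 1) * (-e)

/-! ### Orthonormality -/

/-- The squared norm of `x ^ s` in the polynomial model of the representation with label `α / 2`,
up to the factor `1 / (α - 1)!`. -/
def wt (α s : ℤ) : ℝ := zfac s * zfac (s + α - 1)

lemma wt_pos (α s : ℤ) : 0 < wt α s := mul_pos (zfac_pos _) (zfac_pos _)

lemma wt_succ {α s : ℤ} (hα : 1 ≤ α) (hs : 0 ≤ s) :
    wt α (s + 1) = (s + 1) * (s + α) * wt α s := by
  unfold wt
  rw [zfac_succ hs, show s + 1 + α - 1 = (s + α - 1) + 1 by ring, zfac_succ (by omega)]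
  push_cast; ring

/-- For the inner product with weights `wt`, the operators `J_+` and `-J_-` are adjoint. -/
lemma sum_raise_eq_sum_lower {α β : ℤ} (hα : 1 ≤ α) (hβ : 1 ≤ β) (f h : ℤ → ℤ → ℝ)
    (hf1 : ∀ t, f (-1) t = 0) (hf2 : ∀ s, f s (-1) = 0) (T : ℕ) :
    ∑ x ∈ Finset.HasAntidiagonal.antidiagonal (T + 1),
      wt α x.1 * wt β x.2 * (f (x.1 - 1) x.2 + f x.1 (x.2 - 1)) * h x.1 x.2 =
    ∑ x ∈ Finset.HasAntidiagonal.antidiagonal T,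
      wt α x.1 * wt β x.2 * f x.1 x.2 * (((x.1 : ℝ) + 1) * (x.1 + α) * h (x.1 + 1) x.2 +
        (x.2 + 1) * (x.2 + β) * h x.1 (x.2 + 1)) := by
  have h1 : ∑ x ∈ Finset.HasAntidiagonal.antidiagonal (T + 1),
      wt α x.1 * wt β x.2 * f (x.1 - 1) x.2 * h x.1 x.2 =
      ∑ x ∈ Finset.HasAntidiagonal.antidiagonal T,
      wt α x.1 * wt β x.2 * f x.1 x.2 * (((x.1 : ℝ) + 1) * (x.1 + α) * h (x.1 + 1) x.2) := by
    rw [Finset.Nat.sum_antidiagonal_succ]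
    simp only [Nat.cast_zero, zero_sub, hf1, mul_zero, zero_mul, zero_add]
    refine Finset.sum_congr rfl fun x _ => ?_
    push_cast
    rw [wt_succ hα (by positivity), add_sub_cancel_right]
    push_cast; ring
  have h2 : ∑ x ∈ Finset.HasAntidiagonal.antidiagonal (T + 1),
      wt α x.1 * wt β x.2 * f x.1 (x.2 - 1) * h x.1 x.2 =
      ∑ x ∈ Finset.HasAntidiagonal.antidiagonal T,
      wt α x.1 * wt β x.2 * f x.1 x.2 * (((x.2 : ℝ) + 1) * (x.2 + β) * h x.1 (x.2 + 1)) := by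
    rw [Finset.Nat.sum_antidiagonal_succ']
    simp only [Nat.cast_zero, zero_sub, hf2, mul_zero, zero_mul, zero_add]
    refine Finset.sum_congr rfl fun x _ => ?_
    push_cast
    rw [wt_succ hβ (by positivity), add_sub_cancel_right]
    push_cast; ring
  simp only [mul_add, add_mul, Finset.sum_add_distrib] at h1 h2 ⊢
  rw [h1, h2]

/-- The inner product of two raised lowest weight vectors of total degree `T`. -/
def kapInner (α β n n' : ℤ) (T : ℕ) : ℝ :=
  ∑ x ∈ Finset.HasAntidiagonal.antidiagonal T,
    wt α x.1 * wt β x.2 * kap α β n x.1 x.2 * kap α β n' x.1 x.2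

lemma kapInner_comm (α β n n' : ℤ) (T : ℕ) : kapInner α β n n' T = kapInner α β n' n T :=
  Finset.sum_congr rfl fun _ _ => by ring

lemma kapInner_eq_zero_of_lt {α β n n' : ℤ} {T : ℕ} (h : T < n) : kapInner α β n n' T = 0 :=
  Finset.sum_eq_zero fun x hx => by
    rw [Finset.HasAntidiagonal.mem_antidiagonal] at hx
    rw [kap_eq_zero (n := n) (.inl (by omega))]; ring

lemma kapInner_succ {α β : ℤ} (hα : 1 ≤ α) (hβ : 1 ≤ β) {n n' : ℤ} {T : ℕ} (h : n ≤ T) :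
    kapInner α β n n' (T + 1) = (T + 1 - n') * (T + n' + α + β) * kapInner α β n n' T := by
  unfold kapInner
  have := sum_raise_eq_sum_lower hα hβ (kap α β n) (kap α β n')
    (fun t => kap_eq_zero (by omega)) (fun t => kap_eq_zero (by omega)) T
  rw [Finset.mul_sum]
  refine Eq.trans (Finset.sum_congr rfl fun x hx => ?_) (this.trans
    (Finset.sum_congr rfl fun x hx => ?_))
  · rw [Finset.HasAntidiagonal.mem_antidiagonal] at hx
    rw [kap_step (n := n) (by omega)]
  · rw [Finset.HasAntidiagonal.mem_antidiagonal] at hx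
    have h1 := kap_lower α β n' x.1 x.2
    have h2 : (T : ℝ) = x.1 + x.2 := by exact_mod_cast hx.symm
    push_cast at h1
    rw [h1, h2]; ring

lemma kapInner_of_lt {α β : ℤ} (hα : 1 ≤ α) (hβ : 1 ≤ β) {n n' : ℕ} (hn : n < n') (T : ℕ) :
    kapInner α β n n' T = 0 := by
  induction T with
  | zero => rw [kapInner_comm]; exact kapInner_eq_zero_of_lt (by push_cast; omega)
  | succ T ih =>
    by_cases h : n ≤ T
    · rw [kapInner_succ hα hβ (by exact_mod_cast h), ih, mul_zero]
    · rw [kapInner_comm]; exact kapInner_eq_zero_of_lt (by push_cast; omega)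

lemma kapInner_of_ne {α β : ℤ} (hα : 1 ≤ α) (hβ : 1 ≤ β) {n n' : ℕ} (hn : n ≠ n') (T : ℕ) :
    kapInner α β n n' T = 0 := by
  rcases hn.lt_or_gt with h | h
  · exact kapInner_of_lt hα hβ h T
  · rw [kapInner_comm]; exact kapInner_of_lt hα hβ h T

/-- The square of the normalisation constant `√(2 j - 1) Δ(j₁ j₂ j)`. -/
def nrmSq (α β n : ℤ) : ℝ :=
  (α + β + 2 * n - 1) *
    (zfac n * zfac (n + β - 1) * zfac (n + α - 1) * zfac (α + β + n - 2))

lemma nrmSq_pos {α β n : ℤ} (hα : 1 ≤ α) (hβ : 1 ≤ β) (hn : 0 ≤ n) : 0 < nrmSq α β n := by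
  have h : (0 : ℝ) < α + β + 2 * n - 1 := by
    have : 0 < α + β + 2 * n - 1 := by omega
    exact_mod_cast this
  exact mul_pos h (mul_pos (mul_pos (mul_pos (zfac_pos _) (zfac_pos _)) (zfac_pos _)) (zfac_pos _))

lemma kapInner_self {α β : ℤ} (hα : 1 ≤ α) (hβ : 1 ≤ β) (n N : ℕ) :
    nrmSq α β n * kapInner α β n n (n + N) = wt (α + β + 2 * n) N := by
  induction N with
  | zero =>
    have h1 : kapInner α β n n n = ∑ x ∈ Finset.HasAntidiagonal.antidiagonal n,
        zinv x.1 * zinv x.2 * zinv (α + x.1 - 1) * zinv (β + x.2 - 1) := by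
      refine Finset.sum_congr rfl fun x hx => ?_
      rw [Finset.HasAntidiagonal.mem_antidiagonal] at hx
      rw [kap_base (by omega)]
      have e : ((-1 : ℝ) ^ (x.1 : ℤ)) * (-1) ^ (x.1 : ℤ) = 1 := by
        rw [← mul_zpow]; norm_num
      have a1 := zfac_mul_zinv (k := x.1) (by positivity)
      have a2 := zfac_mul_zinv (k := x.2) (by positivity)
      have a3 := zfac_mul_zinv (k := α + x.1 - 1) (by omega)
      have a4 := zfac_mul_zinv (k := β + x.2 - 1) (by omega)
      unfold wt
      rw [show (x.1 : ℤ) + α - 1 = α + x.1 - 1 by ring,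
        show (x.2 : ℤ) + β - 1 = β + x.2 - 1 by ring]
      calc _ = (((-1 : ℝ) ^ (x.1 : ℤ)) * (-1) ^ (x.1 : ℤ)) *
            (zfac x.1 * zinv x.1) * (zfac x.2 * zinv x.2) *
            (zfac (α + x.1 - 1) * zinv (α + x.1 - 1)) * (zfac (β + x.2 - 1) * zinv (β + x.2 - 1)) *
            (zinv x.1 * zinv x.2 * zinv (α + x.1 - 1) * zinv (β + x.2 - 1)) := by ring
        _ = _ := by rw [e, a1, a2, a3, a4]; ring
    rw [add_zero, h1, sum_zinv_vandermonde hα hβ]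
    have a1 := zfac_mul_zinv (k := n) (by positivity)
    have a2 := zfac_mul_zinv (k := β + n - 1) (by omega)
    have a3 := zfac_mul_zinv (k := α + n - 1) (by omega)
    have a4 := zfac_mul_zinv (k := α + β + n - 2) (by omega)
    have a5 := zfac_pred (k := α + β + 2 * n - 1) (by omega)
    unfold nrmSq wt
    rw [show (n : ℤ) + β - 1 = β + n - 1 by ring, show (n : ℤ) + α - 1 = α + n - 1 by ring]
    rw [show ((0 : ℕ) : ℤ) + (α + β + 2 * n) - 1 = α + β + 2 * n - 1 by push_cast; ring, a5,
      show α + β + 2 * (n : ℤ) - 1 - 1 = α + β + 2 * n - 2 by ring,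
      show zfac ((0 : ℕ) : ℤ) = 1 by simp [zfac]]
    push_cast
    calc _ = ((α : ℝ) + β + 2 * n - 1) * zfac (α + β + 2 * n - 2) *
          (zfac n * zinv n) * (zfac (β + n - 1) * zinv (β + n - 1)) *
          (zfac (α + n - 1) * zinv (α + n - 1)) *
          (zfac (α + β + n - 2) * zinv (α + β + n - 2)) := by ring
      _ = _ := by rw [a1, a2, a3, a4]; ring
  | succ N ih =>
    rw [show n + (N + 1) = n + N + 1 by ring, kapInner_succ hα hβ (by push_cast; omega)]
    push_cast
    rw [wt_succ (by omega) (by positivity), ← ih]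
    push_cast; ring

/-- The Clebsch-Gordan coefficient `[j₁ j₂ j; j₁ + s, j₂ + t, j₁ + s + j₂ + t]` for
`2 j₁ = α`, `2 j₂ = β`, `j = j₁ + j₂ + n`: the coefficient `kap` relative to normalised vectors. -/
def ncg (α β n s t : ℤ) : ℝ :=
  √(nrmSq α β n) * √(wt α s * wt β t / wt (α + β + 2 * n) (s + t - n)) * kap α β n s t

lemma ncg_eq_zero {α β n s t : ℤ} (h : s + t < n ∨ s < 0 ∨ t < 0) : ncg α β n s t = 0 := by
  rw [ncg, kap_eq_zero h, mul_zero]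

lemma sum_ncg_mul_ncg {α β : ℤ} (hα : 1 ≤ α) (hβ : 1 ≤ β) {n n' T : ℕ} (hn : n ≤ T) :
    ∑ x ∈ Finset.HasAntidiagonal.antidiagonal T, ncg α β n x.1 x.2 * ncg α β n' x.1 x.2 =
      if n = n' then 1 else 0 := by
  have h : ∑ x ∈ Finset.HasAntidiagonal.antidiagonal T,
      ncg α β n x.1 x.2 * ncg α β n' x.1 x.2 =
      √(nrmSq α β n) * √(nrmSq α β n') * (1 / √(wt (α + β + 2 * n) (T - n))) *
        (1 / √(wt (α + β + 2 * n') (T - n'))) * kapInner α β n n' T := by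
    unfold kapInner
    rw [Finset.mul_sum]
    refine Finset.sum_congr rfl fun x hx => ?_
    rw [Finset.HasAntidiagonal.mem_antidiagonal] at hx
    have hT : (x.1 : ℤ) + x.2 = T := by exact_mod_cast hx
    have hw : 0 < wt α x.1 * wt β x.2 := mul_pos (wt_pos _ _) (wt_pos _ _)
    have hs := Real.mul_self_sqrt hw.le
    rw [ncg, ncg, hT, Real.sqrt_div hw.le, Real.sqrt_div hw.le]
    linear_combination √(nrmSq α β n) * √(nrmSq α β n') *
      (1 / √(wt (α + β + 2 * n) (T - n))) * (1 / √(wt (α + β + 2 * n') (T - n'))) *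
      kap α β n x.1 x.2 * kap α β n' x.1 x.2 * hs
  rw [h]
  split_ifs with hnn
  · subst hnn
    obtain ⟨N, rfl⟩ := Nat.exists_eq_add_of_le hn
    have h1 := kapInner_self hα hβ n N
    have h2 := Real.mul_self_sqrt (nrmSq_pos hα hβ (n := n) (by positivity)).le
    have h3 := wt_pos (α + β + 2 * n) N
    have h4 := Real.mul_self_sqrt h3.le
    rw [show ((n + N : ℕ) : ℤ) - n = N by push_cast; ring]
    have h5 : √(wt (α + β + 2 * n) N) ≠ 0 := (Real.sqrt_pos.mpr h3).ne'
    calc _ = (√(nrmSq α β n) * √(nrmSq α β n)) * kapInner α β n n (n + N) /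
        (√(wt (α + β + 2 * n) N) * √(wt (α + β + 2 * n) N)) := by field_simp
      _ = 1 := by rw [h2, h4, h1]; exact div_self h3.ne'
  · rw [kapInner_of_ne hα hβ hnn, mul_zero]

/-! ### The Clebsch-Gordan coefficients in the polynomial model -/

lemma raised_eq_sum (α β n : ℤ) (N : ℕ) (s t : ℤ) :
    raised α β n N s t = ∑ x ∈ Finset.HasAntidiagonal.antidiagonal N,
      (N.choose x.1 : ℝ) * lowest α β n (s - x.1) (t - x.2) := by
  induction N generalizing s t with
  | zero => simp [raised]
  | succ N ih =>
    rw [raised, ih, ih,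
      Finset.sum_antidiagonal_choose_succ_mul (fun i j => lowest α β n (s - i) (t - j)) N, add_comm]
    congr 1
    · refine Finset.sum_congr rfl fun x _ => ?_
      push_cast; rw [sub_sub, add_comm (1 : ℤ)]
    · refine Finset.sum_congr rfl fun x hx => ?_
      rw [Finset.HasAntidiagonal.mem_antidiagonal] at hx
      push_cast; rw [sub_sub, add_comm (1 : ℤ), show N.choose x.1 = N.choose x.2 by
        rw [← hx]; exact Nat.choose_symm_add]

lemma fac_eq {x : ℚ} {k : ℤ} (h : x = k) : fac x = zfac k := by
  subst h; rw [fac, zfac, ← Int.floor_toNat, Int.floor_intCast]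

lemma isNat_iff {x : ℚ} {k : ℤ} (h : x = k) : IsNat x ↔ 0 ≤ k := by
  subst h
  constructor
  · rintro ⟨n, hn⟩
    have : k = n := by exact_mod_cast hn
    omega
  · intro hk
    exact ⟨k.toNat, by exact_mod_cast (Int.toNat_of_nonneg hk).symm⟩

lemma invFac_eq {x : ℚ} {k : ℤ} (h : x = k) : invFac x = zinv k := by
  unfold invFac zinv
  simp only [isNat_iff h, fac_eq h]

lemma sgn_eq {x : ℚ} {k : ℤ} (h : x = k) : sgn x = (-1) ^ k := by
  subst h; simp [sgn]

/-- Twice a label, as a natural number. -/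
def dbl (a : Spin) : ℕ := a.2.choose

lemma dbl_pos (a : Spin) : 0 < dbl a := a.2.choose_spec.1

lemma coe_eq_dbl (a : Spin) : (a : ℚ) = (dbl a : ℚ) / 2 := a.2.choose_spec.2

lemma triad_iff {a b c : Spin} : Triad a b c ↔ ∃ n : ℕ, dbl c = dbl a + dbl b + 2 * n := by
  unfold Triad IsNat
  simp only [coe_eq_dbl]
  refine exists_congr fun n => ?_
  constructor
  · intro h
    have : (dbl c : ℚ) = dbl a + dbl b + 2 * n := by linarith
    exact_mod_cast this
  · intro h
    rw [h]; push_cast; ring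

lemma kap_eq_sum {α β n s t : ℤ} {N : ℕ} (h : s + t = n + N) :
    kap α β n s t = zfac N * ((-1) ^ s * ∑ z ∈ Finset.range (N + 1),
      (-1 : ℝ) ^ z * (zinv z * zinv (N - z) * zinv (s - z) * zinv (α + s - z - 1) *
        zinv (n - s + z) * zinv (β + n - s + z - 1))) := by
  rw [kap, show (s + t - n).toNat = N by omega, raised_eq_sum,
    Finset.Nat.sum_antidiagonal_eq_sum_range_succ_mk, Finset.mul_sum, Finset.mul_sum]
  refine Finset.sum_congr rfl fun z hz => ?_
  have hz' : z ≤ N := Finset.mem_range_succ_iff.mp hz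
  dsimp only
  rw [lowest, if_pos (by push_cast [hz']; omega), Nat.cast_choose ℝ hz',
    show t - ((N - z : ℕ) : ℤ) = n - s + z by push_cast [hz']; omega,
    zpow_sub₀ (by norm_num), zpow_natCast,
    zinv_nonneg (k := z) (by positivity), zinv_nonneg (k := N - z) (by omega),
    show ((N : ℤ) - z) = ((N - z : ℕ) : ℤ) by push_cast [hz']; rfl, zfac_natCast, zfac_natCast,
    zfac_natCast, show α + (s - z) - 1 = α + s - z - 1 by ring,
    show β + (n - s + z) - 1 = β + n - s + z - 1 by ring]
  have : (-1 : ℝ) ^ s / (-1) ^ z = (-1) ^ s * (-1) ^ z := by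
    rw [div_eq_mul_inv, ← inv_pow]; norm_num
  rw [this]
  ring

lemma sqrt_regroup {D h N s t s' t' d : ℝ} (hD : 0 ≤ D) (hh : 0 ≤ h) (hN : 0 < N) (hd : 0 < d) :
    √D * √(h * N * s * t * s' * t' / d) = √(h * D) * √(s * s' * (t * t') / (N * d)) * N := by
  rw [← Real.sqrt_mul hD, ← Real.sqrt_mul (by positivity)]
  conv_rhs => rhs; rw [← Real.sqrt_sq hN.le]
  rw [← Real.sqrt_mul' _ (sq_nonneg _)]
  congr 1
  field_simp

/-- The Clebsch-Gordan coefficients are the normalised coefficients of the polynomial model. -/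
lemma cg_eq_ncg {a b c : Spin} {n : ℕ} (hn : dbl c = dbl a + dbl b + 2 * n) {m₁ m₂ m : ℚ}
    {s t : ℤ} (h₁ : m₁ = a + s) (h₂ : m₂ = b + t) (h : m₁ + m₂ = m) :
    cg a b c m₁ m₂ m = ncg (dbl a) (dbl b) n s t := by
  have hc : (c : ℚ) = a + b + n := by
    rw [coe_eq_dbl, coe_eq_dbl a, coe_eq_dbl b, hn]; push_cast; ring
  have ha := coe_eq_dbl a
  have hb := coe_eq_dbl b
  have ha0 := dbl_pos a
  have hb0 := dbl_pos b
  set α := dbl a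
  set β := dbl b
  have e1 : m₁ - a = (s : ℤ) := by rw [h₁]; ring
  have e2 : m₂ - b = (t : ℤ) := by rw [h₂]; ring
  have e3 : m - c = ((s + t - n : ℤ) : ℚ) := by rw [← h, h₁, h₂, hc]; push_cast; ring
  by_cases hneg : s + t < n ∨ s < 0 ∨ t < 0
  · rw [ncg_eq_zero hneg, cg, if_neg]
    rw [isNat_iff e1, isNat_iff e2, isNat_iff e3]
    omega
  obtain ⟨N, hN⟩ : ∃ N : ℕ, s + t = n + N := ⟨(s + t - n).toNat, by omega⟩
  have e3 : m - c = ((N : ℤ) : ℚ) := by rw [e3]; congr 1; omega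
  rw [cg, if_pos ⟨triad_iff.mpr ⟨n, hn⟩, h, (isNat_iff e1).mpr (by omega),
    (isNat_iff e2).mpr (by omega), (isNat_iff e3).mpr (by omega)⟩]
  have hfl : ⌊m - (c : ℚ)⌋₊ = N := by rw [e3]; simp
  have hsum : ∀ z : ℕ, invFac z * invFac (m - c - z) * invFac (m₁ - a - z) *
      invFac (m₁ + a - z - 1) * invFac (c - b - m₁ + z) * invFac (c + b - m₁ + z - 1) =
      zinv z * zinv (N - z) * zinv (s - z) * zinv (α + s - z - 1) *
        zinv (n - s + z) * zinv (β + n - s + z - 1) := by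
    intro z
    rw [invFac_eq (x := z) (k := z) (by simp), invFac_eq (x := m - c - z) (k := N - z)
      (by rw [e3]; push_cast; ring), invFac_eq (x := m₁ - a - z) (k := s - z)
      (by rw [e1]; push_cast; ring), invFac_eq (x := m₁ + a - z - 1) (k := α + s - z - 1)
      (by rw [h₁, ha]; push_cast; ring), invFac_eq (x := c - b - m₁ + z) (k := n - s + z)
      (by rw [h₁, hc]; push_cast; ring), invFac_eq (x := c + b - m₁ + z - 1)
      (k := β + n - s + z - 1) (by rw [h₁, hc, hb]; push_cast; ring)]
  simp only [hsum, hfl]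
  rw [sgn_eq e1, ncg, kap_eq_sum hN, triDelta, fac_eq e3, fac_eq e1, fac_eq e2,
    fac_eq (x := c - a - b) (k := n) (by rw [hc]; push_cast; ring),
    fac_eq (x := c - a + b - 1) (k := n + β - 1) (by rw [hc, hb]; push_cast; ring),
    fac_eq (x := c + a - b - 1) (k := n + α - 1) (by rw [hc, ha]; push_cast; ring),
    fac_eq (x := c + a + b - 2) (k := α + β + n - 2) (by rw [hc, ha, hb]; push_cast; ring),
    fac_eq (x := m₁ + a - 1) (k := s + α - 1) (by rw [h₁, ha]; push_cast; ring),
    fac_eq (x := m₂ + b - 1) (k := t + β - 1) (by rw [h₂, hb]; push_cast; ring),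
    fac_eq (x := m + c - 1) (k := N + (α + β + 2 * n) - 1)
      (by rw [← h, h₁, h₂, hc, ha, hb]; push_cast
          have : (s : ℚ) + t = n + N := by exact_mod_cast hN
          linear_combination this)]
  have hs : s + t - n = N := by omega
  rw [hs]
  have h2c : ((2 * (c : ℚ) - 1 : ℚ) : ℝ) = α + β + 2 * n - 1 := by
    rw [hc, ha, hb]; push_cast; ring
  rw [h2c]
  have hpos : (0 : ℝ) ≤ α + β + 2 * n - 1 := by
    have : (1 : ℝ) ≤ α := by exact_mod_cast ha0
    have : (0 : ℝ) ≤ β := by positivity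
    have : (0 : ℝ) ≤ n := by positivity
    linarith
  have p := fun k => (zfac_pos k).le
  have key := sqrt_regroup (D := zfac n * zfac (n + β - 1) * zfac (n + α - 1) *
    zfac (α + β + n - 2)) (s := zfac s) (t := zfac t) (s' := zfac (s + α - 1))
    (t' := zfac (t + β - 1))
    (mul_nonneg (mul_nonneg (mul_nonneg (p _) (p _)) (p _)) (p _)) hpos (zfac_pos N)
    (zfac_pos (N + (α + β + 2 * n) - 1))
  unfold nrmSq wt
  push_cast
  linear_combination ((-1 : ℝ) ^ s * ∑ z ∈ Finset.range (N + 1),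
      (-1 : ℝ) ^ z * (zinv z * zinv (N - z) * zinv (s - z) * zinv (α + s - z - 1) *
        zinv (n - s + z) * zinv (β + n - s + z - 1))) * key

/-! ### The intertwining property -/

lemma sqrt_mul_sqrt_wt {α : ℤ} (hα : 1 ≤ α) {s : ℤ} (hs : 1 ≤ s) (B C : ℝ) :
    √((s * (s + α - 1) : ℝ)) * √(wt α (s - 1) * B / C) = √(wt α s * B / C) := by
  have h := wt_succ hα (s := s - 1) (by omega)
  rw [sub_add_cancel] at h
  push_cast at h
  have h0 : (0 : ℝ) ≤ s * (s + α - 1) := by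
    have : (0 : ℤ) ≤ s * (s + α - 1) := mul_nonneg (by omega) (by omega)
    exact_mod_cast this
  rw [h, ← Real.sqrt_mul h0]
  congr 1
  ring

/-- `kap_step` for normalised vectors: compatibility with `J_+`. -/
lemma ncg_step {α β : ℤ} (hα : 1 ≤ α) (hβ : 1 ≤ β) {n s t : ℤ} (h0 : 0 ≤ n)
    (hs : 0 ≤ s) (ht : 0 ≤ t) (h : n < s + t) :
    √(((s + t - n) * (s + t + n + α + β - 1) : ℝ)) * ncg α β n s t =
      √((s * (s + α - 1) : ℝ)) * ncg α β n (s - 1) t +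
      √((t * (t + β - 1) : ℝ)) * ncg α β n s (t - 1) := by
  have hJ : wt (α + β + 2 * n) (s + t - n) =
      (s + t - n) * (s + t + n + α + β - 1) * wt (α + β + 2 * n) (s + t - n - 1) := by
    have := wt_succ (α := α + β + 2 * n) (s := s + t - n - 1) (by omega) (by omega)
    rw [sub_add_cancel] at this
    rw [this]; push_cast; ring
  have c3 : (0 : ℝ) < (s + t - n) * (s + t + n + α + β - 1) := by
    have : (0 : ℤ) < (s + t - n) * (s + t + n + α + β - 1) := mul_pos (by omega) (by omega)
    exact_mod_cast this
  set W := √(wt α s * wt β t / wt (α + β + 2 * n) (s + t - n - 1)) with hW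
  have g1 : √((s * (s + α - 1) : ℝ)) * ncg α β n (s - 1) t =
      √(nrmSq α β n) * W * kap α β n (s - 1) t := by
    rcases hs.eq_or_lt with rfl | hs
    · rw [ncg_eq_zero (by omega), kap_eq_zero (by omega)]; ring
    · rw [ncg, hW, ← sqrt_mul_sqrt_wt hα (by omega : 1 ≤ s),
        show s - 1 + t - n = s + t - n - 1 by ring]
      ring
  have g2 : √((t * (t + β - 1) : ℝ)) * ncg α β n s (t - 1) =
      √(nrmSq α β n) * W * kap α β n s (t - 1) := by
    rcases ht.eq_or_lt with rfl | ht
    · rw [ncg_eq_zero (by omega), kap_eq_zero (by omega)]; ring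
    · rw [ncg, hW, mul_comm (wt α s), mul_comm (wt α s),
        ← sqrt_mul_sqrt_wt hβ (by omega : 1 ≤ t),
        show s + (t - 1) - n = s + t - n - 1 by ring]
      ring
  have g3 : √(((s + t - n) * (s + t + n + α + β - 1) : ℝ)) * ncg α β n s t =
      √(nrmSq α β n) * W * kap α β n s t := by
    rw [ncg, hW, hJ]
    have : √(((s + t - n) * (s + t + n + α + β - 1) : ℝ)) *
      √(wt α s * wt β t / ((s + t - n) * (s + t + n + α + β - 1) *
        wt (α + β + 2 * n) (s + t - n - 1))) =
      √(wt α s * wt β t / wt (α + β + 2 * n) (s + t - n - 1)) := by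
      rw [← Real.sqrt_mul c3.le, mul_div_assoc', mul_div_mul_left _ _ c3.ne']
    rw [← this]; ring
  rw [g1, g2, g3, kap_step h]; ring

/-- `kap_lower` for normalised vectors: compatibility with `J_-`. -/
lemma ncg_lower {α β : ℤ} (hα : 1 ≤ α) (hβ : 1 ≤ β) {n s t : ℤ} (h0 : 0 ≤ n)
    (hs : 0 ≤ s) (ht : 0 ≤ t) (h : n ≤ s + t) :
    √(((s + 1) * (s + α) : ℝ)) * ncg α β n (s + 1) t +
      √(((t + 1) * (t + β) : ℝ)) * ncg α β n s (t + 1) =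
    √(((s + t - n + 1) * (s + t + n + α + β) : ℝ)) * ncg α β n s t := by
  have hJ : wt (α + β + 2 * n) (s + t - n + 1) =
      (s + t - n + 1) * (s + t + n + α + β) * wt (α + β + 2 * n) (s + t - n) := by
    rw [wt_succ (by omega) (by omega)]; push_cast; ring
  have hS := wt_succ hα hs
  have hT := wt_succ hβ ht
  have c1 : (0 : ℝ) < (s + 1) * (s + α) := by
    have : (0 : ℤ) < (s + 1) * (s + α) := mul_pos (by omega) (by omega)
    exact_mod_cast this
  have c2 : (0 : ℝ) < (t + 1) * (t + β) := by
    have : (0 : ℤ) < (t + 1) * (t + β) := mul_pos (by omega) (by omega)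
    exact_mod_cast this
  have c3 : (0 : ℝ) < (s + t - n + 1) * (s + t + n + α + β) := by
    have : (0 : ℤ) < (s + t - n + 1) * (s + t + n + α + β) := mul_pos (by omega) (by omega)
    exact_mod_cast this
  have pS := wt_pos α s
  have pT := wt_pos β t
  have pJ := wt_pos (α + β + 2 * n) (s + t - n)
  have hk := kap_lower α β n s t
  rw [ncg, ncg, ncg, show s + 1 + t - n = s + t - n + 1 by ring,
    show s + (t + 1) - n = s + t - n + 1 by ring, hJ, hS, hT]
  set A := wt α s
  set B := wt β t
  set C := wt (α + β + 2 * n) (s + t - n)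
  have f1 : √(((s : ℝ) + 1) * (s + α)) * √((s + 1) * (s + α) * A * B /
      ((s + t - n + 1) * (s + t + n + α + β) * C)) =
      (s + 1) * (s + α) * √(A * B / C) / √((s + t - n + 1) * (s + t + n + α + β)) := by
    rw [show ((s : ℝ) + 1) * (s + α) * A * B / ((s + t - n + 1) * (s + t + n + α + β) * C) =
      (s + 1) * (s + α) * (A * B / C) / ((s + t - n + 1) * (s + t + n + α + β)) by field_simp,
      Real.sqrt_div (by positivity), Real.sqrt_mul c1.le, mul_div_assoc', ← mul_assoc,
      Real.mul_self_sqrt c1.le]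
  have f2 : √(((t : ℝ) + 1) * (t + β)) * √(A * ((t + 1) * (t + β) * B) /
      ((s + t - n + 1) * (s + t + n + α + β) * C)) =
      (t + 1) * (t + β) * √(A * B / C) / √((s + t - n + 1) * (s + t + n + α + β)) := by
    rw [show A * (((t : ℝ) + 1) * (t + β) * B) / ((s + t - n + 1) * (s + t + n + α + β) * C) =
      (t + 1) * (t + β) * (A * B / C) / ((s + t - n + 1) * (s + t + n + α + β)) by field_simp,
      Real.sqrt_div (by positivity), Real.sqrt_mul c2.le, mul_div_assoc', ← mul_assoc,
      Real.mul_self_sqrt c2.le]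
  have c3' := Real.mul_self_sqrt c3.le
  have c4 := (Real.sqrt_pos.mpr c3).ne'
  set r := √(((s : ℝ) + t - n + 1) * (s + t + n + α + β))
  calc _ = √(nrmSq α β n) * (√(((s : ℝ) + 1) * (s + α)) * √((s + 1) * (s + α) * A * B /
      ((s + t - n + 1) * (s + t + n + α + β) * C))) * kap α β n (s + 1) t +
      √(nrmSq α β n) * (√(((t : ℝ) + 1) * (t + β)) * √(A * ((t + 1) * (t + β) * B) /
      ((s + t - n + 1) * (s + t + n + α + β) * C))) * kap α β n s (t + 1) := by ring
    _ = √(nrmSq α β n) * √(A * B / C) / r * (((s : ℝ) + 1) * (s + α) * kap α β n (s + 1) t +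
        (t + 1) * (t + β) * kap α β n s (t + 1)) := by rw [f1, f2]; ring
    _ = √(nrmSq α β n) * √(A * B / C) / r * (r * r * kap α β n s t) := by rw [hk, c3']
    _ = _ := by field_simp

/-- `J_-` kills the coupled vector of lowest weight. -/
lemma ncg_lower_lowest {α β : ℤ} (hα : 1 ≤ α) (hβ : 1 ≤ β) {n s t : ℤ}
    (hs : 0 ≤ s) (ht : 0 ≤ t) (h : s + t + 1 = n) :
    √(((s + 1) * (s + α) : ℝ)) * ncg α β n (s + 1) t +
      √(((t + 1) * (t + β) : ℝ)) * ncg α β n s (t + 1) = 0 := by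
  have c1 : (0 : ℝ) ≤ (s + 1) * (s + α) := by
    have : (0 : ℤ) ≤ (s + 1) * (s + α) := mul_nonneg (by omega) (by omega)
    exact_mod_cast this
  have c2 : (0 : ℝ) ≤ (t + 1) * (t + β) := by
    have : (0 : ℤ) ≤ (t + 1) * (t + β) := mul_nonneg (by omega) (by omega)
    exact_mod_cast this
  have aux : ∀ x y : ℝ, 0 ≤ x → √x * √(x * y) = x * √y := fun x y hx => by
    rw [Real.sqrt_mul hx, ← mul_assoc, Real.mul_self_sqrt hx]
  have hk := kap_lower α β n s t
  rw [show ((s : ℝ) + t - n + 1) = 0 by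
    have : (s : ℝ) + t + 1 = n := by exact_mod_cast h
    linarith, zero_mul, zero_mul] at hk
  set X := wt α s * wt β t / wt (α + β + 2 * n) 0
  have e1 : wt α (s + 1) * wt β t / wt (α + β + 2 * n) (s + 1 + t - n) =
      (s + 1) * (s + α) * X := by
    rw [wt_succ hα hs, show s + 1 + t - n = 0 by omega]; ring
  have e2 : wt α s * wt β (t + 1) / wt (α + β + 2 * n) (s + (t + 1) - n) =
      (t + 1) * (t + β) * X := by
    rw [wt_succ hβ ht, show s + (t + 1) - n = 0 by omega]; ring
  rw [ncg, ncg, e1, e2]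
  linear_combination √(nrmSq α β n) * kap α β n (s + 1) t * aux _ X c1 +
    √(nrmSq α β n) * kap α β n s (t + 1) * aux _ X c2 + √(nrmSq α β n) * √X * hk

lemma coupled_cg {a b c : Spin} {n : ℕ} (hn : dbl c = dbl a + dbl b + 2 * n) (k : ℕ) :
    coupled cg a b c k = ∑ x ∈ Finset.HasAntidiagonal.antidiagonal (n + k),
      (ncg (dbl a) (dbl b) n x.1 x.2 : ℂ) • (ket x.1 ⊗ₜ[ℂ] ket x.2) := by
  have hc : (c : ℚ) = a + b + n := by
    rw [coe_eq_dbl, coe_eq_dbl a, coe_eq_dbl b, hn]; push_cast; ring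
  have hfl : ⌊(k : ℚ) + c - a - b⌋₊ = n + k := by
    rw [hc, show (k : ℚ) + (a + b + n) - a - b = ((n + k : ℕ) : ℚ) by push_cast; ring,
      Nat.floor_natCast]
  rw [coupled, hfl]
  refine Finset.sum_congr rfl fun x hx => ?_
  rw [Finset.HasAntidiagonal.mem_antidiagonal] at hx
  rw [cg_eq_ncg hn (s := x.1) (t := x.2) (by simp) (by simp)]
  rw [hc]
  have : (x.1 : ℚ) + x.2 = n + k := by exact_mod_cast hx
  linear_combination this

lemma linearCombination_ket (v : ℕ → Rep) (k : ℕ) :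
    Finsupp.linearCombination ℂ v (ket k) = v k := by simp [ket]

lemma linearCombination_ket' (v : ℕ → Rep ⊗[ℂ] Rep) (k : ℕ) :
    Finsupp.linearCombination ℂ v (ket k) = v k := by simp [ket]

lemma coproduct_coupled (A B : Rep →ₗ[ℂ] Rep) (f : ℕ × ℕ → ℂ) (T : ℕ) :
    coproduct A B (∑ x ∈ Finset.HasAntidiagonal.antidiagonal T,
      f x • (ket x.1 ⊗ₜ[ℂ] ket x.2)) =
    ∑ x ∈ Finset.HasAntidiagonal.antidiagonal T, f x • (A (ket x.1) ⊗ₜ[ℂ] ket x.2) +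
    ∑ x ∈ Finset.HasAntidiagonal.antidiagonal T, f x • (ket x.1 ⊗ₜ[ℂ] B (ket x.2)) := by
  simp only [coproduct, map_sum, map_smul, LinearMap.add_apply, TensorProduct.map_tmul,
    LinearMap.id_apply, smul_add, Finset.sum_add_distrib]

theorem cg_commutes_Jz {a b c : Spin} {n : ℕ} (hn : dbl c = dbl a + dbl b + 2 * n) :
    coupling cg a b c ∘ₗ Jz c = coproduct (Jz a) (Jz b) ∘ₗ coupling cg a b c := by
  have hc : (c : ℚ) = a + b + n := by
    rw [coe_eq_dbl, coe_eq_dbl a, coe_eq_dbl b, hn]; push_cast; ring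
  refine Finsupp.lhom_ext' fun k => LinearMap.ext_ring ?_
  change coupling cg a b c (Jz c (ket k)) = coproduct (Jz a) (Jz b) (coupling cg a b c (ket k))
  simp only [Jz, coupling, linearCombination_ket, linearCombination_ket', map_smul]
  rw [coupled_cg hn, coproduct_coupled, Finset.smul_sum, ← Finset.sum_add_distrib]
  refine Finset.sum_congr rfl fun x hx => ?_
  rw [Finset.HasAntidiagonal.mem_antidiagonal] at hx
  rw [linearCombination_ket, linearCombination_ket, ← TensorProduct.smul_tmul',
    TensorProduct.tmul_smul, smul_smul, smul_smul, smul_smul, ← add_smul]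
  congr 1
  have h : (c : ℚ) + k = (a + x.1) + (b + x.2) := by
    have : (x.1 : ℚ) + x.2 = n + k := by exact_mod_cast hx
    rw [hc]; linear_combination -this
  rw [h]
  push_cast
  ring

theorem cg_commutes_Jplus {a b c : Spin} {n : ℕ} (hn : dbl c = dbl a + dbl b + 2 * n) :
    coupling cg a b c ∘ₗ Jplus c = coproduct (Jplus a) (Jplus b) ∘ₗ coupling cg a b c := by
  refine Finsupp.lhom_ext' fun k => LinearMap.ext_ring ?_
  change coupling cg a b c (Jplus c (ket k)) =
    coproduct (Jplus a) (Jplus b) (coupling cg a b c (ket k))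
  simp only [Jplus, coupling, linearCombination_ket, linearCombination_ket', map_smul]
  rw [coupled_cg hn, coupled_cg hn, coproduct_coupled, Finset.smul_sum]
  simp only [linearCombination_ket, ← TensorProduct.smul_tmul', TensorProduct.tmul_smul, smul_smul]
  have h1 : ∑ x ∈ Finset.HasAntidiagonal.antidiagonal (n + k + 1),
      (((√((x.1 * (x.1 + dbl a - 1) : ℝ)) * ncg (dbl a) (dbl b) n (x.1 - 1) x.2 : ℝ) : ℂ)) •
        (ket x.1 ⊗ₜ[ℂ] ket x.2) =
      ∑ x ∈ Finset.HasAntidiagonal.antidiagonal (n + k),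
      ((ncg (dbl a) (dbl b) n x.1 x.2 : ℂ) *
        ((√(((2 * (a : ℚ) + x.1) * (x.1 + 1) : ℚ) : ℝ) : ℝ) : ℂ)) •
        (ket (x.1 + 1) ⊗ₜ[ℂ] ket x.2) := by
    rw [Finset.Nat.sum_antidiagonal_succ, ncg_eq_zero (by right; left; simp)]
    rw [mul_zero, Complex.ofReal_zero, zero_smul, zero_add]
    refine Finset.sum_congr rfl fun x _ => ?_
    congr 1
    rw [← Complex.ofReal_mul]
    congr 1
    rw [mul_comm, coe_eq_dbl a]
    push_cast
    rw [add_sub_cancel_right]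
    congr 2
    ring
  have h2 : ∑ x ∈ Finset.HasAntidiagonal.antidiagonal (n + k + 1),
      (((√((x.2 * (x.2 + dbl b - 1) : ℝ)) * ncg (dbl a) (dbl b) n x.1 (x.2 - 1) : ℝ) : ℂ)) •
        (ket x.1 ⊗ₜ[ℂ] ket x.2) =
      ∑ x ∈ Finset.HasAntidiagonal.antidiagonal (n + k),
      ((ncg (dbl a) (dbl b) n x.1 x.2 : ℂ) *
        ((√(((2 * (b : ℚ) + x.2) * (x.2 + 1) : ℚ) : ℝ) : ℝ) : ℂ)) •
        (ket x.1 ⊗ₜ[ℂ] ket (x.2 + 1)) := by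
    rw [Finset.Nat.sum_antidiagonal_succ', ncg_eq_zero (by right; right; simp)]
    rw [mul_zero, Complex.ofReal_zero, zero_smul, zero_add]
    refine Finset.sum_congr rfl fun x _ => ?_
    congr 1
    rw [← Complex.ofReal_mul]
    congr 1
    rw [mul_comm, coe_eq_dbl b]
    push_cast
    rw [add_sub_cancel_right]
    congr 2
    ring
  rw [← h1, ← h2, ← Finset.sum_add_distrib, ← add_assoc]
  refine Finset.sum_congr rfl fun x hx => ?_
  rw [Finset.HasAntidiagonal.mem_antidiagonal] at hx
  rw [← add_smul]
  congr 1
  have ha := dbl_pos a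
  have hb := dbl_pos b
  have h3 := ncg_step (α := dbl a) (β := dbl b) (n := n) (s := x.1) (t := x.2)
    (by omega) (by omega) (by omega) (by omega) (by omega) (by omega)
  push_cast at h3
  rw [← Complex.ofReal_mul, ← Complex.ofReal_add, ← h3]
  congr 3
  have : (x.1 : ℝ) + x.2 = n + k + 1 := by exact_mod_cast hx
  rw [coe_eq_dbl c, hn, this]
  push_cast
  ring

theorem cg_commutes_Jminus {a b c : Spin} {n : ℕ} (hn : dbl c = dbl a + dbl b + 2 * n) :
    coupling cg a b c ∘ₗ Jminus c = coproduct (Jminus a) (Jminus b) ∘ₗ coupling cg a b c := by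
  refine Finsupp.lhom_ext' fun k => LinearMap.ext_ring ?_
  change coupling cg a b c (Jminus c (ket k)) =
    coproduct (Jminus a) (Jminus b) (coupling cg a b c (ket k))
  simp only [Jminus, coupling, linearCombination_ket, linearCombination_ket', map_smul]
  rw [coupled_cg hn, coupled_cg hn, coproduct_coupled, Finset.smul_sum]
  simp only [linearCombination_ket, ← TensorProduct.smul_tmul', TensorProduct.tmul_smul, smul_smul]
  have ha := dbl_pos a
  have hb := dbl_pos b
  obtain h0 | ⟨m, hm⟩ : n + k = 0 ∨ ∃ m, n + k = m + 1 := by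
    rcases h : n + k with _ | m
    · exact .inl rfl
    · exact .inr ⟨m, rfl⟩
  · obtain ⟨rfl, rfl⟩ : n = 0 ∧ k = 0 := by omega
    simp
  have h1 : ∑ x ∈ Finset.HasAntidiagonal.antidiagonal (n + k),
      ((ncg (dbl a) (dbl b) n x.1 x.2 : ℂ) *
        (-(√((x.1 * (2 * (a : ℚ) + x.1 - 1) : ℚ) : ℝ) : ℝ) : ℂ)) •
        (ket (x.1 - 1) ⊗ₜ[ℂ] ket x.2) =
      ∑ x ∈ Finset.HasAntidiagonal.antidiagonal m,
      ((-(√((x.1 + 1) * (x.1 + dbl a) : ℝ) * ncg (dbl a) (dbl b) n (x.1 + 1) x.2) : ℝ) : ℂ) •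
        (ket x.1 ⊗ₜ[ℂ] ket x.2) := by
    rw [hm, Finset.Nat.sum_antidiagonal_succ]
    simp only [Nat.cast_zero, zero_mul, Rat.cast_zero, Real.sqrt_zero, Complex.ofReal_zero,
      neg_zero, mul_zero, zero_smul, zero_add]
    refine Finset.sum_congr rfl fun x _ => ?_
    rw [Nat.add_sub_cancel]
    congr 1
    rw [← Complex.ofReal_neg, ← Complex.ofReal_mul]
    congr 1
    rw [mul_comm, coe_eq_dbl a]
    push_cast
    rw [neg_mul]
    congr 4
    ring
  have h2 : ∑ x ∈ Finset.HasAntidiagonal.antidiagonal (n + k),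
      ((ncg (dbl a) (dbl b) n x.1 x.2 : ℂ) *
        (-(√((x.2 * (2 * (b : ℚ) + x.2 - 1) : ℚ) : ℝ) : ℝ) : ℂ)) •
        (ket x.1 ⊗ₜ[ℂ] ket (x.2 - 1)) =
      ∑ x ∈ Finset.HasAntidiagonal.antidiagonal m,
      ((-(√((x.2 + 1) * (x.2 + dbl b) : ℝ) * ncg (dbl a) (dbl b) n x.1 (x.2 + 1)) : ℝ) : ℂ) •
        (ket x.1 ⊗ₜ[ℂ] ket x.2) := by
    rw [hm, Finset.Nat.sum_antidiagonal_succ']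
    simp only [Nat.cast_zero, zero_mul, Rat.cast_zero, Real.sqrt_zero, Complex.ofReal_zero,
      neg_zero, mul_zero, zero_smul, zero_add]
    refine Finset.sum_congr rfl fun x _ => ?_
    rw [Nat.add_sub_cancel]
    congr 1
    rw [← Complex.ofReal_neg, ← Complex.ofReal_mul]
    congr 1
    rw [mul_comm, coe_eq_dbl b]
    push_cast
    rw [neg_mul]
    congr 4
    ring
  rw [h1, h2, ← Finset.sum_add_distrib]
  rcases k.eq_zero_or_pos with rfl | hk
  · simp only [Nat.cast_zero, zero_mul, Rat.cast_zero, Real.sqrt_zero, Complex.ofReal_zero,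
      neg_zero, zero_smul, Finset.sum_const_zero]
    symm
    refine Finset.sum_eq_zero fun x hx => ?_
    rw [Finset.HasAntidiagonal.mem_antidiagonal] at hx
    have h4 := ncg_lower_lowest (α := dbl a) (β := dbl b) (n := n) (s := x.1) (t := x.2)
      (by omega) (by omega) (by omega) (by omega) (by omega)
    push_cast at h4
    rw [← add_smul, ← Complex.ofReal_add, ← neg_add, h4]
    simp
  · rw [show n + (k - 1) = m by omega]
    refine Finset.sum_congr rfl fun x hx => ?_
    rw [Finset.HasAntidiagonal.mem_antidiagonal] at hx
    rw [← add_smul]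
    congr 1
    have h3 := ncg_lower (α := dbl a) (β := dbl b) (n := n) (s := x.1) (t := x.2)
      (by omega) (by omega) (by omega) (by omega) (by omega) (by omega)
    push_cast at h3
    rw [← Complex.ofReal_add, ← neg_add, h3, ← Complex.ofReal_neg, ← Complex.ofReal_mul,
      ← neg_mul]
    congr 4
    have : (x.1 : ℝ) + x.2 = n + k - 1 := by
      have : (x.1 : ℝ) + x.2 + 1 = n + k := by exact_mod_cast (by omega : x.1 + x.2 + 1 = n + k)
      linarith
    rw [coe_eq_dbl c, hn, this]
    push_cast
    ring

theorem isClebschGordan_cg : IsClebschGordan cg := by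
  intro a b c h
  obtain ⟨n, hn⟩ := triad_iff.mp h
  refine ⟨cg_commutes_Jz hn, cg_commutes_Jplus hn, cg_commutes_Jminus hn, fun k => ?_⟩
  have hc : (c : ℚ) = a + b + n := by
    rw [coe_eq_dbl, coe_eq_dbl a, coe_eq_dbl b, hn]; push_cast; ring
  have hfl : ⌊(k : ℚ) + c - a - b⌋₊ = n + k := by
    rw [hc, show (k : ℚ) + (a + b + n) - a - b = ((n + k : ℕ) : ℚ) by push_cast; ring,
      Nat.floor_natCast]
  have ha := dbl_pos a
  have hb := dbl_pos b
  have key := sum_ncg_mul_ncg (α := dbl a) (β := dbl b) (by omega) (by omega) (n := n) (n' := n)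
    (T := n + k) (by omega)
  rw [if_pos rfl] at key
  rw [hfl, ← key]
  refine Finset.sum_congr rfl fun x hx => ?_
  rw [Finset.HasAntidiagonal.mem_antidiagonal] at hx
  rw [cg_eq_ncg hn (s := x.1) (t := x.2) (by simp) (by simp), sq]
  rw [hc]
  have : (x.1 : ℚ) + x.2 = n + k := by exact_mod_cast hx
  linear_combination this

/-! ### Recoupling of three representations in the polynomial model -/

lemma kap_zero_right (α β : ℤ) (n v : ℕ) :
    kap α β n (n + v) 0 = (-1) ^ n * (zinv n * zinv (α + n - 1) * zinv (β - 1)) := by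
  induction v with
  | zero =>
    rw [kap_base (by simp), zinv_zero]; push_cast; rw [add_zero, add_zero, zpow_natCast]; ring
  | succ v ih =>
    rw [kap_step (by push_cast; omega), kap_eq_zero (t := 0 - 1) (by omega), ← ih]
    push_cast
    rw [add_zero, ← add_assoc, add_sub_cancel_right]

lemma kap_zero_left (α β : ℤ) (n v : ℕ) :
    kap α β n 0 (n + v) = zinv n * zinv (α - 1) * zinv (β + n - 1) := by
  induction v with
  | zero => rw [kap_base (by simp), zinv_zero]; push_cast; rw [add_zero, add_zero, zpow_zero]; ring
  | succ v ih =>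
    rw [kap_step (by push_cast; omega), kap_eq_zero (s := 0 - 1) (by omega), ← ih]
    push_cast
    rw [zero_add, ← add_assoc, add_sub_cancel_right]

/-- The coefficients of a vector of the tensor product of three representations that is killed by
`J_-` in degree `n`, together with the vectors obtained from it by `J_+`. -/
structure IsTripleTower (α β γ n : ℤ) (f : ℤ → ℤ → ℤ → ℝ) : Prop where
  zero : ∀ s t u, s + t + u < n ∨ s < 0 ∨ t < 0 ∨ u < 0 → f s t u = 0
  step : ∀ s t u, n < s + t + u → f s t u = f (s - 1) t u + f s (t - 1) u + f s t (u - 1)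
  lower : ∀ s t u, s + t + u + 1 = n → ((s : ℝ) + 1) * (s + α) * f (s + 1) t u +
    (t + 1) * (t + β) * f s (t + 1) u + (u + 1) * (u + γ) * f s t (u + 1) = 0

/-- A lowest weight vector is determined by its monomials that do not involve the second
variable, because `J_-` expresses the others through them. -/
lemma IsTripleTower.eq_zero {α β γ : ℤ} {n : ℕ} (hβ : 1 ≤ β) {f : ℤ → ℤ → ℤ → ℝ}
    (hf : IsTripleTower α β γ n f) (h0 : ∀ s u : ℕ, s + u = n → f s 0 u = 0) (s t u : ℤ) :
    f s t u = 0 := by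
  have base : ∀ (t : ℕ) (s u : ℤ), s + t + u = n → f s t u = 0 := by
    intro t
    induction t with
    | zero =>
      intro s u h
      by_cases hneg : s < 0 ∨ u < 0
      · exact hf.zero _ _ _ (by tauto)
      · have := h0 s.toNat u.toNat (by omega)
        rwa [Int.toNat_of_nonneg (by omega), Int.toNat_of_nonneg (by omega)] at this
    | succ t ih =>
      intro s u h
      push_cast at h ⊢
      have h1 := hf.lower s t u (by omega)
      rw [ih _ _ (by omega), ih _ _ (by omega)] at h1
      have h2 : ((t : ℝ) + 1) * (t + β) ≠ 0 := by
        have : (1 : ℝ) ≤ β := by exact_mod_cast hβ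
        positivity
      push_cast at h1
      simpa [h2] using h1
  by_cases hneg : s + t + u < n ∨ s < 0 ∨ t < 0 ∨ u < 0
  · exact hf.zero _ _ _ hneg
  obtain ⟨L, hL⟩ : ∃ L : ℕ, s + t + u = n + L := ⟨(s + t + u - n).toNat, by omega⟩
  clear hneg
  induction L generalizing s t u with
  | zero =>
    by_cases ht : t < 0
    · exact hf.zero _ _ _ (by omega)
    · have := base t.toNat s u (by push_cast at hL; omega)
      rwa [Int.toNat_of_nonneg (by omega)] at this
  | succ L ih =>
    push_cast at hL
    rw [hf.step _ _ _ (by omega), ih _ _ _ (by omega), ih _ _ _ (by omega), ih _ _ _ (by omega)]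
    ring

lemma IsTripleTower.sub {α β γ n : ℤ} {f g : ℤ → ℤ → ℤ → ℝ} (hf : IsTripleTower α β γ n f)
    (hg : IsTripleTower α β γ n g) : IsTripleTower α β γ n (fun s t u => f s t u - g s t u) where
  zero s t u h := by rw [hf.zero s t u h, hg.zero s t u h, sub_zero]
  step s t u h := by rw [hf.step s t u h, hg.step s t u h]; ring
  lower s t u h := by linear_combination hf.lower s t u h - hg.lower s t u h

lemma IsTripleTower.sum {α β γ n : ℤ} {ι : Type*} (S : Finset ι) (c : ι → ℝ)
    {f : ι → ℤ → ℤ → ℤ → ℝ} (hf : ∀ i ∈ S, IsTripleTower α β γ n (f i)) :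
    IsTripleTower α β γ n (fun s t u => ∑ i ∈ S, c i * f i s t u) where
  zero s t u h := Finset.sum_eq_zero fun i hi => by rw [(hf i hi).zero s t u h, mul_zero]
  step s t u h := by
    simp only [← Finset.sum_add_distrib]
    exact Finset.sum_congr rfl fun i hi => by rw [(hf i hi).step s t u h]; ring
  lower s t u h := by
    simp only [Finset.mul_sum, ← Finset.sum_add_distrib]
    exact Finset.sum_eq_zero fun i hi => by linear_combination c i * (hf i hi).lower s t u h

/-- The scheme `((j₁ j₂) j₃)`, with `j₁₂ = j₁ + j₂ + i` and `j = j₁₂ + j₃ + N`. -/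
def kapLeft (α β γ i N s t u : ℤ) : ℝ :=
  kap α β i s t * kap (α + β + 2 * i) γ N (s + t - i) u

/-- The scheme `(j₁ (j₂ j₃))`, with `j₂₃ = j₂ + j₃ + l` and `j = j₁ + j₂₃ + M`. -/
def kapRight (α β γ l M s t u : ℤ) : ℝ :=
  kap β γ l t u * kap α (β + γ + 2 * l) M s (t + u - l)

lemma isTripleTower_kapLeft (α β γ i N : ℤ) :
    IsTripleTower α β γ (i + N) (kapLeft α β γ i N) where
  zero s t u h := by
    unfold kapLeft
    by_cases h1 : s + t < i ∨ s < 0 ∨ t < 0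
    · rw [kap_eq_zero h1, zero_mul]
    · rw [kap_eq_zero (n := N) (by omega), mul_zero]
  step s t u h := by
    unfold kapLeft
    rw [kap_step (n := N) (by omega)]
    rw [show s - 1 + t - i = s + t - i - 1 by ring, show s + (t - 1) - i = s + t - i - 1 by ring]
    by_cases h1 : i < s + t
    · have := kap_step (α := α) (β := β) h1
      linear_combination kap (α + β + 2 * i) γ N (s + t - i - 1) u * this
    · rw [kap_eq_zero (n := N) (s := s + t - i - 1) (by omega)]; ring
  lower s t u h := by
    unfold kapLeft
    have h1 := kap_lower α β i s t
    have h2 := kap_lower (α + β + 2 * i) γ N (s + t - i) u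
    have h3 : ((s : ℝ) + t + u + 1) = i + N := by exact_mod_cast h
    rw [show s + 1 + t - i = s + t - i + 1 by ring, show s + (t + 1) - i = s + t - i + 1 by ring]
    rw [show (((s + t - i : ℤ) : ℝ) + u - N + 1) = 0 by push_cast; linarith, zero_mul,
      zero_mul] at h2
    push_cast at h2
    linear_combination kap (α + β + 2 * i) γ N (s + t - i + 1) u * h1 + kap α β i s t * h2

lemma isTripleTower_kapRight (α β γ l M : ℤ) :
    IsTripleTower α β γ (l + M) (kapRight α β γ l M) where
  zero s t u h := by
    unfold kapRight
    by_cases h1 : t + u < l ∨ t < 0 ∨ u < 0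
    · rw [kap_eq_zero h1, zero_mul]
    · rw [kap_eq_zero (n := M) (by omega), mul_zero]
  step s t u h := by
    unfold kapRight
    rw [kap_step (n := M) (by omega)]
    rw [show t - 1 + u - l = t + u - l - 1 by ring, show t + (u - 1) - l = t + u - l - 1 by ring]
    by_cases h1 : l < t + u
    · have := kap_step (α := β) (β := γ) h1
      linear_combination kap α (β + γ + 2 * l) M s (t + u - l - 1) * this
    · rw [kap_eq_zero (n := M) (t := t + u - l - 1) (by omega)]; ring
  lower s t u h := by
    unfold kapRight
    have h1 := kap_lower β γ l t u
    have h2 := kap_lower α (β + γ + 2 * l) M s (t + u - l)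
    have h3 : ((s : ℝ) + t + u + 1) = l + M := by exact_mod_cast h
    rw [show t + 1 + u - l = t + u - l + 1 by ring, show t + (u + 1) - l = t + u - l + 1 by ring]
    rw [show ((s : ℝ) + (t + u - l : ℤ) - M + 1) = 0 by push_cast; linarith, zero_mul,
      zero_mul] at h2
    push_cast at h2
    linear_combination kap α (β + γ + 2 * l) M s (t + u - l + 1) * h1 + kap β γ l t u * h2

/-- The inverse of the triangular matrix `1 / ((s - i)! (σ + i + s - 1)!)`: the sum telescopes. -/
lemma sum_triangular_inverse {σ : ℤ} (hσ : 2 ≤ σ) {n k s : ℕ} (hs : s ≤ n) :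
    ∑ i ∈ Finset.range (n + 1), (2 * (i : ℝ) + σ - 1) * ((-1) ^ (i + k) *
      zfac (σ + i + k - 2) * zinv (i - k)) * (zinv (s - i) * zinv (σ + i + s - 1)) =
    if k = s then 1 else 0 := by
  split_ifs with hks
  · subst hks
    rw [Finset.sum_eq_single k]
    · rw [sub_self, zinv_zero, ← two_mul, pow_mul]
      have h1 := zfac_pred (k := σ + k + k - 1) (by omega)
      have h2 := zfac_mul_zinv (k := σ + k + k - 1) (by omega)
      rw [h1, show σ + (k : ℤ) + k - 1 - 1 = σ + k + k - 2 by ring] at h2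
      push_cast at h2
      norm_num
      linear_combination h2
    · intro i _ hik
      rcases lt_or_gt_of_ne hik with h | h
      · rw [zinv_neg (k := (i : ℤ) - k) (by omega)]; ring
      · rw [zinv_neg (k := (k : ℤ) - i) (by omega)]; ring
    · intro h; simp at h; omega
  · -- After multiplication by `s - k` the summand is the difference of consecutive values of `G`.
    set G : ℕ → ℝ := fun i => -((-1) ^ (i + k) * zfac (σ + i + k - 2) * zinv (i - 1 - k) *
      (zinv (s - i) * zinv (σ + i + s - 2))) with hG
    have hne : (s : ℝ) - k ≠ 0 := sub_ne_zero.mpr (by exact_mod_cast Ne.symm hks)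
    apply mul_left_cancel₀ hne
    rw [mul_zero, Finset.mul_sum]
    have htel : ∀ i ∈ Finset.range (n + 1), ((s : ℝ) - k) *
        ((2 * (i : ℝ) + σ - 1) * ((-1) ^ (i + k) *
      zfac (σ + i + k - 2) * zinv (i - k)) * (zinv (s - i) * zinv (σ + i + s - 1))) =
        G (i + 1) - G i := by
      intro i _
      simp only [hG]
      have h1 := zfac_succ (k := σ + i + k - 2) (by omega)
      have h2 := mul_zinv (s - i)
      have h3 := mul_zinv (i - k)
      have h4 := mul_zinv (σ + i + s - 1)
      push_cast at h1 h2 h3 h4 ⊢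
      rw [show σ + ((i : ℤ) + 1) + k - 2 = σ + i + k - 2 + 1 by ring, h1,
        show (i : ℤ) + 1 - 1 - k = i - k by ring, show (s : ℤ) - (i + 1) = s - i - 1 by ring, ← h2,
        show σ + ((i : ℤ) + 1) + s - 2 = σ + i + s - 1 by ring,
        show (i : ℤ) - 1 - k = i - k - 1 by ring, ← h3,
        show σ + (i : ℤ) + s - 2 = σ + i + s - 1 - 1 by ring, ← h4]
      rw [show i + 1 + k = i + k + 1 by ring, pow_succ]
      ring
    rw [Finset.sum_congr rfl htel, Finset.sum_range_sub]
    simp only [hG]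
    rw [zinv_neg (k := (s : ℤ) - (n + 1 : ℕ)) (by omega),
      zinv_neg (k := ((0 : ℕ) : ℤ) - 1 - k) (by omega)]
    ring

/-- The coefficients of the scheme `(j₁ (j₂ j₃))` on the slice without second variable, freed of
the factors that do not enter the triangular system. -/
def sliceCoeff (α β γ n l k : ℤ) : ℝ :=
  zfac (n - k) * zfac (γ + n - k - 1) * zinv k * zinv (n - l - k) * zinv (α + k - 1) *
    zinv (β + γ + l + n - 1 - k)

/-- The recoupling coefficients of the polynomial model. -/
def kapRec (α β γ : ℤ) (n i l : ℕ) : ℝ :=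
  zfac i * zfac (α + i - 1) * zinv l * zinv (γ + l - 1) *
    ((2 * (i : ℝ) + (α + β : ℤ) - 1) * ∑ k ∈ Finset.range (n + 1),
      ((-1) ^ (i + k) * zfac (α + β + i + k - 2) * zinv (i - k)) * sliceCoeff α β γ n l k)

theorem kapRight_eq_sum {α β γ : ℤ} (hα : 1 ≤ α) (hβ : 1 ≤ β) (hγ : 1 ≤ γ) {n l : ℕ}
    (s t u : ℤ) :
    kapRight α β γ l (n - l) s t u =
      ∑ i ∈ Finset.range (n + 1), kapRec α β γ n i l * kapLeft α β γ i (n - i) s t u := by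
  have hR := isTripleTower_kapRight α β γ l (n - l)
  rw [add_sub_cancel] at hR
  have hL := IsTripleTower.sum (α := α) (β := β) (γ := γ) (n := n) (Finset.range (n + 1))
    (fun i => kapRec α β γ n i l) (f := fun i => kapLeft α β γ i (n - i)) (fun i _ => by
      have := isTripleTower_kapLeft α β γ i (n - i)
      rwa [add_sub_cancel] at this)
  refine sub_eq_zero.mp ((hR.sub hL).eq_zero hβ (fun s u hsu => ?_) s t u)
  rw [sub_eq_zero]
  have hs : s ≤ n := by omega
  have hRs : kapRight α β γ l (n - l) s 0 u =
      (-1) ^ s * (zinv l * zinv (γ + l - 1) * zinv (β - 1)) *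
        (zinv (n - s) * zinv (γ + n - s - 1)) * sliceCoeff α β γ n l s := by
    unfold kapRight sliceCoeff
    by_cases hul : u < l
    · rw [kap_eq_zero (n := l) (by omega), zinv_neg (k := (n : ℤ) - l - s) (by omega)]; ring
    obtain ⟨v, rfl⟩ := Nat.exists_eq_add_of_le (not_lt.mp hul)
    rw [show ((l + v : ℕ) : ℤ) = l + v by push_cast; rfl, kap_zero_left, kap_base (by omega)]
    have h1 := zfac_mul_zinv (k := n - s) (by omega)
    have h2 := zfac_mul_zinv (k := γ + n - s - 1) (by omega)
    rw [zpow_natCast, show (0 : ℤ) + (l + v) - l = n - l - s by omega,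
      show β + γ + 2 * l + (n - l - s : ℤ) - 1 = β + γ + l + n - 1 - s by ring]
    linear_combination -((-1) ^ s * (zinv l * zinv (γ + l - 1) * zinv (β - 1)) * (zinv s *
      zinv (n - l - s) * zinv (α + s - 1) * zinv (β + γ + l + n - 1 - s))) *
      (h1 * (zfac (γ + n - s - 1) * zinv (γ + n - s - 1)) + h2)
  have hLs : ∀ i ∈ Finset.range (n + 1), kapRec α β γ n i l * kapLeft α β γ i (n - i) s 0 u =
      (-1) ^ s * (zinv l * zinv (γ + l - 1) * zinv (β - 1)) *
        (zinv (n - s) * zinv (γ + n - s - 1)) * ∑ k ∈ Finset.range (n + 1),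
        (2 * (i : ℝ) + (α + β : ℤ) - 1) * ((-1) ^ (i + k) * zfac (α + β + i + k - 2) *
          zinv (i - k)) * (zinv (s - i) * zinv (α + β + i + s - 1)) * sliceCoeff α β γ n l k := by
    intro i hi
    unfold kapLeft kapRec
    by_cases his : s < i
    · rw [kap_eq_zero (n := n - i) (s := s + 0 - i) (by omega),
        zinv_neg (k := (s : ℤ) - i) (by omega)]
      simp
    obtain ⟨v, hv⟩ := Nat.exists_eq_add_of_le (not_lt.mp his)
    rw [show (s : ℤ) = i + v by omega, kap_zero_right, kap_base (by omega)]
    have h1 := zfac_mul_zinv (k := i) (by omega)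
    have h2 := zfac_mul_zinv (k := α + i - 1) (by omega)
    rw [show (i : ℤ) + v + 0 - i = v by ring, show (i : ℤ) + v - i = v by ring, zpow_natCast,
      show α + β + 2 * i + v - 1 = α + β + i + (i + v) - 1 by ring,
      show (u : ℤ) = n - (i + v) by omega,
      show γ + (n - (i + v) : ℤ) - 1 = γ + n - (i + v) - 1 by ring, hv, pow_add]
    have hsum : ∀ c : ℝ, ∑ k ∈ Finset.range (n + 1),
        (2 * (i : ℝ) + (α + β : ℤ) - 1) * ((-1) ^ (i + k) * zfac (α + β + i + k - 2) *
          zinv (i - k)) * c * sliceCoeff α β γ n l k =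
        c * ((2 * (i : ℝ) + (α + β : ℤ) - 1) * ∑ k ∈ Finset.range (n + 1),
        ((-1) ^ (i + k) * zfac (α + β + i + k - 2) * zinv (i - k)) * sliceCoeff α β γ n l k) := by
      intro c
      rw [Finset.mul_sum, Finset.mul_sum]
      exact Finset.sum_congr rfl fun k _ => by ring
    rw [hsum]
    set S := (2 * (i : ℝ) + (α + β : ℤ) - 1) * ∑ k ∈ Finset.range (n + 1),
        ((-1) ^ (i + k) * zfac (α + β + i + k - 2) * zinv (i - k)) * sliceCoeff α β γ n l k
    linear_combination ((-1) ^ i * (-1) ^ v * zinv l * zinv (γ + l - 1) * zinv (β - 1) *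
      zinv (n - (i + v)) * zinv (γ + n - (i + v) - 1) * zinv v *
      zinv (α + β + i + (i + v) - 1) * S) *
      (h1 * (zfac (α + i - 1) * zinv (α + i - 1)) + h2)
  rw [hRs, Finset.sum_congr rfl hLs, ← Finset.mul_sum, Finset.sum_comm]
  congr 1
  simp only [← Finset.sum_mul]
  rw [Finset.sum_congr rfl fun k _ => by
    rw [sum_triangular_inverse (σ := α + β) (by omega) (k := k) hs]]
  simp only [ite_mul, one_mul, zero_mul]
  rw [Finset.sum_ite_eq' , if_pos (by simp; omega)]

/-! ### Recoupling of normalised vectors -/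

/-- The normalised vectors of the scheme `((j₁ j₂) j₃)`. -/
def ncgLeft (α β γ i N s t u : ℤ) : ℝ :=
  ncg α β i s t * ncg (α + β + 2 * i) γ N (s + t - i) u

/-- The normalised vectors of the scheme `(j₁ (j₂ j₃))`. -/
def ncgRight (α β γ l M s t u : ℤ) : ℝ :=
  ncg β γ l t u * ncg α (β + γ + 2 * l) M s (t + u - l)

/-- The weight common to all coupling schemes of three representations. -/
def tripleWt (α β γ n s t u : ℤ) : ℝ :=
  √(wt α s * wt β t * wt γ u / wt (α + β + γ + 2 * n) (s + t + u - n))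

lemma ncgLeft_eq (α β γ i N s t u : ℤ) : ncgLeft α β γ i N s t u =
    √(nrmSq α β i) * √(nrmSq (α + β + 2 * i) γ N) * tripleWt α β γ (i + N) s t u *
      kapLeft α β γ i N s t u := by
  unfold ncgLeft ncg kapLeft tripleWt
  have e1 : α + β + 2 * i + γ + 2 * N = α + β + γ + 2 * (i + N) := by ring
  have e2 : s + t - i + u - N = s + t + u - (i + N) := by ring
  rw [e1, e2]
  have h := wt_pos (α + β + 2 * i) (s + t - i)
  have h1 := wt_pos α s
  have h2 := wt_pos β t
  have : √(wt α s * wt β t / wt (α + β + 2 * i) (s + t - i)) *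
      √(wt (α + β + 2 * i) (s + t - i) * wt γ u /
        wt (α + β + γ + 2 * (i + N)) (s + t + u - (i + N))) =
      √(wt α s * wt β t * wt γ u / wt (α + β + γ + 2 * (i + N)) (s + t + u - (i + N))) := by
    rw [← Real.sqrt_mul (by positivity)]
    congr 1
    field_simp
  rw [← this]; ring

lemma ncgRight_eq (α β γ l M s t u : ℤ) : ncgRight α β γ l M s t u =
    √(nrmSq β γ l) * √(nrmSq α (β + γ + 2 * l) M) * tripleWt α β γ (l + M) s t u *
      kapRight α β γ l M s t u := by
  unfold ncgRight ncg kapRight tripleWt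
  have e1 : α + (β + γ + 2 * l) + 2 * M = α + β + γ + 2 * (l + M) := by ring
  have e2 : s + (t + u - l) - M = s + t + u - (l + M) := by ring
  rw [e1, e2]
  have h := wt_pos (β + γ + 2 * l) (t + u - l)
  have h1 := wt_pos β t
  have h2 := wt_pos γ u
  have : √(wt β t * wt γ u / wt (β + γ + 2 * l) (t + u - l)) *
      √(wt α s * wt (β + γ + 2 * l) (t + u - l) /
        wt (α + β + γ + 2 * (l + M)) (s + t + u - (l + M))) =
      √(wt α s * wt β t * wt γ u / wt (α + β + γ + 2 * (l + M)) (s + t + u - (l + M))) := by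
    rw [← Real.sqrt_mul (by positivity)]
    congr 1
    field_simp
  rw [← this]; ring

/-- The recoupling coefficients between the orthonormal bases of the two schemes. -/
def ncgRec (α β γ : ℤ) (n i l : ℕ) : ℝ :=
  kapRec α β γ n i l * (√(nrmSq β γ l) * √(nrmSq α (β + γ + 2 * l) (n - l))) /
    (√(nrmSq α β i) * √(nrmSq (α + β + 2 * i) γ (n - i)))

theorem ncgRight_eq_sum {α β γ : ℤ} (hα : 1 ≤ α) (hβ : 1 ≤ β) (hγ : 1 ≤ γ) {n l : ℕ}
    (s t u : ℤ) :
    ncgRight α β γ l (n - l) s t u =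
      ∑ i ∈ Finset.range (n + 1), ncgRec α β γ n i l * ncgLeft α β γ i (n - i) s t u := by
  rw [ncgRight_eq, kapRight_eq_sum hα hβ hγ, Finset.mul_sum]
  refine Finset.sum_congr rfl fun i hi => ?_
  rw [ncgLeft_eq, ncgRec, add_sub_cancel, add_sub_cancel]
  have h1 := (Real.sqrt_pos.mpr (nrmSq_pos hα hβ (n := i) (by omega))).ne'
  have h2 := (Real.sqrt_pos.mpr (nrmSq_pos (α := α + β + 2 * i) (by omega) hγ (n := n - i)
    (by simp at hi; omega))).ne'
  field_simp

lemma sum_range_sum_range_eq (n : ℕ) (F : ℕ → ℕ → ℝ) (hF : ∀ k l, n < k + l → F k l = 0) :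
    ∑ k ∈ Finset.range (n + 1), ∑ l ∈ Finset.range (n + 1), F k l =
    ∑ T ∈ Finset.range (n + 1), ∑ x ∈ Finset.HasAntidiagonal.antidiagonal T, F x.1 x.2 := by
  have h : ∀ T ∈ Finset.range (n + 1),
      ∑ x ∈ Finset.HasAntidiagonal.antidiagonal T, F x.1 x.2 =
      ∑ k ∈ Finset.range (n + 1), ∑ l ∈ Finset.range (n + 1), if k + l = T then F k l else 0 := by
    intro T hT
    rw [Finset.mem_range] at hT
    rw [← Finset.sum_product', ← Finset.sum_filter]
    refine Finset.sum_congr ?_ fun _ _ => rfl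
    ext x
    simp only [Finset.HasAntidiagonal.mem_antidiagonal, Finset.mem_filter, Finset.mem_product,
      Finset.mem_range]
    omega
  rw [Finset.sum_congr rfl h]
  symm
  rw [Finset.sum_comm]
  refine Finset.sum_congr rfl fun k _ => ?_
  rw [Finset.sum_comm]
  refine Finset.sum_congr rfl fun l _ => ?_
  rw [Finset.sum_ite_eq]
  split_ifs with h
  · rfl
  · exact (hF _ _ (by simpa using h)).symm

/-- The lowest weight vectors of the scheme `((j₁ j₂) j₃)` are orthonormal. -/
lemma sum_ncgLeft_mul_ncgLeft {α β γ : ℤ} (hα : 1 ≤ α) (hβ : 1 ≤ β) (hγ : 1 ≤ γ) {n i i' : ℕ}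
    (hi : i ≤ n) :
    ∑ k ∈ Finset.range (n + 1), ∑ l ∈ Finset.range (n + 1),
      ncgLeft α β γ i (n - i) k l (n - k - l) * ncgLeft α β γ i' (n - i') k l (n - k - l) =
      if i = i' then 1 else 0 := by
  rw [sum_range_sum_range_eq n (fun k l => ncgLeft α β γ i (n - i) k l (n - k - l) *
    ncgLeft α β γ i' (n - i') k l (n - k - l)) (fun k l h => by
      rw [ncgLeft, ncg_eq_zero (n := n - i) (by omega)]; ring)]
  set g : ℕ → ℕ → ℝ := fun i T => ncg (α + β + 2 * i) γ (n - i) (T - i) (n - T) with hg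
  have h1 : ∀ T ∈ Finset.range (n + 1), ∑ x ∈ Finset.HasAntidiagonal.antidiagonal T,
      ncgLeft α β γ i (n - i) x.1 x.2 (n - x.1 - x.2) *
        ncgLeft α β γ i' (n - i') x.1 x.2 (n - x.1 - x.2) =
      (if i = i' then 1 else 0) * (g i T * g i' T) := by
    intro T _
    have : ∀ x ∈ Finset.HasAntidiagonal.antidiagonal T,
        ncgLeft α β γ i (n - i) x.1 x.2 (n - x.1 - x.2) *
          ncgLeft α β γ i' (n - i') x.1 x.2 (n - x.1 - x.2) =
        ncg α β i x.1 x.2 * ncg α β i' x.1 x.2 * (g i T * g i' T) := by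
      intro x hx
      rw [Finset.HasAntidiagonal.mem_antidiagonal] at hx
      simp only [hg, ncgLeft]
      rw [show (n : ℤ) - x.1 - x.2 = n - T by omega, show (x.1 : ℤ) + x.2 = T by omega]
      ring
    rw [Finset.sum_congr rfl this, ← Finset.sum_mul]
    by_cases hT : i ≤ T
    · rw [sum_ncg_mul_ncg hα hβ hT]
    · have : g i T = 0 := ncg_eq_zero (by omega)
      rw [this]; ring
  rw [Finset.sum_congr rfl h1, ← Finset.mul_sum]
  split_ifs with hii
  · subst hii
    rw [one_mul, show n + 1 = i + (n - i + 1) by omega, Finset.sum_range_add,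
      Finset.sum_eq_zero (s := Finset.range i), zero_add]
    · have h2 := sum_ncg_mul_ncg (α := α + β + 2 * i) (β := γ) (by omega) hγ (n := n - i)
        (n' := n - i) (T := n - i) le_rfl
      rw [if_pos rfl, Finset.Nat.sum_antidiagonal_eq_sum_range_succ_mk] at h2
      rw [← h2]
      refine Finset.sum_congr rfl fun v hv => ?_
      have hv' : v ≤ n - i := Finset.mem_range_succ_iff.mp hv
      simp only [hg]
      rw [show (((i + v : ℕ) : ℤ) - i) = v by omega, show ((n : ℤ) - (i + v : ℕ)) =
        ((n - i - v : ℕ) : ℤ) by omega, show ((n : ℤ) - i) = ((n - i : ℕ) : ℤ) by omega]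
    · intro T hT
      rw [Finset.mem_range] at hT
      have : g i T = 0 := ncg_eq_zero (by omega)
      rw [this, zero_mul]
  · rw [zero_mul]

/-- The coefficients of an expansion in the scheme `((j₁ j₂) j₃)`, recovered by contraction. -/
lemma contraction_eq {α β γ : ℤ} (hα : 1 ≤ α) (hβ : 1 ≤ β) (hγ : 1 ≤ γ) {n : ℕ}
    {v : ℤ → ℤ → ℤ → ℝ} {U : ℕ → ℝ}
    (h : ∀ k l : ℕ, v k l (n - k - l) =
      ∑ i ∈ Finset.range (n + 1), U i * ncgLeft α β γ i (n - i) k l (n - k - l))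
    {i : ℕ} (hi : i ≤ n) :
    ∑ k ∈ Finset.range (n + 1), ∑ l ∈ Finset.range (n + 1),
      ncgLeft α β γ i (n - i) k l (n - k - l) * v k l (n - k - l) = U i := by
  simp only [h, Finset.mul_sum]
  rw [Finset.sum_congr rfl fun k _ => Finset.sum_comm, Finset.sum_comm]
  have : ∀ i' ∈ Finset.range (n + 1), ∑ k ∈ Finset.range (n + 1), ∑ l ∈ Finset.range (n + 1),
      ncgLeft α β γ i (n - i) k l (n - k - l) *
        (U i' * ncgLeft α β γ i' (n - i') k l (n - k - l)) =
      if i = i' then U i' else 0 := by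
    intro i' _
    have := sum_ncgLeft_mul_ncgLeft hα hβ hγ (i' := i') hi
    rw [show (if i = i' then U i' else 0) = U i' * if i = i' then 1 else 0 by simp, ← this,
      Finset.mul_sum]
    refine Finset.sum_congr rfl fun k _ => ?_
    rw [Finset.mul_sum]
    exact Finset.sum_congr rfl fun l _ => by ring
  rw [Finset.sum_congr rfl this, Finset.sum_ite_eq, if_pos (by simp; omega)]

/-! ### The 6j symbol solves the recoupling identity, and uniquely so -/

/-- The label `(k + 1) / 2`. -/
def mkSpin (k : ℕ) : Spin := ⟨((k + 1 : ℕ) : ℚ) / 2, k + 1, k.succ_pos, rfl⟩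

lemma dbl_mkSpin (k : ℕ) : dbl (mkSpin k) = k + 1 := by
  have h := coe_eq_dbl (mkSpin k)
  have h' : ((k + 1 : ℕ) : ℚ) / 2 = dbl (mkSpin k) / 2 := h
  have : ((k + 1 : ℕ) : ℚ) = dbl (mkSpin k) := by linarith
  exact_mod_cast this.symm

lemma dbl_injective : Function.Injective dbl := fun a b h =>
  Subtype.ext (by rw [coe_eq_dbl, coe_eq_dbl b, h])

lemma mkSpin_dbl_sub_one (a : Spin) : mkSpin (dbl a - 1) = a :=
  dbl_injective (by have := dbl_pos a; rw [dbl_mkSpin]; omega)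

/-- The labels at most `N / 2`. -/
def spinsLE (N : ℕ) : Finset Spin := (Finset.range N).image mkSpin

lemma mem_spinsLE {N : ℕ} {a : Spin} : a ∈ spinsLE N ↔ dbl a ≤ N := by
  simp only [spinsLE, Finset.mem_image, Finset.mem_range]
  constructor
  · rintro ⟨k, hk, rfl⟩; rw [dbl_mkSpin]; omega
  · intro h
    exact ⟨dbl a - 1, by have := dbl_pos a; omega, mkSpin_dbl_sub_one a⟩

lemma cg_ne_zero {a b c : Spin} {m₁ m₂ m : ℚ} (h : cg a b c m₁ m₂ m ≠ 0) :
    Triad a b c ∧ m₁ + m₂ = m ∧ IsNat (m₁ - a) ∧ IsNat (m₂ - b) ∧ IsNat (m - c) := by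
  by_contra hn
  exact h (by rw [cg, if_neg hn])

lemma Tetrad.le {a b c d e f : Spin} (h : Tetrad a b c d e f) : dbl c ≤ dbl e := by
  obtain ⟨N, hN⟩ := triad_iff.mp h.2.1
  omega

lemma tetrad_iff {a b c d e f : Spin} : Tetrad a b c d e f ↔ ∃ n i l : ℕ, i ≤ n ∧ l ≤ n ∧
    dbl c = dbl a + dbl b + 2 * i ∧ dbl f = dbl b + dbl d + 2 * l ∧
    dbl e = dbl a + dbl b + dbl d + 2 * n := by
  unfold Tetrad
  simp only [triad_iff]
  constructor
  · rintro ⟨⟨i, hi⟩, ⟨N, hN⟩, ⟨l, hl⟩, ⟨M, hM⟩⟩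
    exact ⟨i + N, i, l, by omega, by omega, hi, hl, by omega⟩
  · rintro ⟨n, i, l, hi, hl, h1, h2, h3⟩
    exact ⟨⟨i, h1⟩, ⟨n - i, by omega⟩, ⟨l, h2⟩, ⟨n - l, by omega⟩⟩

lemma cg_mul_cg_left {a b c d e : Spin} {n i : ℕ} (hc : dbl c = dbl a + dbl b + 2 * i)
    (he : dbl e = dbl a + dbl b + dbl d + 2 * n) (hi : i ≤ n) {m₁ m₂ m₃ m₁₂ m : ℚ} {s t u : ℤ}
    (h₁ : m₁ = a + s) (h₂ : m₂ = b + t) (h₃ : m₃ = d + u) (h₁₂ : m₁ + m₂ = m₁₂)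
    (h : m₁₂ + m₃ = m) :
    cg a b c m₁ m₂ m₁₂ * cg c d e m₁₂ m₃ m =
      ncgLeft (dbl a) (dbl b) (dbl d) i (n - i) s t u := by
  have hcq : (c : ℚ) = a + b + i := by
    rw [coe_eq_dbl, coe_eq_dbl a, coe_eq_dbl b, hc]; push_cast; ring
  rw [cg_eq_ncg hc h₁ h₂ h₁₂, cg_eq_ncg (n := n - i) (by omega) (s := s + t - i)
    (by rw [← h₁₂, h₁, h₂, hcq]; push_cast; ring) h₃ h, hc, ncgLeft]
  push_cast [hi]
  rfl

lemma cg_mul_cg_right {a b d e f : Spin} {n l : ℕ} (hf : dbl f = dbl b + dbl d + 2 * l)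
    (he : dbl e = dbl a + dbl b + dbl d + 2 * n) (hl : l ≤ n) {m₁ m₂ m₃ m₂₃ m : ℚ} {s t u : ℤ}
    (h₁ : m₁ = a + s) (h₂ : m₂ = b + t) (h₃ : m₃ = d + u) (h₂₃ : m₂ + m₃ = m₂₃)
    (h : m₁ + m₂₃ = m) :
    cg b d f m₂ m₃ m₂₃ * cg a f e m₁ m₂₃ m =
      ncgRight (dbl a) (dbl b) (dbl d) l (n - l) s t u := by
  have hfq : (f : ℚ) = b + d + l := by
    rw [coe_eq_dbl, coe_eq_dbl b, coe_eq_dbl d, hf]; push_cast; ring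
  rw [cg_eq_ncg hf h₂ h₃ h₂₃, cg_eq_ncg (n := n - l) (by omega) (t := t + u - l)
    h₁ (by rw [← h₂₃, h₂, h₃, hfq]; push_cast; ring) h, hf, ncgRight]
  push_cast [hl]
  rfl

/-- The factor between the 6j symbol and the recoupling coefficient of orthonormal bases. -/
def recFactor (a b c d e f : Spin) : ℝ :=
  sgn ((a : ℚ) + b + d + e) * √(((2 * (c : ℚ) - 1) * (2 * (f : ℚ) - 1) : ℚ) : ℝ)

lemma two_mul_sub_one_pos {a b c : Spin} {n : ℕ} (hc : dbl c = dbl a + dbl b + 2 * n) :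
    0 < 2 * (c : ℚ) - 1 := by
  have ha := dbl_pos a
  have hb := dbl_pos b
  rw [coe_eq_dbl c]
  have : (2 : ℚ) ≤ dbl c := by exact_mod_cast (by omega : 2 ≤ dbl c)
  linarith

lemma sgn_mul_self (x : ℚ) : sgn x * sgn x = 1 := by
  unfold sgn
  rw [← mul_zpow]; norm_num

lemma recFactor_ne_zero {a b c d e f : Spin} {i l : ℕ} (hc : dbl c = dbl a + dbl b + 2 * i)
    (hf : dbl f = dbl b + dbl d + 2 * l) : recFactor a b c d e f ≠ 0 := by
  refine mul_ne_zero (fun h => ?_) (Real.sqrt_pos.mpr ?_).ne'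
  · have := sgn_mul_self ((a : ℚ) + b + d + e)
    rw [h] at this; simp at this
  · exact_mod_cast mul_pos (two_mul_sub_one_pos hc) (two_mul_sub_one_pos hf)

/-- The left side of the recoupling identity, as a sum over the labels below a bound. -/
lemma finsum_recoupling {W : Spin → Spin → Spin → Spin → Spin → Spin → ℝ}
    (hW : ∀ a b c d e f : Spin, ¬ Tetrad a b c d e f → W a b c d e f = 0)
    (a b d e f : Spin) (m₁ m₂ m₃ : ℚ) {N : ℕ} (hN : dbl e ≤ N) :
    ∑ᶠ c : Spin, sgn ((a : ℚ) + b + d + e) *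
        √(((2 * (c : ℚ) - 1) * (2 * (f : ℚ) - 1) : ℚ) : ℝ) * W a b c d e f *
        cg a b c m₁ m₂ (m₁ + m₂) * cg c d e (m₁ + m₂) m₃ (m₁ + m₂ + m₃) =
      ∑ c ∈ spinsLE N, recFactor a b c d e f * W a b c d e f *
        (cg a b c m₁ m₂ (m₁ + m₂) * cg c d e (m₁ + m₂) m₃ (m₁ + m₂ + m₃)) := by
  rw [finsum_eq_sum_of_support_subset (s := spinsLE N)]
  · exact Finset.sum_congr rfl fun c _ => by rw [recFactor]; ring
  · intro c hc
    rw [Finset.mem_coe, mem_spinsLE]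
    by_contra h
    refine hc ?_
    dsimp only
    rw [hW a b c d e f fun ht => h (ht.le.trans hN)]
    ring

lemma sum_spinsLE_eq {W : Spin → Spin → Spin → Spin → Spin → Spin → ℝ}
    (hW : ∀ a b c d e f : Spin, ¬ Tetrad a b c d e f → W a b c d e f = 0)
    {a b d e f : Spin} {n : ℕ}
    (he : dbl e = dbl a + dbl b + dbl d + 2 * n) {m₁ m₂ m₃ : ℚ} {s t u : ℤ}
    (h₁ : m₁ = a + s) (h₂ : m₂ = b + t) (h₃ : m₃ = d + u) :
    ∑ c ∈ spinsLE (dbl e), recFactor a b c d e f * W a b c d e f *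
        (cg a b c m₁ m₂ (m₁ + m₂) * cg c d e (m₁ + m₂) m₃ (m₁ + m₂ + m₃)) =
      ∑ i ∈ Finset.range (n + 1), (recFactor a b (mkSpin (dbl a + dbl b + 2 * i - 1)) d e f *
        W a b (mkSpin (dbl a + dbl b + 2 * i - 1)) d e f) *
          ncgLeft (dbl a) (dbl b) (dbl d) i (n - i) s t u := by
  have ha := dbl_pos a
  have hb := dbl_pos b
  have hd := dbl_pos d
  have hdbl : ∀ i : ℕ, dbl (mkSpin (dbl a + dbl b + 2 * i - 1)) = dbl a + dbl b + 2 * i :=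
    fun i => by rw [dbl_mkSpin]; omega
  symm
  refine Finset.sum_of_injOn (fun i : ℕ => mkSpin (dbl a + dbl b + 2 * i - 1)) ?_ ?_ ?_ ?_
  · intro i _ j _ hij
    have := congrArg dbl hij
    simp only [hdbl] at this
    omega
  · intro i hi
    simp only [Finset.coe_range, Set.mem_Iio] at hi
    rw [Finset.mem_coe, mem_spinsLE, hdbl]
    omega
  · intro c _ hc
    rw [hW, mul_zero, zero_mul]
    intro ht
    obtain ⟨n', i, l', hi, hl', h1, h2, h3⟩ := tetrad_iff.mp ht
    refine hc ⟨i, by simp; omega, dbl_injective ?_⟩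
    rw [hdbl, h1]
  · intro i hi
    rw [cg_mul_cg_left (hdbl i) he (by simp at hi; omega) h₁ h₂ h₃ rfl rfl]

/-- On admissible labels, `sixJ` is the contraction of the two orthonormal bases. -/
lemma recFactor_mul_sixJ {a b c d e f : Spin} {n i l : ℕ} (hi : i ≤ n) (hl : l ≤ n)
    (hc : dbl c = dbl a + dbl b + 2 * i) (hf : dbl f = dbl b + dbl d + 2 * l)
    (he : dbl e = dbl a + dbl b + dbl d + 2 * n) :
    recFactor a b c d e f * sixJ a b c d e f =
      ∑ k ∈ Finset.range (n + 1), ∑ k' ∈ Finset.range (n + 1),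
        ncgLeft (dbl a) (dbl b) (dbl d) i (n - i) k k' (n - k - k') *
        ncgRight (dbl a) (dbl b) (dbl d) l (n - l) k k' (n - k - k') := by
  have heq : (e : ℚ) = a + b + d + n := by
    rw [coe_eq_dbl, coe_eq_dbl a, coe_eq_dbl b, coe_eq_dbl d, he]; push_cast; ring
  have hfl : ⌊(e : ℚ) - a - b - d⌋₊ = n := by
    rw [heq, show (a : ℚ) + b + d + n - a - b - d = n by ring, Nat.floor_natCast]
  have hr : √(((2 * (c : ℚ) - 1) * (2 * (f : ℚ) - 1) : ℚ) : ℝ) ≠ 0 :=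
    (Real.sqrt_pos.mpr (by
      exact_mod_cast mul_pos (two_mul_sub_one_pos hc) (two_mul_sub_one_pos hf))).ne'
  rw [sixJ, if_pos (tetrad_iff.mpr ⟨n, i, l, hi, hl, hc, hf, he⟩), hfl, recFactor]
  have hs := sgn_mul_self ((a : ℚ) + b + d + e)
  set r := √(((2 * (c : ℚ) - 1) * (2 * (f : ℚ) - 1) : ℚ) : ℝ)
  set σ := sgn ((a : ℚ) + b + d + e)
  rw [show ∀ S : ℝ, σ * r * (σ / r * S) = σ * σ * S by intro S; field_simp, hs, one_mul]
  refine Finset.sum_congr rfl fun k _ => Finset.sum_congr rfl fun k' _ => ?_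
  rw [← cg_mul_cg_left (a := a) (b := b) (c := c) (d := d) (e := e) hc he hi
    (m₁ := a + k) (m₂ := b + k') (m₃ := e - (a + k) - (b + k')) (s := k) (t := k')
    (u := n - k - k') (by simp) (by simp) (by rw [heq]; push_cast; ring) rfl (m := e) (by ring),
    ← cg_mul_cg_right (a := a) (b := b) (d := d) (e := e) (f := f) hf he hl
    (m₁ := a + k) (m₂ := b + k') (m₃ := e - (a + k) - (b + k')) (s := k) (t := k')
    (u := n - k - k') (by simp) (by simp) (by rw [heq]; push_cast; ring)
    (m₂₃ := e - (a + k)) (by ring) (m := e) (by ring)]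
  ring

/-- The 6j symbol as an explicit recoupling coefficient. -/
lemma recFactor_mul_sixJ_eq_ncgRec {a b c d e f : Spin} {n i l : ℕ} (hi : i ≤ n) (hl : l ≤ n)
    (hc : dbl c = dbl a + dbl b + 2 * i) (hf : dbl f = dbl b + dbl d + 2 * l)
    (he : dbl e = dbl a + dbl b + dbl d + 2 * n) :
    recFactor a b c d e f * sixJ a b c d e f = ncgRec (dbl a) (dbl b) (dbl d) n i l := by
  have ha := dbl_pos a
  have hb := dbl_pos b
  have hd := dbl_pos d
  rw [recFactor_mul_sixJ hi hl hc hf he]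
  exact contraction_eq (by omega) (by omega) (by omega)
    (fun k k' => ncgRight_eq_sum (by omega) (by omega) (by omega) _ _ _) hi

theorem isSixJ_sixJ : IsSixJ sixJ := by
  have hW : ∀ a b c d e f : Spin, ¬ Tetrad a b c d e f → sixJ a b c d e f = 0 :=
    fun a b c d e f h => by rw [sixJ, if_neg h]
  refine ⟨hW, fun a b d e f m₁ m₂ m₃ => ?_⟩
  by_cases hT : Triad b d f ∧ Triad a f e
  swap
  · have hR : cg b d f m₂ m₃ (m₂ + m₃) * cg a f e m₁ (m₂ + m₃) (m₁ + m₂ + m₃) = 0 := by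
      by_contra h
      exact hT ⟨(cg_ne_zero (left_ne_zero_of_mul h)).1, (cg_ne_zero (right_ne_zero_of_mul h)).1⟩
    rw [hR]
    refine finsum_eq_zero_of_forall_eq_zero fun c => ?_
    rw [hW a b c d e f fun h => hT h.2.2]
    ring
  obtain ⟨⟨l, hl⟩, ⟨M, hM⟩⟩ := And.imp triad_iff.mp triad_iff.mp hT
  by_cases hm : IsNat (m₁ - a) ∧ IsNat (m₂ - b) ∧ IsNat (m₃ - d)
  swap
  · have hR : cg b d f m₂ m₃ (m₂ + m₃) * cg a f e m₁ (m₂ + m₃) (m₁ + m₂ + m₃) = 0 := by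
      by_contra h
      have h1 := cg_ne_zero (left_ne_zero_of_mul h)
      have h2 := cg_ne_zero (right_ne_zero_of_mul h)
      exact hm ⟨h2.2.2.1, h1.2.2.1, h1.2.2.2.1⟩
    rw [hR]
    refine finsum_eq_zero_of_forall_eq_zero fun c => ?_
    rw [mul_assoc]
    by_contra h
    have h' := right_ne_zero_of_mul h
    have h1 := cg_ne_zero (left_ne_zero_of_mul h')
    have h2 := cg_ne_zero (right_ne_zero_of_mul h')
    exact hm ⟨h1.2.2.1, h1.2.2.2.1, h2.2.2.2.1⟩
  obtain ⟨⟨s, hs⟩, ⟨t, ht⟩, ⟨u, hu⟩⟩ := hm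
  have h₁ : m₁ = a + (s : ℤ) := by push_cast; linarith
  have h₂ : m₂ = b + (t : ℤ) := by push_cast; linarith
  have h₃ : m₃ = d + (u : ℤ) := by push_cast; linarith
  have he : dbl e = dbl a + dbl b + dbl d + 2 * (l + M) := by omega
  have ha := dbl_pos a
  have hb := dbl_pos b
  have hd := dbl_pos d
  rw [finsum_recoupling hW a b d e f m₁ m₂ m₃ le_rfl,
    sum_spinsLE_eq hW he h₁ h₂ h₃,
    cg_mul_cg_right hl he (by omega) h₁ h₂ h₃ rfl (by ring),
    ncgRight_eq_sum (by omega) (by omega) (by omega)]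
  refine Finset.sum_congr rfl fun i hi => ?_
  rw [recFactor_mul_sixJ_eq_ncgRec (by simp at hi; omega) (by omega)
    (by rw [dbl_mkSpin]; omega) hl he]

theorem isSixJ_iff (W : Spin → Spin → Spin → Spin → Spin → Spin → ℝ) :
    IsSixJ W ↔ W = sixJ := by
  refine ⟨fun hW => ?_, fun h => h ▸ isSixJ_sixJ⟩
  funext a b c d e f
  by_cases hT : Tetrad a b c d e f
  swap
  · rw [hW.1 _ _ _ _ _ _ hT, isSixJ_sixJ.1 _ _ _ _ _ _ hT]
  obtain ⟨n, i, l, hi, hl, hc, hf, he⟩ := tetrad_iff.mp hT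
  have ha := dbl_pos a
  have hb := dbl_pos b
  have hd := dbl_pos d
  apply mul_left_cancel₀ (recFactor_ne_zero (e := e) hc hf)
  rw [recFactor_mul_sixJ hi hl hc hf he]
  have hci : mkSpin (dbl a + dbl b + 2 * i - 1) = c := by
    rw [← hc]; exact mkSpin_dbl_sub_one c
  have key := contraction_eq (α := dbl a) (β := dbl b) (γ := dbl d) (by omega) (by omega)
    (by omega) (n := n) (v := ncgRight (dbl a) (dbl b) (dbl d) l (n - l))
    (U := fun i => recFactor a b (mkSpin (dbl a + dbl b + 2 * i - 1)) d e f *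
        W a b (mkSpin (dbl a + dbl b + 2 * i - 1)) d e f) (fun k k' => by
      rw [← sum_spinsLE_eq hW.1 he rfl rfl rfl, ← finsum_recoupling hW.1 _ _ _ _ _ _ _ _ le_rfl,
        hW.2, cg_mul_cg_right hf he hl rfl rfl rfl rfl (by ring)]) hi
  rw [key, hci]

/-- The recoupling identity, as a finite sum. -/
lemma cg_mul_cg_eq_sum (a b d e f : Spin) {m₁ m₂ m₃ m₁₂ m₂₃ m : ℚ} (h₁₂ : m₁ + m₂ = m₁₂)
    (h₂₃ : m₂ + m₃ = m₂₃) (h : m₁₂ + m₃ = m) {N : ℕ} (hN : dbl e ≤ N) :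
    cg b d f m₂ m₃ m₂₃ * cg a f e m₁ m₂₃ m =
      ∑ c ∈ spinsLE N, recFactor a b c d e f * sixJ a b c d e f *
        (cg a b c m₁ m₂ m₁₂ * cg c d e m₁₂ m₃ m) := by
  subst h₁₂ h₂₃ h
  rw [← isSixJ_sixJ.2, finsum_recoupling isSixJ_sixJ.1 a b d e f m₁ m₂ m₃ hN]

/-! ### The Biedenharn-Elliott relation for the SU(1,1) symbol -/

/-- Clebsch-Gordan coefficients to different total labels are linearly independent. -/
lemma cg_independent {a b : Spin} {F : Finset Spin} {φ : Spin → ℝ} {m : ℚ}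
    (h : ∀ m₁ m₂, m₁ + m₂ = m → ∑ p ∈ F, φ p * cg a b p m₁ m₂ m = 0) {p : Spin} (hp : p ∈ F)
    (hT : Triad a b p) (hm : IsNat (m - p)) : φ p = 0 := by
  obtain ⟨n, hn⟩ := triad_iff.mp hT
  obtain ⟨N, hN⟩ := hm
  have ha := dbl_pos a
  have hb := dbl_pos b
  have hpq : (p : ℚ) = a + b + n := by
    rw [coe_eq_dbl, coe_eq_dbl a, coe_eq_dbl b, hn]; push_cast; ring
  have hortho : ∀ p' ∈ F, ∑ x ∈ Finset.HasAntidiagonal.antidiagonal (n + N),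
      cg a b p (a + x.1) (b + x.2) m * cg a b p' (a + x.1) (b + x.2) m =
        if p' = p then 1 else 0 := by
    intro p' _
    by_cases hT' : Triad a b p'
    · obtain ⟨n', hn'⟩ := triad_iff.mp hT'
      have hiff : p' = p ↔ n = n' := by
        rw [← dbl_injective.eq_iff]; omega
      simp only [hiff]
      rw [← sum_ncg_mul_ncg (α := dbl a) (β := dbl b) (by omega) (by omega) (n := n) (n' := n')
        (T := n + N) (by omega)]
      refine Finset.sum_congr rfl fun x hx => ?_
      rw [Finset.HasAntidiagonal.mem_antidiagonal] at hx
      have hsum : (a : ℚ) + x.1 + (b + x.2) = m := by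
        have : (x.1 : ℚ) + x.2 = n + N := by exact_mod_cast hx
        linear_combination this - hN - hpq
      rw [cg_eq_ncg hn (s := x.1) (t := x.2) (by simp) (by simp) hsum,
        cg_eq_ncg hn' (s := x.1) (t := x.2) (by simp) (by simp) hsum]
    · rw [if_neg (fun h : p' = p => hT' (h ▸ hT))]
      refine Finset.sum_eq_zero fun x _ => ?_
      rw [show cg a b p' (a + x.1) (b + x.2) m = 0 by
        by_contra h; exact hT' (cg_ne_zero h).1, mul_zero]
  have h0 : ∑ x ∈ Finset.HasAntidiagonal.antidiagonal (n + N),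
      cg a b p (a + x.1) (b + x.2) m *
        ∑ p' ∈ F, φ p' * cg a b p' (a + x.1) (b + x.2) m = 0 := by
    refine Finset.sum_eq_zero fun x hx => ?_
    rw [Finset.HasAntidiagonal.mem_antidiagonal] at hx
    rw [h _ _ (by
      have : (x.1 : ℚ) + x.2 = n + N := by exact_mod_cast hx
      linear_combination this - hN - hpq), mul_zero]
  simp only [Finset.mul_sum] at h0
  rw [Finset.sum_comm] at h0
  have h1 : ∀ p' ∈ F, ∑ x ∈ Finset.HasAntidiagonal.antidiagonal (n + N),
      cg a b p (a + x.1) (b + x.2) m * (φ p' * cg a b p' (a + x.1) (b + x.2) m) =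
        if p' = p then φ p' else 0 := by
    intro p' hp'
    rw [show (if p' = p then φ p' else 0) = φ p' * if p' = p then 1 else 0 by simp,
      ← hortho p' hp', Finset.mul_sum]
    exact Finset.sum_congr rfl fun x _ => by ring
  rw [Finset.sum_congr rfl h1, Finset.sum_ite_eq', if_pos hp] at h0
  exact h0

/-- The vectors of the scheme `(((a b) c) d)` with total label `r` are linearly independent. -/
lemma cg_triple_independent {a b c d r : Spin} {F : Finset Spin} {L : Spin → Spin → ℝ}
    (h : ∀ m₁ m₂ m₃ m₄ m₁₂ m₁₂₃ m : ℚ, m₁ + m₂ = m₁₂ → m₁₂ + m₃ = m₁₂₃ → m₁₂₃ + m₄ = m →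
      ∑ p ∈ F, ∑ q ∈ F, L p q *
        (cg a b p m₁ m₂ m₁₂ * cg p c q m₁₂ m₃ m₁₂₃ * cg q d r m₁₂₃ m₄ m) = 0)
    {p q : Spin} (hp : p ∈ F) (hq : q ∈ F) (hT₁ : Triad a b p) (hT₂ : Triad p c q)
    (hT₃ : Triad q d r) : L p q = 0 := by
  -- Peel off one coupling at a time.
  have step₁ : ∀ m₃ m₄ m₁₂ m₁₂₃ m : ℚ, m₁₂ + m₃ = m₁₂₃ → m₁₂₃ + m₄ = m →
      ∑ q ∈ F, L p q * cg q d r m₁₂₃ m₄ m * cg p c q m₁₂ m₃ m₁₂₃ = 0 := by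
    intro m₃ m₄ m₁₂ m₁₂₃ m h₁ h₂
    by_cases hm : IsNat (m₁₂ - p)
    · refine cg_independent (a := a) (b := b) (m := m₁₂) (F := F)
        (φ := fun p => ∑ q ∈ F, L p q * cg q d r m₁₂₃ m₄ m * cg p c q m₁₂ m₃ m₁₂₃) ?_ hp hT₁ hm
      intro m₁ m₂ h₀
      rw [← h m₁ m₂ m₃ m₄ m₁₂ m₁₂₃ m h₀ h₁ h₂]
      refine Finset.sum_congr rfl fun p _ => ?_
      rw [Finset.sum_mul]
      exact Finset.sum_congr rfl fun q _ => by ring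
    · refine Finset.sum_eq_zero fun q _ => ?_
      rw [show cg p c q m₁₂ m₃ m₁₂₃ = 0 by
        by_contra h; exact hm (cg_ne_zero h).2.2.1, mul_zero]
  have step₂ : ∀ m₄ m₁₂₃ m : ℚ, m₁₂₃ + m₄ = m → L p q * cg q d r m₁₂₃ m₄ m = 0 := by
    intro m₄ m₁₂₃ m h₂
    by_cases hm : IsNat (m₁₂₃ - q)
    · exact cg_independent (a := p) (b := c) (m := m₁₂₃) (F := F)
        (φ := fun q => L p q * cg q d r m₁₂₃ m₄ m)
        (fun m₁₂ m₃ h₁ => step₁ m₃ m₄ m₁₂ m₁₂₃ m h₁ h₂) hq hT₂ hm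
    · rw [show cg q d r m₁₂₃ m₄ m = 0 by
        by_contra h; exact hm (cg_ne_zero h).2.2.1, mul_zero]
  refine cg_independent (a := q) (b := d) (m := r) (F := {r}) (φ := fun _ => L p q)
    (fun m₁₂₃ m₄ h₂ => ?_) (Finset.mem_singleton_self r) hT₃ ⟨0, by simp⟩
  rw [Finset.sum_singleton]
  exact step₂ m₄ m₁₂₃ r h₂

/-- The pentagon: the two ways of recoupling `(a (b (c d)))` to `(((a b) c) d)` agree. -/
theorem pentagon {a b c d e f p q r : Spin} (h₁ : Triad a f r) (h₂ : Triad a b p)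
    (h₃ : Triad p c q) (h₄ : Triad q d r) :
    ∑ X ∈ spinsLE (dbl r), (recFactor b c X d f e * sixJ b c X d f e) *
        (recFactor a X q d r f * sixJ a X q d r f) * (recFactor a b p c q X * sixJ a b p c q X) =
      (recFactor a b p e r f * sixJ a b p e r f) * (recFactor p c q d r e * sixJ p c q d r e) := by
  have hle : ∀ {x y z : Spin}, Triad x y z → dbl x ≤ dbl z ∧ dbl y ≤ dbl z := by
    intro x y z h
    obtain ⟨n, hn⟩ := triad_iff.mp h
    omega
  set F := spinsLE (dbl r) with hF
  set U : Spin → Spin → Spin → Spin → Spin → Spin → ℝ :=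
    fun a b c d e f => recFactor a b c d e f * sixJ a b c d e f with hU
  change ∑ X ∈ F, U b c X d f e * U a X q d r f * U a b p c q X = U a b p e r f * U p c q d r e
  have key := cg_triple_independent (a := a) (b := b) (c := c) (d := d) (r := r) (F := F)
    (L := fun p q => ∑ X ∈ F, U b c X d f e * U a X q d r f * U a b p c q X -
      U a b p e r f * U p c q d r e) (p := p) (q := q) ?_
      (mem_spinsLE.mpr ((hle h₃).1.trans (hle h₄).1)) (mem_spinsLE.mpr (hle h₄).1) h₂ h₃ h₄
  · exact sub_eq_zero.mp key
  intro m₁ m₂ m₃ m₄ m₁₂ m₁₂₃ m e₁ e₂ e₃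
  have path₁ : cg c d e m₃ m₄ (m₃ + m₄) * cg b e f m₂ (m₃ + m₄) (m₂ + m₃ + m₄) *
      cg a f r m₁ (m₂ + m₃ + m₄) m = ∑ p ∈ F, ∑ q ∈ F,
        (∑ X ∈ F, U b c X d f e * U a X q d r f * U a b p c q X) *
        (cg a b p m₁ m₂ m₁₂ * cg p c q m₁₂ m₃ m₁₂₃ * cg q d r m₁₂₃ m₄ m) := by
    rw [cg_mul_cg_eq_sum b c d f e (m₁₂ := m₂ + m₃) rfl rfl rfl (hle h₁).2, Finset.sum_mul]
    have hX : ∀ X ∈ F, U b c X d f e * (cg b c X m₂ m₃ (m₂ + m₃) *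
        cg X d f (m₂ + m₃) m₄ (m₂ + m₃ + m₄)) * cg a f r m₁ (m₂ + m₃ + m₄) m =
        ∑ p ∈ F, ∑ q ∈ F, U b c X d f e * U a X q d r f * U a b p c q X *
        (cg a b p m₁ m₂ m₁₂ * cg p c q m₁₂ m₃ m₁₂₃ * cg q d r m₁₂₃ m₄ m) := by
      intro X _
      have s₁ := cg_mul_cg_eq_sum a X d r f (m₁ := m₁) (m₂ := m₂ + m₃) (m₃ := m₄)
        (m₁₂ := m₁₂₃) (m := m) (by rw [← e₂, ← e₁]; ring) rfl e₃ le_rfl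
      rw [show U b c X d f e * (cg b c X m₂ m₃ (m₂ + m₃) * cg X d f (m₂ + m₃) m₄
        (m₂ + m₃ + m₄)) * cg a f r m₁ (m₂ + m₃ + m₄) m = U b c X d f e *
        cg b c X m₂ m₃ (m₂ + m₃) * (cg X d f (m₂ + m₃) m₄ (m₂ + m₃ + m₄) *
        cg a f r m₁ (m₂ + m₃ + m₄) m) by ring, s₁, Finset.mul_sum, Finset.sum_comm]
      refine Finset.sum_congr rfl fun q hq => ?_
      have s₂ := cg_mul_cg_eq_sum a b c q X (m₁ := m₁) (m₂ := m₂) (m₃ := m₃) (m := m₁₂₃)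
        e₁ rfl e₂ (mem_spinsLE.mp hq)
      rw [show ∀ x y z w v : ℝ, x * y * (z * (w * v)) = x * z * v * (y * w) by intros; ring, s₂,
        Finset.mul_sum]
      exact Finset.sum_congr rfl fun p _ => by simp only [hU]; ring
    rw [Finset.sum_congr rfl hX, Finset.sum_comm]
    refine Finset.sum_congr rfl fun p _ => ?_
    rw [Finset.sum_comm]
    exact Finset.sum_congr rfl fun q _ => by rw [Finset.sum_mul]
  have path₂ : cg c d e m₃ m₄ (m₃ + m₄) * cg b e f m₂ (m₃ + m₄) (m₂ + m₃ + m₄) *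
      cg a f r m₁ (m₂ + m₃ + m₄) m = ∑ p ∈ F, ∑ q ∈ F, (U a b p e r f * U p c q d r e) *
        (cg a b p m₁ m₂ m₁₂ * cg p c q m₁₂ m₃ m₁₂₃ * cg q d r m₁₂₃ m₄ m) := by
    have s₁ := cg_mul_cg_eq_sum a b e r f (m₁ := m₁) (m₂ := m₂) (m₃ := m₃ + m₄)
      (m₂₃ := m₂ + m₃ + m₄) (m := m) e₁ (by ring) (by rw [← e₃, ← e₂]; ring) le_rfl
    rw [mul_assoc, s₁, Finset.mul_sum]
    refine Finset.sum_congr rfl fun p _ => ?_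
    have s₂ := cg_mul_cg_eq_sum p c d r e (m₁ := m₁₂) (m₂ := m₃) (m₃ := m₄) (m := m)
      e₂ rfl e₃ le_rfl
    rw [show ∀ x y z w : ℝ, x * (y * (z * w)) = y * z * (x * w) by intros; ring, s₂,
      Finset.mul_sum]
    exact Finset.sum_congr rfl fun q _ => by simp only [hU]; ring
  rw [path₁, ← sub_eq_zero, ← Finset.sum_sub_distrib] at path₂
  rw [← path₂]
  refine Finset.sum_congr rfl fun p _ => ?_
  rw [← Finset.sum_sub_distrib]
  exact Finset.sum_congr rfl fun q _ => by ring

lemma neg_one_zpow_congr {k k' : ℤ} (h : Even (k + k')) : (-1 : ℝ) ^ k = (-1) ^ k' := by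
  have h1 : (-1 : ℝ) ^ k * (-1) ^ k' = 1 := by
    rw [← zpow_add₀ (by norm_num), h.neg_one_zpow]
  have h2 : (-1 : ℝ) ^ k' * (-1) ^ k' = 1 := by rw [← mul_zpow]; norm_num
  linear_combination (-1) ^ k' * h1 - (-1) ^ k * h2

lemma sixJ_eq_zero_of_not_tetrad {a b c d e f : Spin} (h : ¬ Tetrad a b c d e f) :
    sixJ a b c d e f = 0 := if_neg h

/-- The pentagon, freed of the factors between the 6j symbols and the recoupling coefficients. -/
theorem hasSum_sixJ (a b c d e f p q r : Spin) :
    HasSum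
      (fun X : Spin =>
        sgn ((a : ℚ) + b + c + d + e + f + p + q + r + X) * ((2 * (X : ℚ) - 1 : ℚ) : ℝ) *
          sixJ b c X d f e * sixJ a X q d r f * sixJ a b p c q X)
      (sixJ a b p e r f * sixJ p c q d r e) := by
  -- Outside the common triad conditions both sides vanish.
  by_cases hT : Triad c d e ∧ Triad b e f ∧ Triad a f r ∧ Triad a b p ∧ Triad p c q ∧ Triad q d r
  swap
  · have hR : sixJ a b p e r f * sixJ p c q d r e = 0 := by
      by_contra h
      have t₁ := not_imp_comm.mp sixJ_eq_zero_of_not_tetrad (left_ne_zero_of_mul h)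
      have t₂ := not_imp_comm.mp sixJ_eq_zero_of_not_tetrad (right_ne_zero_of_mul h)
      exact hT ⟨t₂.2.2.1, t₁.2.2.1, t₁.2.2.2, t₁.1, t₂.1, t₂.2.1⟩
    rw [hR]
    convert hasSum_zero with X
    by_contra h
    have t₁ := not_imp_comm.mp sixJ_eq_zero_of_not_tetrad
      (right_ne_zero_of_mul (left_ne_zero_of_mul (left_ne_zero_of_mul h)))
    have t₂ := not_imp_comm.mp sixJ_eq_zero_of_not_tetrad
      (right_ne_zero_of_mul (left_ne_zero_of_mul h))
    have t₃ := not_imp_comm.mp sixJ_eq_zero_of_not_tetrad (right_ne_zero_of_mul h)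
    exact hT ⟨t₁.2.2.1, t₁.2.2.2, t₂.2.2.2, t₃.1, t₃.2.1, t₂.2.1⟩
  obtain ⟨hcde, hbef, hafr, habp, hpcq, hqdr⟩ := hT
  have key := pentagon (e := e) hafr habp hpcq hqdr (b := b) (c := c) (d := d)
  obtain ⟨ε, hε⟩ := triad_iff.mp hcde
  obtain ⟨φ, hφ⟩ := triad_iff.mp hbef
  obtain ⟨ρ, hρ⟩ := triad_iff.mp hafr
  obtain ⟨π, hπ⟩ := triad_iff.mp habp
  obtain ⟨κ, hκ⟩ := triad_iff.mp hpcq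
  have pe : (0 : ℝ) < ((2 * (e : ℚ) - 1 : ℚ) : ℝ) := by exact_mod_cast two_mul_sub_one_pos hε
  have pf : (0 : ℝ) < ((2 * (f : ℚ) - 1 : ℚ) : ℝ) := by exact_mod_cast two_mul_sub_one_pos hφ
  have pp : (0 : ℝ) < ((2 * (p : ℚ) - 1 : ℚ) : ℝ) := by exact_mod_cast two_mul_sub_one_pos hπ
  have pq : (0 : ℝ) < ((2 * (q : ℚ) - 1 : ℚ) : ℝ) := by exact_mod_cast two_mul_sub_one_pos hκ
  set σ := sgn ((a : ℚ) + b + e + r) * sgn ((p : ℚ) + c + d + r) with hσ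
  set S := √((2 * (e : ℚ) - 1 : ℚ) : ℝ) * √((2 * (f : ℚ) - 1 : ℚ) : ℝ) *
    √((2 * (p : ℚ) - 1 : ℚ) : ℝ) * √((2 * (q : ℚ) - 1 : ℚ) : ℝ) with hS
  have hσS : σ * S ≠ 0 := by
    refine mul_ne_zero (fun h => ?_) (by positivity)
    have h1 := sgn_mul_self ((a : ℚ) + b + e + r)
    have h2 := sgn_mul_self ((p : ℚ) + c + d + r)
    have h3 : σ * σ = 1 := by rw [hσ]; linear_combination (sgn ((p : ℚ) + c + d + r)) ^ 2 * h1 + h2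
    rw [h] at h3; simp at h3
  have hsupp : ∀ X ∉ spinsLE (dbl r),
      sgn ((a : ℚ) + b + c + d + e + f + p + q + r + X) * ((2 * (X : ℚ) - 1 : ℚ) : ℝ) *
        sixJ b c X d f e * sixJ a X q d r f * sixJ a b p c q X = 0 := by
    intro X hX
    rw [sixJ_eq_zero_of_not_tetrad (a := b) (b := c) (c := X) (fun ht => hX ?_)]
    · ring
    · rw [mem_spinsLE]
      have := ht.le
      omega
  convert hasSum_sum_of_ne_finset_zero (L := .unconditional Spin) hsupp using 1
  apply mul_left_cancel₀ hσS
  have hR : σ * S * (sixJ a b p e r f * sixJ p c q d r e) =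
      (recFactor a b p e r f * sixJ a b p e r f) * (recFactor p c q d r e * sixJ p c q d r e) := by
    unfold recFactor
    rw [Rat.cast_mul, Rat.cast_mul, Real.sqrt_mul pp.le, Real.sqrt_mul pq.le]
    rw [hσ, hS]; ring
  rw [hR, ← key, Finset.mul_sum]
  refine Finset.sum_congr rfl fun X _ => ?_
  by_cases hX : Triad b c X
  swap
  · rw [sixJ_eq_zero_of_not_tetrad (a := b) (b := c) (c := X) fun ht => hX ht.1]; ring
  obtain ⟨x, hx⟩ := triad_iff.mp hX
  have pX : (0 : ℝ) < ((2 * (X : ℚ) - 1 : ℚ) : ℝ) := by exact_mod_cast two_mul_sub_one_pos hx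
  -- The three signs from the left side of the pentagon against the two from its right side.
  have hsgn : sgn ((b : ℚ) + c + d + f) * sgn ((a : ℚ) + X + d + r) * sgn ((a : ℚ) + b + c + q) =
      σ * sgn ((a : ℚ) + b + c + d + e + f + p + q + r + X) := by
    have ha := coe_eq_dbl a; have hb := coe_eq_dbl b; have hc := coe_eq_dbl c
    have hd := coe_eq_dbl d; have he := coe_eq_dbl e; have hf := coe_eq_dbl f
    have hp := coe_eq_dbl p; have hq := coe_eq_dbl q; have hr := coe_eq_dbl r
    have hX := coe_eq_dbl X
    have eε : (dbl e : ℚ) = dbl c + dbl d + 2 * ε := by exact_mod_cast hε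
    have eφ : (dbl f : ℚ) = dbl b + dbl e + 2 * φ := by exact_mod_cast hφ
    have eρ : (dbl r : ℚ) = dbl a + dbl f + 2 * ρ := by exact_mod_cast hρ
    have eπ : (dbl p : ℚ) = dbl a + dbl b + 2 * π := by exact_mod_cast hπ
    have eκ : (dbl q : ℚ) = dbl p + dbl c + 2 * κ := by exact_mod_cast hκ
    have ex : (dbl X : ℚ) = dbl b + dbl c + 2 * x := by exact_mod_cast hx
    set α := dbl a
    set β := dbl b
    set γ := dbl c
    set δ := dbl d
    rw [hσ, sgn_eq (k := β + γ + δ + ε + φ) (by push_cast; linarith),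
      sgn_eq (k := α + β + γ + δ + x + ε + φ + ρ) (by push_cast; linarith),
      sgn_eq (k := α + β + γ + π + κ) (by push_cast; linarith),
      sgn_eq (k := α + β + γ + δ + 2 * ε + φ + ρ) (by push_cast; linarith),
      sgn_eq (k := α + β + γ + δ + π + ε + φ + ρ) (by push_cast; linarith),
      sgn_eq (k := 2 * α + 3 * β + 3 * γ + 2 * δ + 3 * ε + 2 * φ + 2 * π + κ + ρ + x)
        (by push_cast; linarith)]
    simp only [← zpow_add₀ (show (-1 : ℝ) ≠ 0 by norm_num)]
    apply neg_one_zpow_congr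
    rw [Int.even_iff]
    omega
  unfold recFactor
  rw [Rat.cast_mul, Rat.cast_mul, Rat.cast_mul, Real.sqrt_mul pX.le, Real.sqrt_mul pq.le,
    Real.sqrt_mul pp.le]
  have hXX := Real.mul_self_sqrt pX.le
  set rX := √((2 * (X : ℚ) - 1 : ℚ) : ℝ)
  rw [← hXX, hS]
  linear_combination (√((2 * (e : ℚ) - 1 : ℚ) : ℝ) * √((2 * (f : ℚ) - 1 : ℚ) : ℝ) *
    √((2 * (p : ℚ) - 1 : ℚ) : ℝ) * √((2 * (q : ℚ) - 1 : ℚ) : ℝ) * rX * rX *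
    (sixJ b c X d f e * sixJ a X q d r f * sixJ a b p c q X)) * hsgn

/-! ### The sums of Saalschütz and Whipple -/

/-- The rising factorial `a (a + 1) ⋯ (a + k - 1)`. -/
def rise (a : ℝ) (k : ℕ) : ℝ := ∏ i ∈ Finset.range k, (a + i)

lemma rise_zero (a : ℝ) : rise a 0 = 1 := by simp [rise]

lemma rise_succ (a : ℝ) (k : ℕ) : rise a (k + 1) = rise a k * (a + k) := by
  simp [rise, Finset.prod_range_succ]

lemma rise_succ' (a : ℝ) (k : ℕ) : rise a (k + 1) = a * rise (a + 1) k := by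
  simp only [rise, Finset.prod_range_succ']
  rw [mul_comm]
  congr 1
  · simp
  · exact Finset.prod_congr rfl fun i _ => by push_cast; ring

lemma rise_sub_add_one {m : ℤ} (hm : 0 ≤ m) (k : ℕ) :
    rise (m - k + 1) k = zfac m * zinv (m - k) := by
  induction k with
  | zero => simp [rise_zero, zfac_mul_zinv hm]
  | succ k ih =>
    have h := mul_zinv (m - k)
    push_cast at h ⊢
    rw [rise_succ', show (m : ℝ) - (k + 1) + 1 + 1 = m - k + 1 by ring, ih,
      show m - ((k : ℤ) + 1) = m - k - 1 by ring, ← h]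
    ring

lemma rise_neg {m : ℤ} (hm : 0 ≤ m) (k : ℕ) :
    rise (-m) k = (-1) ^ k * (zfac m * zinv (m - k)) := by
  induction k with
  | zero => simp [rise_zero, zfac_mul_zinv hm]
  | succ k ih =>
    have h := mul_zinv (m - k)
    push_cast at h ⊢
    rw [rise_succ, ih, show m - ((k : ℤ) + 1) = m - k - 1 by ring, ← h, pow_succ]
    ring

lemma rise_of_pos {a : ℤ} (ha : 1 ≤ a) (k : ℕ) :
    rise a k = zfac (a + k - 1) * zinv (a - 1) := by
  have := rise_sub_add_one (m := a + k - 1) (by omega) k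
  rw [show a + (k : ℤ) - 1 - k = a - 1 by ring] at this
  rw [← this]
  congr 1
  push_cast; ring

/-- The sum of Saalschütz. The sums for `k` and `k + 1` differ termwise by a telescoping
expression. -/
theorem saalschutz (A B C : ℝ) (k : ℕ) :
    ∑ j ∈ Finset.range (k + 1), (k.choose j : ℝ) * rise A j * rise B j * rise (C + j) (k - j) *
      rise (C - A - B) (k - j) = rise (C - A) k * rise (C - B) k := by
  induction k with
  | zero => simp [rise_zero]
  | succ k ih =>
    set D := C - A - B with hD
    set T : ℕ → ℝ := fun j => (k.choose j : ℝ) * rise A j * rise B j * rise (C + j) (k - j) *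
      rise D (k - j) with hT
    set V : ℕ → ℝ := fun j => (k.choose j : ℝ) * rise A (j + 1) * rise B (j + 1) *
      rise (C + j + 1) (k - j) * rise D (k - j) with hV
    set G : ℕ → ℝ := fun j => j * (D + k - j) * T j with hG
    have hpascal : ∑ j ∈ Finset.range (k + 1 + 1), ((k + 1).choose j : ℝ) * rise A j * rise B j *
        rise (C + j) (k + 1 - j) * rise D (k + 1 - j) =
        ∑ j ∈ Finset.range (k + 1), (T j * (C + k) * (D + k - j) + V j) := by
      rw [Finset.sum_range_succ']
      have h1 : ∀ j ∈ Finset.range (k + 1), ((k + 1).choose (j + 1) : ℝ) * rise A (j + 1) *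
          rise B (j + 1) * rise (C + (j + 1 : ℕ)) (k + 1 - (j + 1)) * rise D (k + 1 - (j + 1)) =
          V j + (k.choose (j + 1) : ℝ) * rise A (j + 1) * rise B (j + 1) *
            rise (C + (j + 1 : ℕ)) (k - j) * rise D (k - j) := by
        intro j _
        simp only [hV]
        rw [Nat.choose_succ_succ, Nat.add_sub_add_right]
        push_cast
        rw [add_assoc C]
        ring
      have h2 : ∀ j ∈ Finset.range (k + 1), T j * (C + k) * (D + k - j) =
          (k.choose j : ℝ) * rise A j * rise B j * rise (C + j) (k + 1 - j) *
            rise D (k + 1 - j) := by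
        intro j hj
        have hj' : j ≤ k := Finset.mem_range_succ_iff.mp hj
        simp only [hT]
        rw [show k + 1 - j = (k - j) + 1 by omega, rise_succ, rise_succ]
        push_cast [hj']
        ring
      rw [Finset.sum_congr rfl h1, Finset.sum_add_distrib, Finset.sum_add_distrib,
        Finset.sum_congr rfl h2]
      conv_rhs => rw [Finset.sum_range_succ']
      rw [Finset.sum_range_succ (fun j => (k.choose (j + 1) : ℝ) * rise A (j + 1) * rise B (j + 1) *
            rise (C + (j + 1 : ℕ)) (k - j) * rise D (k - j)) k, Nat.choose_succ_self]
      have h3 : ∀ j ∈ Finset.range k, (k.choose (j + 1) : ℝ) * rise A (j + 1) * rise B (j + 1) *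
          rise (C + (j + 1 : ℕ)) (k + 1 - (j + 1)) * rise D (k + 1 - (j + 1)) =
          (k.choose (j + 1) : ℝ) * rise A (j + 1) * rise B (j + 1) *
            rise (C + (j + 1 : ℕ)) (k - j) * rise D (k - j) := by
        intro j _
        rw [Nat.add_sub_add_right]
      rw [Finset.sum_congr rfl h3]
      simp only [Nat.choose_zero_right]
      push_cast
      ring
    have hVG : ∀ j ∈ Finset.range (k + 1), V j = (A + j) * (B + j) * T j + G (j + 1) := by
      intro j hj
      have hj' : j ≤ k := Finset.mem_range_succ_iff.mp hj
      simp only [hV, hG, hT]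
      rcases hj'.eq_or_lt with rfl | hlt
      · simp only [Nat.sub_self, rise_zero, Nat.choose_succ_self, rise_succ]
        push_cast; ring
      · obtain ⟨m, rfl⟩ := Nat.exists_eq_add_of_lt hlt
        have hc : ((j : ℝ) + 1) * ((j + m + 1).choose (j + 1) : ℝ) =
            (m + 1) * ((j + m + 1).choose j : ℝ) := by
          have := Nat.choose_succ_right_eq (j + m + 1) j
          rw [show j + m + 1 - j = m + 1 by omega] at this
          have h : (((j + m + 1).choose (j + 1) * (j + 1) : ℕ) : ℝ) =
            (((j + m + 1).choose j * (m + 1) : ℕ) : ℝ) := by exact_mod_cast this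
          push_cast at h
          linarith
        rw [show j + m + 1 - j = m + 1 by omega, show j + m + 1 - (j + 1) = m by omega,
          rise_succ' (C + j), rise_succ (C + j + 1) m, rise_succ D m, rise_succ A j, rise_succ B j]
        push_cast
        rw [show C + ((j : ℝ) + 1) = C + j + 1 by ring]
        linear_combination (-(D + m) * rise A j * (A + j) * (rise B j * (B + j)) *
          rise (C + j + 1) m * rise D m) * hc
    rw [hpascal, rise_succ, rise_succ]
    have hfin : ∑ j ∈ Finset.range (k + 1), (T j * (C + k) * (D + k - j) + V j -
        (C - A + k) * (C - B + k) * T j) = 0 := by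
      have : ∀ j ∈ Finset.range (k + 1), T j * (C + k) * (D + k - j) + V j -
          (C - A + k) * (C - B + k) * T j = G (j + 1) - G j := by
        intro j hj
        rw [hVG j hj]
        simp only [hG, hD]
        push_cast
        ring
      rw [Finset.sum_congr rfl this, Finset.sum_range_sub]
      simp [hG, hT]
    rw [Finset.sum_sub_distrib, ← Finset.mul_sum, ih] at hfin
    linear_combination hfin

lemma natCast_choose_eq {k j : ℕ} (h : j ≤ k) :
    (k.choose j : ℝ) = zfac k * (zinv j * zinv (k - j)) := by
  rw [Nat.cast_choose ℝ h, zinv_nonneg (k := j) (by omega), zinv_nonneg (k := k - j) (by omega),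
    show (k : ℤ) - j = ((k - j : ℕ) : ℤ) by omega, zfac_natCast, zfac_natCast, zfac_natCast]
  field_simp

lemma saalschutz_alternating {p M : ℕ} {x y : ℤ} (hpx : p ≤ x) (hpy : p ≤ y) (hMx : M ≤ x)
    (hMy : M ≤ y) :
    zinv (x - M) * zinv (y - M) * zinv (x - p) * zinv (y - p) *
      ∑ i ∈ Finset.range (p + 1), zinv (p - i) * zinv (M - i) * zinv i * zfac (x - i) *
        zfac (y - i) * rise (p + M - x - y - 1) i =
    zinv M * zinv p * zinv (x - p - M) * zinv (y - p - M) := by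
  have h := saalschutz (-(M : ℤ)) (p + M - x - y - 1) (-(x : ℤ)) p
  rw [show (-(x : ℝ)) - -((M : ℤ) : ℝ) = -((x - M : ℤ) : ℝ) by push_cast; ring,
    rise_neg (by omega : 0 ≤ x - M),
    show (-(x : ℝ)) - (p + M - x - y - 1) = ((y - M : ℤ) : ℝ) - p + 1 by push_cast; ring,
    rise_sub_add_one (by omega : 0 ≤ y - M)] at h
  have hterm : ∀ i ∈ Finset.range (p + 1), (p.choose i : ℝ) * rise (-((M : ℤ) : ℝ)) i *
      rise (p + M - x - y - 1) i * rise (-(x : ℝ) + i) (p - i) *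
      rise (-((x - M : ℤ) : ℝ) - (p + M - x - y - 1)) (p - i) =
      (-1) ^ p * (zfac p * zfac M * zinv (x - p) * zinv (y - p)) *
        (zinv (p - i) * zinv (M - i) * zinv i * zfac (x - i) *
        zfac (y - i) * rise (p + M - x - y - 1) i) := by
    intro i hi
    have hi' : i ≤ p := Finset.mem_range_succ_iff.mp hi
    rw [natCast_choose_eq hi', rise_neg (by omega : 0 ≤ (M : ℤ)),
      show -(x : ℝ) + i = -((x - i : ℤ) : ℝ) by push_cast; ring,
      rise_neg (by omega : 0 ≤ x - i),
      show -((x - M : ℤ) : ℝ) - (p + M - x - y - 1) = ((y - i : ℤ) : ℝ) - (p - i : ℕ) + 1 by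
        push_cast [hi']; ring,
      rise_sub_add_one (by omega : 0 ≤ y - i),
      show x - (i : ℤ) - (p - i : ℕ) = x - p by omega,
      show y - (i : ℤ) - (p - i : ℕ) = y - p by omega]
    have hpow : (-1 : ℝ) ^ i * (-1) ^ (p - i) = (-1) ^ p := by
      rw [← pow_add]; congr 1; omega
    rw [← hpow]; ring
  rw [Finset.sum_congr rfl hterm, ← Finset.mul_sum] at h
  have e1 := zfac_mul_zinv (k := p) (by omega)
  have e2 := zfac_mul_zinv (k := M) (by omega)
  have e3 := zfac_mul_zinv (k := x - M) (by omega)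
  have e4 := zfac_mul_zinv (k := y - M) (by omega)
  have e5 : (-1 : ℝ) ^ p * (-1) ^ p = 1 := by rw [← mul_pow]; norm_num
  set S := ∑ i ∈ Finset.range (p + 1), zinv (p - i) * zinv (M - i) * zinv i * zfac (x - i) *
        zfac (y - i) * rise (p + M - x - y - 1) i
  rw [show x - (M : ℤ) - p = x - p - M by ring, show y - (M : ℤ) - p = y - p - M by ring] at h
  calc zinv (x - M) * zinv (y - M) * zinv (x - p) * zinv (y - p) * S =
      ((-1 : ℝ) ^ p * (-1) ^ p) * (zfac p * zinv p) * (zfac M * zinv M) *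
        (zinv (x - M) * zinv (y - M) * zinv (x - p) * zinv (y - p) * S) := by
        rw [e5, e1, e2]; ring
    _ = (-1) ^ p * (zinv p * zinv M * zinv (x - M) * zinv (y - M)) *
        ((-1) ^ p * (zfac p * zfac M * zinv (x - p) * zinv (y - p)) * S) := by ring
    _ = ((-1 : ℝ) ^ p * (-1) ^ p) * (zfac (x - M) * zinv (x - M)) * (zfac (y - M) * zinv (y - M)) *
        (zinv M * zinv p * zinv (x - p - M) * zinv (y - p - M)) := by rw [h]; ring
    _ = _ := by rw [e5, e3, e4]; ring

/-- The first half of Whipple's transformation: a quotient of factorials is expanded by the sum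
of Saalschütz. -/
lemma saalschutz_expansion {α q Z : ℤ} (hα : 1 ≤ α) (hq : 0 ≤ q) (hZ : 0 ≤ Z) {p k : ℕ}
    (hk : k ≤ p) :
    zinv q * zinv (α + q - 1) * zfac Z * zfac (α + Z - 1) * ((-1) ^ k * zfac (α + q - 1 + k) *
      zinv (Z - k) * zinv (α + k - 1) * zinv k) =
    ∑ j ∈ Finset.range (p + 1), (-1) ^ j * zinv j * zinv (q - j) * zfac (α + Z - 1 + j) *
      zinv (α - 1 + j) * (zinv (k - j) * rise (q - Z) (k - j)) := by
  have h := saalschutz (-(q : ℝ)) ((α + Z : ℤ) : ℝ) α k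
  rw [show (α : ℝ) - -(q : ℝ) = ((α + q : ℤ) : ℝ) by push_cast; ring,
    rise_of_pos (by omega : 1 ≤ α + q), show (α : ℝ) - ((α + Z : ℤ) : ℝ) = -(Z : ℝ) by
      push_cast; ring, rise_neg hZ] at h
  have hterm : ∀ j ∈ Finset.range (k + 1), (k.choose j : ℝ) * rise (-(q : ℝ)) j *
      rise ((α + Z : ℤ) : ℝ) j * rise ((α : ℝ) + j) (k - j) *
      rise (((α + q : ℤ) : ℝ) - ((α + Z : ℤ) : ℝ)) (k - j) =
      (zfac k * zfac q * zinv (α + Z - 1) * zfac (α + k - 1)) * ((-1) ^ j * zinv j * zinv (q - j) *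
        zfac (α + Z - 1 + j) * zinv (α - 1 + j) * (zinv (k - j) * rise (q - Z) (k - j))) := by
    intro j hj
    have hj' : j ≤ k := Finset.mem_range_succ_iff.mp hj
    rw [natCast_choose_eq hj', rise_neg hq, rise_of_pos (by omega : 1 ≤ α + Z),
      show (α : ℝ) + j = ((α + j : ℤ) : ℝ) by push_cast; ring,
      rise_of_pos (by omega : 1 ≤ α + (j : ℤ)),
      show ((α + q : ℤ) : ℝ) - ((α + Z : ℤ) : ℝ) = q - Z by push_cast; ring,
      show α + Z + (j : ℤ) - 1 = α + Z - 1 + j by ring,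
      show α + (j : ℤ) + (k - j : ℕ) - 1 = α + k - 1 by omega,
      show α + (j : ℤ) - 1 = α - 1 + j by ring]
    ring
  rw [Finset.sum_congr rfl hterm, ← Finset.mul_sum] at h
  have hext : ∑ j ∈ Finset.range (p + 1), (-1) ^ j * zinv j * zinv (q - j) *
      zfac (α + Z - 1 + j) * zinv (α - 1 + j) * (zinv (k - j) * rise (q - Z) (k - j)) =
      ∑ j ∈ Finset.range (k + 1), (-1) ^ j * zinv j * zinv (q - j) *
      zfac (α + Z - 1 + j) * zinv (α - 1 + j) * (zinv (k - j) * rise (q - Z) (k - j)) := by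
    symm
    refine Finset.sum_subset (Finset.range_mono (by omega)) fun j _ hj => ?_
    rw [Finset.mem_range, not_lt] at hj
    rw [zinv_neg (k := (k : ℤ) - j) (by omega)]
    ring
  rw [hext]
  have e1 := zfac_mul_zinv (k := k) (by omega)
  have e2 := zfac_mul_zinv hq
  have e3 := zfac_mul_zinv (k := α + Z - 1) (by omega)
  have e4 := zfac_mul_zinv (k := α + k - 1) (by omega)
  rw [show α + q + (k : ℤ) - 1 = α + q - 1 + k by ring] at h
  set S := ∑ j ∈ Finset.range (k + 1), (-1) ^ j * zinv j * zinv (q - j) *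
      zfac (α + Z - 1 + j) * zinv (α - 1 + j) * (zinv (k - j) * rise (q - Z) (k - j))
  calc _ = zinv q * zfac (α + Z - 1) * zinv (α + k - 1) * zinv k *
        (zfac (α + q - 1 + k) * zinv (α + q - 1) * ((-1) ^ k * (zfac Z * zinv (Z - k)))) := by ring
    _ = (zfac k * zinv k) * (zfac q * zinv q) * (zfac (α + Z - 1) * zinv (α + Z - 1)) *
        (zfac (α + k - 1) * zinv (α + k - 1)) * S := by rw [← h]; ring
    _ = S := by rw [e1, e2, e3, e4]; ring

/-- The second half of Whipple's transformation. -/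
lemma saalschutz_shifted {p M j : ℕ} {x y : ℤ} (hpx : p ≤ x) (hpy : p ≤ y) (hMx : M ≤ x)
    (hMy : M ≤ y) (hj : j ≤ p) :
    zinv (x - M) * zinv (y - M) * zinv (x - p) * zinv (y - p) *
      ∑ k ∈ Finset.range (p + 1), zinv (p - k) * zinv (M - k) * zfac (x - k) * zfac (y - k) *
        (zinv (k - j) * rise (p + M - x - y - 1) (k - j)) =
    zinv (M - j) * zinv (p - j) * zinv (x - p - M + j) * zinv (y - p - M + j) := by
  by_cases hM : M < j
  · rw [zinv_neg (k := (M : ℤ) - j) (by omega), Finset.sum_eq_zero]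
    · ring
    · intro k _
      by_cases hk : k < j
      · rw [zinv_neg (k := (k : ℤ) - j) (by omega)]; ring
      · rw [zinv_neg (k := (M : ℤ) - k) (by omega)]; ring
  obtain ⟨M', rfl⟩ := Nat.exists_eq_add_of_le (not_lt.mp hM)
  obtain ⟨p', rfl⟩ := Nat.exists_eq_add_of_le hj
  rw [show j + p' + 1 = j + (p' + 1) by ring, Finset.sum_range_add,
    Finset.sum_eq_zero (s := Finset.range j), zero_add]
  · have h := saalschutz_alternating (p := p') (M := M') (x := x - j) (y := y - j)
      (by push_cast at hpx; omega) (by push_cast at hpy; omega) (by push_cast at hMx; omega)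
      (by push_cast at hMy; omega)
    push_cast at h ⊢
    rw [show (j : ℤ) + M' - j = M' by ring, show (j : ℤ) + p' - j = p' by ring,
      show x - ((j : ℤ) + p') - (j + M') + j = x - j - p' - M' by ring,
      show y - ((j : ℤ) + p') - (j + M') + j = y - j - p' - M' by ring, ← h,
      show x - ((j : ℤ) + M') = x - j - M' by ring, show y - ((j : ℤ) + M') = y - j - M' by ring,
      show x - ((j : ℤ) + p') = x - j - p' by ring, show y - ((j : ℤ) + p') = y - j - p' by ring]
    congr 1
    refine Finset.sum_congr rfl fun i _ => ?_
    rw [show (j : ℤ) + p' - (j + i) = p' - i by ring, show (j : ℤ) + M' - (j + i) = M' - i by ring,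
      show x - ((j : ℤ) + i) = x - j - i by ring, show y - ((j : ℤ) + i) = y - j - i by ring,
      show (j : ℤ) + i - j = i by ring, Nat.add_sub_cancel_left,
      show (j : ℝ) + p' + (j + M') - x - y - 1 = p' + M' - (x - j) - (y - j) - 1 by ring]
    ring
  · intro k hk
    rw [Finset.mem_range] at hk
    rw [zinv_neg (k := (k : ℤ) - j) (by omega)]; ring

/-- Whipple's transformation of a terminating balanced `₄F₃`, for integral parameters: one factor
of the summand is expanded by the sum of Saalschütz, and after the interchange of the two summations
the inner sum is again of Saalschütz's type. -/
theorem whipple {α β : ℤ} {p M n : ℕ} {x y : ℤ} (hα : 1 ≤ α) (hβ : 1 ≤ β) (hpx : p ≤ x)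
    (hpy : p ≤ y) (hMx : M ≤ x) (hMy : M ≤ y) (hpn : p ≤ n) :
    zinv (x - M) * zinv (y - M) * zinv (x - p) * zinv (y - p) * zinv (β + p - 1) *
      zinv (α + β + p - 2) * zfac (β + x + y - M) * zfac (α + β + x + y - M - 1) *
      ∑ k ∈ Finset.range (n + 1), (-1) ^ k * zfac (α + β + p + k - 2) * zinv (p - k) *
        (zfac (x - k) * zfac (y - k) * zinv k * zinv (M - k) * zinv (α + k - 1) *
          zinv (β + x + y - M - k)) =
    ∑ k ∈ Finset.range (M + 1), (-1) ^ k * zfac (α + β + x + y - M - 1 + k) * zinv (M - k) *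
      zinv (p - k) * zinv k * zinv (α - 1 + k) * zinv (β + p - 1 - k) * zinv (x - p - M + k) *
      zinv (y - p - M + k) := by
  set q := β + p - 1 with hq
  set Z := β + x + y - M with hZ
  have hcut : ∀ (f : ℕ → ℝ) (N : ℕ), (∀ k, p < k → f k = 0) → (∀ k, N < k → f k = 0) →
      ∑ k ∈ Finset.range (N + 1), f k = ∑ k ∈ Finset.range (p + 1), f k := by
    intro f N h1 h2
    rcases le_total p N with h | h
    · symm
      exact Finset.sum_subset (Finset.range_mono (by omega)) fun k _ hk =>
        h1 k (by simpa using hk)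
    · exact Finset.sum_subset (Finset.range_mono (by omega)) fun k _ hk =>
        h2 k (by simpa using hk)
  have hn : ∑ k ∈ Finset.range (n + 1), (-1) ^ k * zfac (α + β + p + k - 2) * zinv (p - k) *
        (zfac (x - k) * zfac (y - k) * zinv k * zinv (M - k) * zinv (α + k - 1) *
          zinv (Z - k)) = ∑ k ∈ Finset.range (p + 1), (-1) ^ k * zfac (α + β + p + k - 2) *
        zinv (p - k) * (zfac (x - k) * zfac (y - k) * zinv k * zinv (M - k) * zinv (α + k - 1) *
          zinv (Z - k)) := by
    symm
    refine Finset.sum_subset (Finset.range_mono (by omega)) fun k _ hk => ?_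
    rw [Finset.mem_range, not_lt] at hk
    rw [zinv_neg (k := (p : ℤ) - k) (by omega)]; ring
  rw [hn, hcut _ M (fun k hk => by rw [zinv_neg (k := (p : ℤ) - k) (by omega)]; ring)
    (fun k hk => by rw [zinv_neg (k := (M : ℤ) - k) (by omega)]; ring)]
  have h1 : ∀ k ∈ Finset.range (p + 1), zinv q * zinv (α + β + p - 2) * zfac Z *
      zfac (α + β + x + y - M - 1) * ((-1) ^ k * zfac (α + β + p + k - 2) * zinv (p - k) *
        (zfac (x - k) * zfac (y - k) * zinv k * zinv (M - k) * zinv (α + k - 1) *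
          zinv (Z - k))) = ∑ j ∈ Finset.range (p + 1), ((-1) ^ j * zinv j * zinv (q - j) *
          zfac (α + Z - 1 + j) * zinv (α - 1 + j)) * (zinv (p - k) * zinv (M - k) *
          zfac (x - k) * zfac (y - k) *
          (zinv (k - j) * rise (p + M - x - y - 1) (k - j))) := by
    intro k hk
    have h := saalschutz_expansion (α := α) (q := q) (Z := Z) hα (by omega) (by omega)
      (Finset.mem_range_succ_iff.mp hk)
    rw [show α + q - 1 = α + β + p - 2 by rw [hq]; ring,
      show α + β + p - 2 + k = α + β + p + k - 2 by ring,
      show α + Z - 1 = α + β + x + y - M - 1 by rw [hZ]; ring] at h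
    calc _ = (zinv (p - k) * zinv (M - k) * zfac (x - k) * zfac (y - k)) *
          (zinv q * zinv (α + β + p - 2) * zfac Z * zfac (α + β + x + y - M - 1) * ((-1) ^ k *
            zfac (α + β + p + k - 2) * zinv (Z - k) * zinv (α + k - 1) * zinv k)) := by ring
      _ = _ := by
        rw [h, Finset.mul_sum]
        refine Finset.sum_congr rfl fun j _ => ?_
        rw [show α + β + x + y - M - 1 = α + Z - 1 by rw [hZ]; ring,
          show (q : ℝ) - Z = p + M - x - y - 1 by rw [hq, hZ]; push_cast; ring]
        ring
  calc _ = zinv (x - M) * zinv (y - M) * zinv (x - p) * zinv (y - p) *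
        ∑ k ∈ Finset.range (p + 1), zinv q * zinv (α + β + p - 2) * zfac Z *
        zfac (α + β + x + y - M - 1) * ((-1) ^ k * zfac (α + β + p + k - 2) * zinv (p - k) *
        (zfac (x - k) * zfac (y - k) * zinv k * zinv (M - k) * zinv (α + k - 1) *
          zinv (Z - k))) := by rw [← Finset.mul_sum]; ring
    _ = ∑ j ∈ Finset.range (p + 1), ((-1) ^ j * zinv j * zinv (q - j) *
          zfac (α + Z - 1 + j) * zinv (α - 1 + j)) * (zinv (x - M) * zinv (y - M) *
          zinv (x - p) * zinv (y - p) * ∑ k ∈ Finset.range (p + 1), zinv (p - k) * zinv (M - k) *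
          zfac (x - k) * zfac (y - k) *
          (zinv (k - j) * rise (p + M - x - y - 1) (k - j))) := by
        rw [Finset.sum_congr rfl h1, Finset.sum_comm, Finset.mul_sum]
        refine Finset.sum_congr rfl fun j _ => ?_
        rw [← Finset.mul_sum]; ring
    _ = _ := by
        refine Finset.sum_congr rfl fun j hj => ?_
        rw [saalschutz_shifted hpx hpy hMx hMy (Finset.mem_range_succ_iff.mp hj),
          show α + Z - 1 = α + β + x + y - M - 1 by rw [hZ]; ring]
        ring

/-! ### Racah's formula -/

/-- The alternating sum of Racah's formula in the SU(1,1) region, with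
`2 j₁ = α`, `2 j₂ = β`, `2 j₃ = γ`, `j₁₂ = j₁ + j₂ + i`, `j₂₃ = j₂ + j₃ + l` and
`j = j₁ + j₂₃ + M`. -/
def racahSum (α β γ : ℤ) (i l M : ℕ) : ℝ :=
  ∑ k ∈ Finset.range (M + 1), (-1) ^ k * zfac (α + β + γ + M + 2 * l - 2 + k) * zinv (M - k) *
      zinv (i - k) * zinv k * zinv (α - 1 + k) * zinv (β + i - 1 - k) * zinv (l - i + k) *
      zinv (γ + l - 1 - i + k)

/-- The recoupling coefficients by Racah's formula; the sum that arises from the recoupling of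
lowest weight vectors is transformed by `whipple`. -/
lemma kapRec_eq_racahSum {α β γ : ℤ} (hα : 1 ≤ α) (hβ : 1 ≤ β) (hγ : 1 ≤ γ) {i l N M : ℕ}
    (h : i + N = l + M) :
    kapRec α β γ (l + M) i l * (zinv i * zinv (i + α - 1) * zinv (i + β - 1) *
      zinv (α + β + i - 2) * zinv N * zinv (N + γ - 1) *
      zfac (M + (β + γ + 2 * l) - 1) * zfac (α + (β + γ + 2 * l) + M - 2)) =
      (2 * (i : ℝ) + (α + β : ℤ) - 1) * ((-1) ^ i * racahSum α β γ i l M) := by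
  have hw := whipple (α := α) (β := β) (p := i) (M := M) (n := l + M) (x := l + M)
    (y := γ + l + M - 1) hα hβ (by omega) (by omega) (by omega) (by omega) (by omega)
  have hN : (N : ℤ) = l + M - i := by omega
  have hr : racahSum α β γ i l M = ∑ k ∈ Finset.range (M + 1), (-1) ^ k *
      zfac (α + β + (l + M) + (γ + l + M - 1) - M - 1 + k) * zinv (M - k) *
      zinv (i - k) * zinv k * zinv (α - 1 + k) * zinv (β + i - 1 - k) *
      zinv ((l + M) - i - M + k) * zinv ((γ + l + M - 1) - i - M + k) := by
    refine Finset.sum_congr rfl fun k _ => ?_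
    rw [show α + β + γ + M + 2 * l - 2 + k = α + β + (l + M) + (γ + l + M - 1) - M - 1 + k by ring,
      show (l : ℤ) - i + k = (l + M) - i - M + k by ring,
      show γ + (l : ℤ) - 1 - i + k = (γ + l + M - 1) - i - M + k by ring]
  rw [hr, ← hw]
  have hs : ∑ k ∈ Finset.range (l + M + 1), ((-1) ^ (i + k) * zfac (α + β + i + k - 2) *
      zinv (i - k)) * sliceCoeff α β γ (l + M : ℕ) l k = (-1) ^ i *
      ∑ k ∈ Finset.range (l + M + 1), (-1) ^ k * zfac (α + β + i + k - 2) * zinv (i - k) *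
        (zfac ((l + M) - k) * zfac ((γ + l + M - 1) - k) * zinv k * zinv (M - k) *
          zinv (α + k - 1) * zinv (β + (l + M) + (γ + l + M - 1) - M - k)) := by
    rw [Finset.mul_sum]
    refine Finset.sum_congr rfl fun k _ => ?_
    rw [sliceCoeff, pow_add]
    push_cast
    rw [show γ + ((l : ℤ) + M) - k - 1 = (γ + l + M - 1) - k by ring,
      show (l : ℤ) + M - l - k = M - k by ring,
      show β + γ + l + ((l : ℤ) + M) - 1 - k = β + (l + M) + (γ + l + M - 1) - M - k by ring]
    ring
  unfold kapRec
  rw [hs]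
  set S := ∑ k ∈ Finset.range (l + M + 1), (-1) ^ k * zfac (α + β + i + k - 2) * zinv (i - k) *
        (zfac ((l + M) - k) * zfac ((γ + l + M - 1) - k) * zinv k * zinv (M - k) *
          zinv (α + k - 1) * zinv (β + (l + M) + (γ + l + M - 1) - M - k))
  have e1 := zfac_mul_zinv (k := i) (by omega)
  have e2 := zfac_mul_zinv (k := α + i - 1) (by omega)
  rw [show (i : ℤ) + α - 1 = α + i - 1 by ring, show (i : ℤ) + β - 1 = β + i - 1 by ring,
    show (N : ℤ) + γ - 1 = γ + l + M - 1 - i by rw [hN]; ring, hN,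
    show (M : ℤ) + (β + γ + 2 * l) - 1 = β + (l + M) + (γ + l + M - 1) - M by ring,
    show α + (β + γ + 2 * l) + (M : ℤ) - 2 = α + β + (l + M) + (γ + l + M - 1) - M - 1 by ring,
    show (l : ℤ) + M - M = l by ring, show γ + l + (M : ℤ) - 1 - M = γ + l - 1 by ring]
  calc _ = (zfac i * zinv i) * (zfac (α + i - 1) * zinv (α + i - 1)) *
      ((2 * (i : ℝ) + (α + β : ℤ) - 1) * ((-1) ^ i * (zinv l * zinv (γ + l - 1) *
        zinv (l + M - i) * zinv (γ + l + M - 1 - i) * zinv (β + i - 1) * zinv (α + β + i - 2) *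
        zfac (β + (l + M) + (γ + l + M - 1) - M) *
        zfac (α + β + (l + M) + (γ + l + M - 1) - M - 1) * S))) := by ring
    _ = _ := by rw [e1, e2]; ring

lemma triangleSU2_iff {x y z : ℚ} {k₁ k₂ k₃ k₄ : ℤ} (h₁ : x + y - z = k₁) (h₂ : x - y + z = k₂)
    (h₃ : -x + y + z = k₃) (h₄ : x + y + z + 1 = k₄) :
    TriangleSU2 x y z ↔ 0 ≤ k₁ ∧ 0 ≤ k₂ ∧ 0 ≤ k₃ ∧ 0 ≤ k₄ := by
  rw [TriangleSU2, isNat_iff h₁, isNat_iff h₂, isNat_iff h₃, isNat_iff h₄]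

lemma triDeltaSU2_eq {x y z : ℚ} {k₁ k₂ k₃ k₄ : ℤ} (h₁ : x + y - z = k₁) (h₂ : x - y + z = k₂)
    (h₃ : -x + y + z = k₃) (h₄ : x + y + z + 1 = k₄) :
    triDeltaSU2 x y z = √(zfac k₁ * zfac k₂ * zfac k₃ / zfac k₄) := by
  rw [triDeltaSU2, fac_eq h₁, fac_eq h₂, fac_eq h₃, fac_eq h₄]

/-- The square of the product of the four factors `Δ` of Racah's formula. -/
def racahDeltaSq (α β γ : ℤ) (i l N M : ℕ) : ℝ :=
  (zfac N * zfac (α + β + i - 2) * zfac i / zfac (N + (α + β + 2 * i) - 1)) *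
    (zfac (i + β - 1) * zfac (i + α - 1) * zfac (N + γ - 1) /
      zfac (α + β + 2 * i + γ + N - 2)) *
    (zfac M * zfac l * zfac (β + γ + l - 2) / zfac (M + (β + γ + 2 * l) - 1)) *
    (zfac (M + α - 1) * zfac (l + β - 1) * zfac (l + γ - 1) /
      zfac (α + (β + γ + 2 * l) + M - 2))

/-- The extended symbol on admissible labels. -/
lemma sixJExt_eq {a b c d e f : ℚ} {α β γ i l N M : ℕ} (h : i + N = l + M) (hα : 1 ≤ α)
    (hβ : 1 ≤ β) (hγ : 1 ≤ γ) (ha : a = (α : ℚ) / 2 - 1) (hb : b = (β : ℚ) / 2 - 1)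
    (hd : d = (γ : ℚ) / 2 - 1)
    (hc : c = (α + β + 2 * i : ℚ) / 2 - 1) (hf : f = (β + γ + 2 * l : ℚ) / 2 - 1)
    (he : e = (α + β + γ + 2 * (l + M) : ℚ) / 2 - 1) :
    sixJExt a b c d e f = √(racahDeltaSq α β γ i l N M) *
      ((-1) ^ (α + β + γ + M + 2 * l + 1) * racahSum α β γ i l M) := by
  have hN : (N : ℚ) = l + M - i := by
    have : (i : ℚ) + N = l + M := by exact_mod_cast h
    linarith
  set A := (a + b - d + e) / 2 with hA
  set B := (-a - b - d + e) / 2 - 1 with hB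
  set D := (-a + b + d + e) / 2 with hD
  set E := (a - b + d + e) / 2 with hE
  have t1 : A + B - c = (N : ℤ) := by push_cast; rw [hA, hB, ha, hb, hc, hd, he, hN]; ring
  have t2 : A - B + c = (α + β + i - 2 : ℤ) := by
    push_cast; rw [hA, hB, ha, hb, hc]; ring
  have t3 : -A + B + c = (i : ℤ) := by push_cast; rw [hA, hB, ha, hb, hc]; ring
  have t4 : A + B + c + 1 = (N + (α + β + 2 * i) - 1 : ℤ) := by
    push_cast; rw [hA, hB, hc, hd, he, hN]; ring
  have u1 : c + D - E = (i + β - 1 : ℤ) := by push_cast; rw [hD, hE, ha, hb, hc]; ring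
  have u2 : c - D + E = (i + α - 1 : ℤ) := by push_cast; rw [hD, hE, ha, hb, hc]; ring
  have u3 : -c + D + E = (N + γ - 1 : ℤ) := by
    push_cast; rw [hD, hE, hc, hd, he, hN]; ring
  have u4 : c + D + E + 1 = (α + β + 2 * i + γ + N - 2 : ℤ) := by
    push_cast; rw [hD, hE, hc, hd, he, hN]; ring
  have v1 : B + D - f = (M : ℤ) := by push_cast; rw [hB, hD, ha, he, hf]; ring
  have v2 : B - D + f = (l : ℤ) := by push_cast; rw [hB, hD, hb, hd, hf]; ring
  have v3 : -B + D + f = (β + γ + l - 2 : ℤ) := by push_cast; rw [hB, hD, hb, hd, hf]; ring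
  have v4 : B + D + f + 1 = (M + (β + γ + 2 * l) - 1 : ℤ) := by
    push_cast; rw [hB, hD, ha, he, hf]; ring
  have w1 : A + E - f = (M + α - 1 : ℤ) := by push_cast; rw [hA, hE, ha, he, hf]; ring
  have w2 : A - E + f = (l + β - 1 : ℤ) := by push_cast; rw [hA, hE, hb, hd, hf]; ring
  have w3 : -A + E + f = (l + γ - 1 : ℤ) := by push_cast; rw [hA, hE, hb, hd, hf]; ring
  have w4 : A + E + f + 1 = (α + (β + γ + 2 * l) + M - 2 : ℤ) := by
    push_cast; rw [hA, hE, ha, he, hf]; ring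
  have p := fun k => (zfac_pos k).le
  have pq : ∀ k₁ k₂ k₃ k₄ : ℤ, 0 ≤ zfac k₁ * zfac k₂ * zfac k₃ / zfac k₄ := fun k₁ k₂ k₃ k₄ =>
    div_nonneg (mul_nonneg (mul_nonneg (p _) (p _)) (p _)) (p _)
  rw [sixJExt, sixJSU2, if_pos ⟨(triangleSU2_iff t1 t2 t3 t4).mpr (by omega),
    (triangleSU2_iff u1 u2 u3 u4).mpr (by omega), (triangleSU2_iff v1 v2 v3 v4).mpr (by omega),
    (triangleSU2_iff w1 w2 w3 w4).mpr (by omega)⟩, triDeltaSU2_eq t1 t2 t3 t4,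
    triDeltaSU2_eq u1 u2 u3 u4, triDeltaSU2_eq v1 v2 v3 v4, triDeltaSU2_eq w1 w2 w3 w4,
    ← Real.sqrt_mul (pq _ _ _ _), ← Real.sqrt_mul (mul_nonneg (pq _ _ _ _) (pq _ _ _ _)),
    ← Real.sqrt_mul (mul_nonneg (mul_nonneg (pq _ _ _ _) (pq _ _ _ _)) (pq _ _ _ _))]
  unfold racahDeltaSq
  congr 1
  -- Only the indices `z = α + β + γ + M + 2 l - 3 + k` with `k ≥ 0` contribute.
  obtain ⟨T, hT⟩ : ∃ T : ℕ, α + β + γ + M + 2 * l = T + 3 := ⟨α + β + γ + M + 2 * l - 3, by omega⟩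
  have hTq : (α : ℚ) + β + γ + M + 2 * l = T + 3 := by exact_mod_cast hT
  have hfl : ⌊A + B + D + E⌋₊ = T + M := by
    have : A + B + D + E = ((T + M : ℕ) : ℚ) := by
      push_cast; rw [hA, hB, hD, hE, he]; linear_combination hTq
    rw [this, Nat.floor_natCast]
  rw [hfl, add_assoc, Finset.sum_range_add, Finset.sum_eq_zero (s := Finset.range T), zero_add,
    racahSum, Finset.mul_sum]
  · refine Finset.sum_congr rfl fun k _ => ?_
    rw [invFac_eq (x := ((T + k : ℕ) : ℚ) - A - B - c) (k := γ + l - 1 - i + k)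
        (by push_cast; push_cast at t4; linear_combination -t4 - hTq - hN),
      invFac_eq (x := ((T + k : ℕ) : ℚ) - c - D - E) (k := l - i + k)
        (by push_cast; push_cast at u4; linear_combination -u4 - hTq - hN),
      invFac_eq (x := ((T + k : ℕ) : ℚ) - B - D - f) (k := α - 1 + k)
        (by push_cast; push_cast at v4; linear_combination -v4 - hTq),
      invFac_eq (x := ((T + k : ℕ) : ℚ) - A - E - f) (k := k)
        (by push_cast; push_cast at w4; linear_combination -w4 - hTq),
      invFac_eq (x := A + B + D + E - ((T + k : ℕ) : ℚ)) (k := M - k)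
        (by push_cast; rw [hA, hB, hD, hE, he]; linear_combination hTq),
      invFac_eq (x := A + c + D + f - ((T + k : ℕ) : ℚ)) (k := β + i - 1 - k)
        (by push_cast; rw [hA, hD, hb, hc, hf, he]; linear_combination hTq),
      invFac_eq (x := B + c + E + f - ((T + k : ℕ) : ℚ)) (k := i - k)
        (by push_cast; rw [hB, hE, hb, hc, hf, he]; linear_combination hTq)]
    rw [show (α : ℤ) + β + γ + M + 2 * l - 2 + k = ((T + k + 1 : ℕ) : ℤ) by push_cast; omega,
      zfac_natCast, hT, show T + 3 + 1 = T + 4 by ring, pow_add, pow_add]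
    norm_num
    ring
  · intro ν hν
    rw [Finset.mem_range] at hν
    rw [invFac_eq (x := (ν : ℚ) - A - E - f) (k := ν - T)
        (by push_cast; push_cast at w4; linear_combination -w4 - hTq),
      zinv_neg (k := (ν : ℤ) - T) (by omega)]
    ring

/-- The normalisation constants of the two schemes against the factors `Δ` of Racah's formula. -/
lemma sqrt_nrmSq_ratio {α β γ i l N M : ℕ} (h : i + N = l + M) (hα : 1 ≤ α) (hβ : 1 ≤ β)
    (hγ : 1 ≤ γ) :
    (√(nrmSq β γ l) * √(nrmSq α (β + γ + 2 * l) M)) /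
      (√(nrmSq α β i) * √(nrmSq (α + β + 2 * i) γ N)) =
    √((α + β + 2 * i - 1) * (β + γ + 2 * l - 1)) * √(racahDeltaSq α β γ i l N M) *
      (zinv i * zinv (i + α - 1) * zinv (i + β - 1) *
      zinv (α + β + i - 2) * zinv N * zinv (N + γ - 1) *
      zfac (M + (β + γ + 2 * l) - 1) * zfac (α + (β + γ + 2 * l) + M - 2) /
        (α + β + 2 * i - 1)) := by
  have pos : ∀ a b c : ℕ, 1 ≤ a → 1 ≤ b → (0 : ℝ) < a + b + 2 * c - 1 := fun a b c ha hb => by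
    have h1 : (1 : ℝ) ≤ a := by exact_mod_cast ha
    have h2 : (1 : ℝ) ≤ b := by exact_mod_cast hb
    have h3 : (0 : ℝ) ≤ c := by positivity
    linarith
  have p1 := pos α β i hα hβ
  have p2 := pos β γ l hβ hγ
  have p3 : (0 : ℝ) < α + (β + γ + 2 * l) + 2 * M - 1 := by
    have := pos α (β + γ + 2 * l) M hα (by omega)
    push_cast at this; exact this
  have e3 : (α : ℝ) + β + 2 * i + γ + 2 * N - 1 = α + (β + γ + 2 * l) + 2 * M - 1 := by
    have : (i : ℝ) + N = l + M := by exact_mod_cast h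
    linear_combination 2 * this
  rw [zinv_nonneg (k := i) (by omega), zinv_nonneg (k := i + α - 1) (by omega),
    zinv_nonneg (k := i + β - 1) (by omega), zinv_nonneg (k := α + β + i - 2) (by omega),
    zinv_nonneg (k := N) (by omega), zinv_nonneg (k := N + γ - 1) (by omega)]
  unfold racahDeltaSq nrmSq
  push_cast
  rw [e3]
  generalize (α : ℝ) + β + 2 * i - 1 = x1 at *
  generalize (β : ℝ) + γ + 2 * l - 1 = x2 at *
  generalize (α : ℝ) + (β + γ + 2 * l) + 2 * M - 1 = x3 at *
  have a1 := zfac_pos i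
  have a2 := zfac_pos (i + α - 1)
  have a3 := zfac_pos (i + β - 1)
  have a4 := zfac_pos (α + β + i - 2)
  have a5 := zfac_pos N
  have a6 := zfac_pos (N + γ - 1)
  have a7 := zfac_pos (N + (α + β + 2 * i) - 1)
  have a8 := zfac_pos (α + β + 2 * i + γ + N - 2)
  have a9 := zfac_pos l
  have b1 := zfac_pos (l + β - 1)
  have b2 := zfac_pos (l + γ - 1)
  have b3 := zfac_pos (β + γ + l - 2)
  have b4 := zfac_pos M
  have b5 := zfac_pos (M + α - 1)
  have b6 := zfac_pos (M + (β + γ + 2 * l) - 1)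
  have b7 := zfac_pos (α + (β + γ + 2 * l) + M - 2)
  generalize zfac i = y1 at *
  generalize zfac (i + α - 1) = y2 at *
  generalize zfac (i + β - 1) = y3 at *
  generalize zfac (α + β + i - 2) = y4 at *
  generalize zfac N = y5 at *
  generalize zfac (N + γ - 1) = y6 at *
  generalize zfac (N + (α + β + 2 * i) - 1) = y7 at *
  generalize zfac (α + β + 2 * i + γ + N - 2) = y8 at *
  generalize zfac l = y9 at *
  generalize zfac (l + β - 1) = z1 at *
  generalize zfac (l + γ - 1) = z2 at *
  generalize zfac (β + γ + l - 2) = z3 at *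
  generalize zfac M = z4 at *
  generalize zfac (M + α - 1) = z5 at *
  generalize zfac (M + (β + γ + 2 * l) - 1) = z6 at *
  generalize zfac (α + (β + γ + 2 * l) + M - 2) = z7 at *
  rw [← Real.sqrt_mul (by positivity), ← Real.sqrt_mul (by positivity),
    ← Real.sqrt_mul (by positivity), ← Real.sqrt_div (by positivity)]
  rw [Real.sqrt_eq_iff_mul_self_eq (by positivity) (by positivity),
    mul_mul_mul_comm (√_) _ (√_), Real.mul_self_sqrt (by positivity)]
  field_simp

/-- Racah's formula for the SU(1,1) symbol. -/
theorem sixJ_eq_sixJExt {a b c d e f : Spin} {i l N M : ℕ} (h : i + N = l + M)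
    (hc : dbl c = dbl a + dbl b + 2 * i) (hf : dbl f = dbl b + dbl d + 2 * l)
    (he : dbl e = dbl a + dbl b + dbl d + 2 * (l + M)) :
    sixJ a b c d e f = (-1) ^ (i + l + 1) *
      sixJExt ((a : ℚ) - 1) (b - 1) (c - 1) (d - 1) (e - 1) (f - 1) := by
  have ha0 := dbl_pos a
  have hb0 := dbl_pos b
  have hd0 := dbl_pos d
  have ha := coe_eq_dbl a
  have hb := coe_eq_dbl b
  have hd := coe_eq_dbl d
  have hcq := coe_eq_dbl c
  have hfq := coe_eq_dbl f
  have heq := coe_eq_dbl e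
  rw [hc] at hcq
  rw [hf] at hfq
  rw [he] at heq
  have key := recFactor_mul_sixJ_eq_ncgRec (a := a) (b := b) (c := c) (d := d) (e := e) (f := f)
    (n := l + M) (i := i) (l := l) (by omega) (by omega) hc hf he
  have hr := sqrt_nrmSq_ratio h ha0 hb0 hd0
  have hk := kapRec_eq_racahSum (α := dbl a) (β := dbl b) (γ := dbl d) (by omega) (by omega)
    (by omega) h
  rw [ncgRec, show ((l + M : ℕ) : ℤ) - l = M by push_cast; ring,
    show ((l + M : ℕ) : ℤ) - i = N by omega, mul_div_assoc, hr] at key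
  have hroot : (((2 * (c : ℚ) - 1) * (2 * (f : ℚ) - 1) : ℚ) : ℝ) =
      (dbl a + dbl b + 2 * i - 1) * (dbl b + dbl d + 2 * l - 1) := by
    rw [hcq, hfq]; push_cast; ring
  have hrec := recFactor_ne_zero (e := e) hc hf
  rw [sixJExt_eq h ha0 hb0 hd0 (by rw [ha]) (by rw [hb]) (by rw [hd])
    (by rw [hcq]; push_cast; ring) (by rw [hfq]; push_cast; ring) (by rw [heq]; push_cast; ring)]
  apply mul_left_cancel₀ hrec
  rw [key, recFactor, hroot, sgn_eq (k := dbl a + dbl b + dbl d + l + M)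
    (by rw [ha, hb, hd, heq]; push_cast; ring)]
  have hx : (dbl a : ℝ) + dbl b + 2 * i - 1 ≠ 0 := by
    have h1 : (1 : ℝ) ≤ dbl a := by exact_mod_cast ha0
    have h2 : (1 : ℝ) ≤ dbl b := by exact_mod_cast hb0
    have h3 : (0 : ℝ) ≤ i := by positivity
    linarith
  have hsgn : (-1 : ℝ) ^ ((dbl a : ℤ) + dbl b + dbl d + l + M) * ((-1) ^ (i + l + 1) *
      (-1) ^ (dbl a + dbl b + dbl d + M + 2 * l + 1)) = (-1) ^ i := by
    simp only [← zpow_natCast, ← zpow_add₀ (show (-1 : ℝ) ≠ 0 by norm_num)]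
    apply neg_one_zpow_congr
    rw [Int.even_iff]
    push_cast
    omega
  set r := √(((dbl a : ℝ) + dbl b + 2 * i - 1) * (dbl b + dbl d + 2 * l - 1))
  set D := √(racahDeltaSq (dbl a) (dbl b) (dbl d) i l N M)
  set Q := racahSum (dbl a) (dbl b) (dbl d) i l M
  calc _ = r * D / ((dbl a : ℝ) + dbl b + 2 * i - 1) *
        (kapRec (dbl a) (dbl b) (dbl d) (l + M) i l * (zinv i * zinv (i + dbl a - 1) *
        zinv (i + dbl b - 1) * zinv (dbl a + dbl b + i - 2) * zinv N * zinv (N + dbl d - 1) *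
        zfac (M + (dbl b + dbl d + 2 * l) - 1) *
        zfac (dbl a + (dbl b + dbl d + 2 * l) + M - 2))) := by ring
    _ = r * D * ((-1) ^ i * Q) := by
        rw [hk]
        push_cast
        field_simp
        ring
    _ = _ := by rw [← hsgn]; ring

/-! ### Reflections of the extended symbol -/

/-- The conditions under which the extended symbol is given by Racah's formula, in pairs
that are interchanged by the reflections `x ↦ -1 - x` of the labels `a`, `b` and `d`. -/
def ExtDomain (a b c d e f : ℚ) : Prop :=
  (IsNat (e - d - 1 - c) ∧ IsNat (e - d + c)) ∧ (IsNat (d + e - c) ∧ IsNat (c + d + e + 1)) ∧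
    (IsNat (a + b + 1 + c) ∧ IsNat (c - a - b - 1)) ∧ (IsNat (c + b - a) ∧ IsNat (c - b + a)) ∧
    (IsNat (e - a - 1 - f) ∧ IsNat (e - a + f)) ∧ (IsNat (a + e - f) ∧ IsNat (a + e + f + 1)) ∧
    (IsNat (f - b - d - 1) ∧ IsNat (b + d + 1 + f)) ∧ (IsNat (b - d + f) ∧ IsNat (d - b + f))

/-- The square of the product of the factors `Δ` in the extended symbol. -/
def extDeltaSq (a b c d e f : ℚ) : ℝ :=
  (fac (e - d - 1 - c) / fac (e - d + c)) * (fac (d + e - c) / fac (c + d + e + 1)) *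
    (fac (a + b + 1 + c) * fac (c - a - b - 1)) * (fac (c + b - a) * fac (c - b + a)) *
    (fac (e - a - 1 - f) / fac (e - a + f)) * (fac (a + e - f) / fac (a + e + f + 1)) *
    (fac (f - b - d - 1) * fac (b + d + 1 + f)) * (fac (b - d + f) * fac (d - b + f))

/-- The alternating sum in the extended symbol. -/
def extSum (a b c d e f : ℚ) : ℝ :=
  ∑ n ∈ Finset.range (⌊2 * e - 1⌋₊ + 1), (-1 : ℝ) ^ n * (Nat.factorial (n + 1) : ℝ) *
    (invFac (n - e + d + 1 - c) * invFac (n - c - d - e) * invFac (n - e + a + 1 - f) *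
      invFac (n - a - e - f) * invFac (2 * e - 1 - n) * invFac (b + e + c + f - n) *
      invFac (e - b - 1 + c + f - n))

open Classical in
/-- The extended symbol in terms of its own labels. -/
lemma sixJExt_eq_ite (a b c d e f : ℚ) : sixJExt a b c d e f =
    if ExtDomain a b c d e f then √(extDeltaSq a b c d e f) * extSum a b c d e f else 0 := by
  have p : ∀ x, 0 ≤ fac x := fun x => Nat.cast_nonneg _
  have pq : ∀ k₁ k₂ k₃ k₄ : ℚ, 0 ≤ fac k₁ * fac k₂ * fac k₃ / fac k₄ := fun k₁ k₂ k₃ k₄ =>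
    div_nonneg (mul_nonneg (mul_nonneg (p _) (p _)) (p _)) (p _)
  rw [sixJExt, sixJSU2]
  generalize hA : (a + b - d + e) / 2 = A
  generalize hB : (-a - b - d + e) / 2 - 1 = B
  generalize hD : (-a + b + d + e) / 2 = D
  generalize hE : (a - b + d + e) / 2 = E
  have t1 : A + B - c = e - d - 1 - c := by rw [← hA, ← hB]; ring
  have t2 : A - B + c = a + b + 1 + c := by rw [← hA, ← hB]; ring
  have t3 : -A + B + c = c - a - b - 1 := by rw [← hA, ← hB]; ring
  have t4 : A + B + c + 1 = e - d + c := by rw [← hA, ← hB]; ring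
  have t5 : c + D - E = c + b - a := by rw [← hD, ← hE]; ring
  have t6 : c - D + E = c - b + a := by rw [← hD, ← hE]; ring
  have t7 : -c + D + E = d + e - c := by rw [← hD, ← hE]; ring
  have t8 : c + D + E + 1 = c + d + e + 1 := by rw [← hD, ← hE]; ring
  have t9 : B + D - f = e - a - 1 - f := by rw [← hB, ← hD]; ring
  have t10 : B - D + f = f - b - d - 1 := by rw [← hB, ← hD]; ring
  have t11 : -B + D + f = b + d + 1 + f := by rw [← hB, ← hD]; ring
  have t12 : B + D + f + 1 = e - a + f := by rw [← hB, ← hD]; ring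
  have t13 : A + E - f = a + e - f := by rw [← hA, ← hE]; ring
  have t14 : A - E + f = b - d + f := by rw [← hA, ← hE]; ring
  have t15 : -A + E + f = d - b + f := by rw [← hA, ← hE]; ring
  have t16 : A + E + f + 1 = a + e + f + 1 := by rw [← hA, ← hE]; ring
  have t17 : A + B + D + E = 2 * e - 1 := by rw [← hA, ← hB, ← hD, ← hE]; ring
  refine if_congr ?_ ?_ rfl
  · simp only [TriangleSU2, ExtDomain, t1, t2, t3, t4, t5, t6, t7, t8, t9, t10, t11, t12, t13, t14,
      t15, t16]
    constructor
    · rintro ⟨⟨h1, h2, h3, h4⟩, ⟨h5, h6, h7, h8⟩, ⟨h9, k1, k2, k3⟩, ⟨k4, k5, k6, k7⟩⟩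
      exact ⟨⟨h1, h4⟩, ⟨h7, h8⟩, ⟨h2, h3⟩, ⟨h5, h6⟩, ⟨h9, k3⟩, ⟨k4, k7⟩, ⟨k1, k2⟩, ⟨k5, k6⟩⟩
    · rintro ⟨⟨h1, h4⟩, ⟨h7, h8⟩, ⟨h2, h3⟩, ⟨h5, h6⟩, ⟨h9, k3⟩, ⟨k4, k7⟩, ⟨k1, k2⟩, ⟨k5, k6⟩⟩
      exact ⟨⟨h1, h2, h3, h4⟩, ⟨h5, h6, h7, h8⟩, ⟨h9, k1, k2, k3⟩, ⟨k4, k5, k6, k7⟩⟩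
  · rw [triDeltaSU2, triDeltaSU2, triDeltaSU2, triDeltaSU2, ← Real.sqrt_mul (pq _ _ _ _),
      ← Real.sqrt_mul (mul_nonneg (pq _ _ _ _) (pq _ _ _ _)),
      ← Real.sqrt_mul (mul_nonneg (mul_nonneg (pq _ _ _ _) (pq _ _ _ _)) (pq _ _ _ _)),
      t1, t2, t3, t4, t5, t6, t7, t8, t9, t10, t11, t12, t13, t14, t15, t16, t17]
    congr 1
    · unfold extDeltaSq
      congr 1
      ring
    · refine Finset.sum_congr rfl fun n _ => ?_
      rw [show (n : ℚ) - A - B - c = n - e + d + 1 - c by rw [← hA, ← hB]; ring,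
        show (n : ℚ) - c - D - E = n - c - d - e by rw [← hD, ← hE]; ring,
        show (n : ℚ) - B - D - f = n - e + a + 1 - f by rw [← hB, ← hD]; ring,
        show (n : ℚ) - A - E - f = n - a - e - f by rw [← hA, ← hE]; ring,
        show A + c + D + f - n = b + e + c + f - n by rw [← hA, ← hD]; ring,
        show B + c + E + f - n = e - b - 1 + c + f - n by rw [← hB, ← hE]; ring]

open Classical in
/-- The reflection `x ↦ -1 - x` of the first label, with `x = a - 1`. -/
lemma sixJExt_reflect_first (a b c d e f : ℚ) :
    sixJExt (-a) b c d e f = sixJExt (a - 1) b c d e f := by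
  rw [sixJExt_eq_ite, sixJExt_eq_ite]
  refine if_congr ?_ ?_ rfl
  · simp only [ExtDomain]
    rw [show -a + b + 1 + c = c - (a - 1) + b by ring,
      show c - -a - b - 1 = c - b + (a - 1) by ring,
      show c + b - -a = a - 1 + b + 1 + c by ring, show c - b + -a = c - (a - 1) - b - 1 by ring,
      show e - -a - 1 - f = a - 1 + e - f by ring, show e - -a + f = a - 1 + e + f + 1 by ring,
      show -a + e - f = e - (a - 1) - 1 - f by ring, show -a + e + f + 1 = e - (a - 1) + f by ring,
      show c - (a - 1) + b = c + b - (a - 1) by ring]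
    tauto
  · congr 1
    · unfold extDeltaSq
      rw [show -a + b + 1 + c = c + b - (a - 1) by ring,
        show c - -a - b - 1 = c - b + (a - 1) by ring,
        show c + b - -a = a - 1 + b + 1 + c by ring, show c - b + -a = c - (a - 1) - b - 1 by ring,
        show e - -a - 1 - f = a - 1 + e - f by ring, show e - -a + f = a - 1 + e + f + 1 by ring,
        show -a + e - f = e - (a - 1) - 1 - f by ring,
        show -a + e + f + 1 = e - (a - 1) + f by ring]
      congr 1
      ring
    · refine Finset.sum_congr rfl fun n _ => ?_
      rw [show (n : ℚ) - e + -a + 1 - f = n - (a - 1) - e - f by ring,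
        show (n : ℚ) - -a - e - f = n - e + (a - 1) + 1 - f by ring]
      ring

open Classical in
/-- The reflection `x ↦ -1 - x` of the second label, with `x = b - 1`. -/
lemma sixJExt_reflect_second (a b c d e f : ℚ) :
    sixJExt a (-b) c d e f = sixJExt a (b - 1) c d e f := by
  rw [sixJExt_eq_ite, sixJExt_eq_ite]
  refine if_congr ?_ ?_ rfl
  · simp only [ExtDomain]
    rw [show a + -b + 1 + c = c - (b - 1) + a by ring,
      show c - a - -b - 1 = c + (b - 1) - a by ring,
      show c + -b - a = c - a - (b - 1) - 1 by ring, show c - -b + a = a + (b - 1) + 1 + c by ring,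
      show f - -b - d - 1 = b - 1 - d + f by ring, show -b + d + 1 + f = d - (b - 1) + f by ring,
      show -b - d + f = f - (b - 1) - d - 1 by ring, show d - -b + f = b - 1 + d + 1 + f by ring]
    tauto
  · congr 1
    · unfold extDeltaSq
      rw [show a + -b + 1 + c = c - (b - 1) + a by ring,
        show c - a - -b - 1 = c + (b - 1) - a by ring,
        show c + -b - a = c - a - (b - 1) - 1 by ring,
        show c - -b + a = a + (b - 1) + 1 + c by ring,
        show f - -b - d - 1 = b - 1 - d + f by ring, show -b + d + 1 + f = d - (b - 1) + f by ring,
        show -b - d + f = f - (b - 1) - d - 1 by ring, show d - -b + f = b - 1 + d + 1 + f by ring]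
      congr 1
      ring
    · refine Finset.sum_congr rfl fun n _ => ?_
      rw [show -b + e + c + f - (n : ℚ) = e - (b - 1) - 1 + c + f - n by ring,
        show e - -b - 1 + c + f - (n : ℚ) = b - 1 + e + c + f - n by ring]
      ring

open Classical in
/-- The reflection `x ↦ -1 - x` of the fourth label, with `x = d - 1`. -/
lemma sixJExt_reflect_fourth (a b c d e f : ℚ) :
    sixJExt a b c (-d) e f = sixJExt a b c (d - 1) e f := by
  rw [sixJExt_eq_ite, sixJExt_eq_ite]
  refine if_congr ?_ ?_ rfl
  · simp only [ExtDomain]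
    rw [show e - -d - 1 - c = d - 1 + e - c by ring, show e - -d + c = c + (d - 1) + e + 1 by ring,
      show -d + e - c = e - (d - 1) - 1 - c by ring, show c + -d + e + 1 = e - (d - 1) + c by ring,
      show f - b - -d - 1 = d - 1 - b + f by ring, show b + -d + 1 + f = b - (d - 1) + f by ring,
      show b - -d + f = b + (d - 1) + 1 + f by ring, show -d - b + f = f - b - (d - 1) - 1 by ring]
    tauto
  · congr 1
    · unfold extDeltaSq
      rw [show e - -d - 1 - c = d - 1 + e - c by ring,
        show e - -d + c = c + (d - 1) + e + 1 by ring,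
        show -d + e - c = e - (d - 1) - 1 - c by ring,
        show c + -d + e + 1 = e - (d - 1) + c by ring,
        show f - b - -d - 1 = d - 1 - b + f by ring, show b + -d + 1 + f = b - (d - 1) + f by ring,
        show b - -d + f = b + (d - 1) + 1 + f by ring,
        show -d - b + f = f - b - (d - 1) - 1 by ring]
      congr 1
      ring
    · refine Finset.sum_congr rfl fun n _ => ?_
      rw [show (n : ℚ) - e + -d + 1 - c = n - c - (d - 1) - e by ring,
        show (n : ℚ) - c - -d - e = n - e + (d - 1) + 1 - c by ring]
      ring

/-! ### The Biedenharn-Elliott relation for the extended symbol -/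

open Classical in
lemma extDomain_of_ne_zero {a b c d e f : ℚ} (h : sixJExt a b c d e f ≠ 0) :
    ExtDomain a b c d e f := by
  by_contra hn
  exact h (by rw [sixJExt_eq_ite, if_neg hn])

lemma IsNat.nonneg {x : ℚ} (h : IsNat x) : 0 ≤ x := by
  obtain ⟨n, rfl⟩ := h
  positivity

/-- The labels of the extended symbol that are not subject to a reflection are nonnegative. -/
lemma nonneg_of_sixJExt_ne_zero {a b c d e f : ℚ} (h : sixJExt a b c d e f ≠ 0) :
    0 ≤ c ∧ 0 ≤ e ∧ 0 ≤ f := by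
  obtain ⟨⟨h1, -⟩, ⟨h2, -⟩, ⟨h3, h4⟩, -, -, -, ⟨h5, h6⟩, -⟩ := extDomain_of_ne_zero h
  have := h1.nonneg; have := h2.nonneg; have := h3.nonneg
  have := h4.nonneg; have := h5.nonneg; have := h6.nonneg
  refine ⟨?_, ?_, ?_⟩ <;> linarith

lemma tetrad_of_sixJExt_ne_zero {a b c d e f : Spin}
    (h : sixJExt ((a : ℚ) - 1) (b - 1) (c - 1) (d - 1) (e - 1) (f - 1) ≠ 0) :
    Tetrad a b c d e f := by
  obtain ⟨⟨h1, -⟩, -, ⟨-, h2⟩, -, ⟨h3, -⟩, -, ⟨h4, -⟩, -⟩ := extDomain_of_ne_zero h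
  refine ⟨?_, ?_, ?_, ?_⟩ <;> unfold Triad
  · convert h2 using 1; ring
  · convert h1 using 1; ring
  · convert h4 using 1; ring
  · convert h3 using 1; ring

/-- The extended symbol in the region of the SU(1,1) symbol. Only two of the four triad conditions
are assumed, with integers in place of natural numbers: if the conditions fail, both sides
are `0`. -/
lemma sixJExt_eq_sixJ {a b c d e f : Spin} {i l : ℤ} (hc : (dbl c : ℤ) = dbl a + dbl b + 2 * i)
    (hf : (dbl f : ℤ) = dbl b + dbl d + 2 * l) :
    sixJExt ((a : ℚ) - 1) (b - 1) (c - 1) (d - 1) (e - 1) (f - 1) =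
      (-1) ^ (i + l + 1) * sixJ a b c d e f := by
  by_cases hT : Tetrad a b c d e f
  · obtain ⟨n, i', l', hi, hl, hc', hf', he⟩ := tetrad_iff.mp hT
    obtain rfl : i = i' := by omega
    obtain rfl : l = l' := by omega
    rw [sixJ_eq_sixJExt (i := i') (l := l') (N := n - i') (M := n - l') (by omega) hc' hf'
      (by omega), ← mul_assoc, ← zpow_natCast, ← zpow_add₀ (by norm_num),
      Even.neg_one_zpow, one_mul]
    exact ⟨i' + l' + 1, by push_cast; ring⟩
  · rw [sixJ_eq_zero_of_not_tetrad hT, mul_zero]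
    exact not_imp_comm.mp tetrad_of_sixJExt_ne_zero hT

/-- The relation for the extended symbol in the region of the SU(1,1) symbol. -/
lemma hasSum_sixJExt_spin (a b c d e f p q r : Spin) :
    HasSum
      (fun X : Spin =>
        sgn (((f : ℚ) - 1) + (q - 1) - (r - 1) + (X - 1) + 1) *
          ((2 * ((X : ℚ) - 1) + 1 : ℚ) : ℝ) *
          sixJExt ((b : ℚ) - 1) (c - 1) (X - 1) (d - 1) (f - 1) (e - 1) *
          sixJExt ((a : ℚ) - 1) (X - 1) (q - 1) (d - 1) (r - 1) (f - 1) *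
          sixJExt ((a : ℚ) - 1) (b - 1) (p - 1) (c - 1) (q - 1) (X - 1))
      (sixJExt ((a : ℚ) - 1) (b - 1) (p - 1) (e - 1) (r - 1) (f - 1) *
        sixJExt ((p : ℚ) - 1) (c - 1) (q - 1) (d - 1) (r - 1) (e - 1)) := by
  -- Outside the common triad conditions both sides vanish.
  by_cases hT : Triad c d e ∧ Triad b e f ∧ Triad a f r ∧ Triad a b p ∧ Triad p c q
  swap
  · have hR : sixJExt ((a : ℚ) - 1) (b - 1) (p - 1) (e - 1) (r - 1) (f - 1) *
        sixJExt ((p : ℚ) - 1) (c - 1) (q - 1) (d - 1) (r - 1) (e - 1) = 0 := by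
      by_contra h
      have t₁ := tetrad_of_sixJExt_ne_zero (left_ne_zero_of_mul h)
      have t₂ := tetrad_of_sixJExt_ne_zero (right_ne_zero_of_mul h)
      exact hT ⟨t₂.2.2.1, t₁.2.2.1, t₁.2.2.2, t₁.1, t₂.1⟩
    rw [hR]
    convert hasSum_zero with X
    by_contra h
    have t₁ := tetrad_of_sixJExt_ne_zero
      (right_ne_zero_of_mul (left_ne_zero_of_mul (left_ne_zero_of_mul h)))
    have t₂ := tetrad_of_sixJExt_ne_zero (right_ne_zero_of_mul (left_ne_zero_of_mul h))
    have t₃ := tetrad_of_sixJExt_ne_zero (right_ne_zero_of_mul h)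
    exact hT ⟨t₁.2.2.1, t₁.2.2.2, t₂.2.2.2, t₃.1, t₃.2.1⟩
  obtain ⟨hcde, hbef, hafr, habp, hpcq⟩ := hT
  obtain ⟨ε, hε⟩ := triad_iff.mp hcde
  obtain ⟨φ, hφ⟩ := triad_iff.mp hbef
  obtain ⟨ρ, hρ⟩ := triad_iff.mp hafr
  obtain ⟨π, hπ⟩ := triad_iff.mp habp
  obtain ⟨κ, hκ⟩ := triad_iff.mp hpcq
  convert (hasSum_sixJ a b c d e f p q r).mul_left ((-1 : ℝ) ^ ((π : ℤ) + φ + κ + ε)) using 1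
  · rfl
  · funext X
    by_cases hX : Triad b c X
    swap
    · rw [sixJ_eq_zero_of_not_tetrad (a := b) (b := c) (c := X) fun ht => hX ht.1,
        not_imp_comm.mp (tetrad_of_sixJExt_ne_zero (a := b) (b := c) (c := X)) fun ht => hX ht.1]
      ring
    obtain ⟨x, hx⟩ := triad_iff.mp hX
    rw [sixJExt_eq_sixJ (a := b) (b := c) (c := X) (d := d) (e := f) (f := e) (i := x) (l := ε)
        (by omega) (by omega),
      sixJExt_eq_sixJ (a := a) (b := X) (c := q) (d := d) (e := r) (f := f) (i := π + κ - x)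
        (l := ε + φ - x) (by omega) (by omega),
      sixJExt_eq_sixJ (a := a) (b := b) (c := p) (d := c) (e := q) (f := X) (i := π) (l := x)
        (by omega) (by omega)]
    have hsgn : sgn (((f : ℚ) - 1) + (q - 1) - (r - 1) + (X - 1) + 1) *
        ((-1) ^ ((x : ℤ) + ε + 1) * (-1) ^ ((π : ℤ) + κ - x + (ε + φ - x) + 1) *
          (-1) ^ ((π : ℤ) + x + 1)) =
        (-1) ^ ((π : ℤ) + φ + κ + ε) * sgn ((a : ℚ) + b + c + d + e + f + p + q + r + X) := by
      have ha := coe_eq_dbl a; have hb := coe_eq_dbl b; have hc := coe_eq_dbl c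
      have hd := coe_eq_dbl d; have he := coe_eq_dbl e; have hf := coe_eq_dbl f
      have hp := coe_eq_dbl p; have hq := coe_eq_dbl q; have hr := coe_eq_dbl r
      have hX := coe_eq_dbl X
      have eε : (dbl e : ℚ) = dbl c + dbl d + 2 * ε := by exact_mod_cast hε
      have eφ : (dbl f : ℚ) = dbl b + dbl e + 2 * φ := by exact_mod_cast hφ
      have eρ : (dbl r : ℚ) = dbl a + dbl f + 2 * ρ := by exact_mod_cast hρ
      have eπ : (dbl p : ℚ) = dbl a + dbl b + 2 * π := by exact_mod_cast hπ
      have eκ : (dbl q : ℚ) = dbl p + dbl c + 2 * κ := by exact_mod_cast hκ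
      have ex : (dbl X : ℚ) = dbl b + dbl c + 2 * x := by exact_mod_cast hx
      set α := dbl a
      set β := dbl b
      set γ := dbl c
      set δ := dbl d
      rw [sgn_eq (k := β + γ + π + κ - ρ + x - 1) (by push_cast; linarith),
        sgn_eq (k := 2 * α + 3 * β + 3 * γ + 2 * δ + 3 * ε + 2 * φ + 2 * π + κ + ρ + x)
          (by push_cast; linarith)]
      simp only [← zpow_add₀ (show (-1 : ℝ) ≠ 0 by norm_num)]
      apply neg_one_zpow_congr
      rw [Int.even_iff]
      omega
    rw [show (2 * ((X : ℚ) - 1) + 1) = 2 * (X : ℚ) - 1 by ring]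
    linear_combination (((2 * (X : ℚ) - 1 : ℚ) : ℝ) *
      (sixJ b c X d f e * sixJ a X q d r f * sixJ a b p c q X)) * hsgn
  · rw [sixJExt_eq_sixJ (a := a) (b := b) (c := p) (d := e) (e := r) (f := f) (i := π) (l := φ)
        (by omega) (by omega),
      sixJExt_eq_sixJ (a := p) (b := c) (c := q) (d := d) (e := r) (f := e) (i := κ) (l := ε)
        (by omega) (by omega), mul_mul_mul_comm, ← zpow_add₀ (by norm_num)]
    congr 1
    apply neg_one_zpow_congr
    rw [Int.even_iff]
    omega

lemma HalfInt.exists_spin_of_nonneg (x : HalfInt) (h : 0 ≤ (x : ℚ)) :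
    ∃ a : Spin, (x : ℚ) = a - 1 := by
  obtain ⟨x, n, rfl⟩ := x
  have hn : 0 ≤ n := by
    have : (0 : ℚ) ≤ n := by
      have h' : (0 : ℚ) ≤ n / 2 := h
      linarith
    exact_mod_cast this
  lift n to ℕ using hn
  exact ⟨mkSpin (n + 1), by simp only [mkSpin]; push_cast; ring⟩

/-- Up to the reflection `x ↦ -1 - x`, every integer or half-integer is at least `-1/2`. -/
lemma HalfInt.exists_spin (x : HalfInt) : ∃ a : Spin, (x : ℚ) = a - 1 ∨ (x : ℚ) = -a := by
  obtain h | h := le_or_gt 0 (x : ℚ)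
  · obtain ⟨a, ha⟩ := x.exists_spin_of_nonneg h
    exact ⟨a, Or.inl ha⟩
  · obtain ⟨x, n, rfl⟩ := x
    have hn : 0 < -n := by
      have : (n : ℚ) < 0 := by
        have h' : (n : ℚ) / 2 < 0 := h
        linarith
      have : n < 0 := by exact_mod_cast this
      omega
    refine ⟨⟨(-n : ℤ) / 2, (-n).toNat, by omega, ?_⟩, Or.inr ?_⟩
    · rw [← Int.cast_natCast, Int.toNat_of_nonneg hn.le]
    · push_cast; ring

/-- The shift that takes the labels of the SU(1,1) symbol to those of the extended symbol. -/
def shift (a : Spin) : HalfInt :=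
  ⟨(a : ℚ) - 1, dbl a - 2, by rw [coe_eq_dbl]; push_cast; ring⟩

lemma shift_injective : Function.Injective shift := fun a b h => by
  have h' : (a : ℚ) - 1 = b - 1 := congrArg Subtype.val h
  exact Subtype.ext (by linarith)

/-- The labels `a, b, c, d` occur only at positions that admit the reflection, and not in the sign,
so that they may be taken from the region of the SU(1,1) symbol. -/
theorem hasSum_sixJExt (a b c d e f p q r : HalfInt) :
    HasSum
      (fun X : HalfInt =>
        sgn ((f : ℚ) + q - r + X + 1) * ((2 * (X : ℚ) + 1 : ℚ) : ℝ) *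
          sixJExt b c X d f e * sixJExt a X q d r f * sixJExt a b p c q X)
      (sixJExt a b p e r f * sixJExt p c q d r e) := by
  -- Each of these labels occurs at an unreflected position on both sides.
  by_cases hpos : 0 ≤ (e : ℚ) ∧ 0 ≤ (f : ℚ) ∧ 0 ≤ (p : ℚ) ∧ 0 ≤ (q : ℚ) ∧ 0 ≤ (r : ℚ)
  swap
  · have hR : sixJExt a b p e r f * sixJExt p c q d r e = 0 := by
      by_contra h
      have t₁ := nonneg_of_sixJExt_ne_zero (left_ne_zero_of_mul h)
      have t₂ := nonneg_of_sixJExt_ne_zero (right_ne_zero_of_mul h)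
      exact hpos ⟨t₂.2.2, t₁.2.2, t₁.1, t₂.1, t₁.2.1⟩
    rw [hR]
    convert hasSum_zero with X
    by_contra h
    have t₁ := nonneg_of_sixJExt_ne_zero
      (right_ne_zero_of_mul (left_ne_zero_of_mul (left_ne_zero_of_mul h)))
    have t₂ := nonneg_of_sixJExt_ne_zero (right_ne_zero_of_mul (left_ne_zero_of_mul h))
    have t₃ := nonneg_of_sixJExt_ne_zero (right_ne_zero_of_mul h)
    exact hpos ⟨t₁.2.2, t₁.2.1, t₃.1, t₃.2.1, t₂.2.1⟩
  obtain ⟨he, hf, hp, hq, hr⟩ := hpos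
  obtain ⟨e', he'⟩ := e.exists_spin_of_nonneg he
  obtain ⟨f', hf'⟩ := f.exists_spin_of_nonneg hf
  obtain ⟨p', hp'⟩ := p.exists_spin_of_nonneg hp
  obtain ⟨q', hq'⟩ := q.exists_spin_of_nonneg hq
  obtain ⟨r', hr'⟩ := r.exists_spin_of_nonneg hr
  obtain ⟨a', ha'⟩ := a.exists_spin
  obtain ⟨b', hb'⟩ := b.exists_spin
  obtain ⟨c', hc'⟩ := c.exists_spin
  obtain ⟨d', hd'⟩ := d.exists_spin
  have h₁ : ∀ {x : ℚ} {x' : Spin}, x = x' - 1 ∨ x = -x' → ∀ b c d e f : ℚ,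
      sixJExt x b c d e f = sixJExt (x' - 1) b c d e f := by
    rintro x x' (rfl | rfl) b c d e f
    exacts [rfl, sixJExt_reflect_first ..]
  have h₂ : ∀ {x : ℚ} {x' : Spin}, x = x' - 1 ∨ x = -x' → ∀ a c d e f : ℚ,
      sixJExt a x c d e f = sixJExt a (x' - 1) c d e f := by
    rintro x x' (rfl | rfl) a c d e f
    exacts [rfl, sixJExt_reflect_second ..]
  have h₄ : ∀ {x : ℚ} {x' : Spin}, x = x' - 1 ∨ x = -x' → ∀ a b c e f : ℚ,
      sixJExt a b c x e f = sixJExt a b c (x' - 1) e f := by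
    rintro x x' (rfl | rfl) a b c e f
    exacts [rfl, sixJExt_reflect_fourth ..]
  simp only [h₁ ha', h₁ hb', h₂ hb', h₂ hc', h₄ hc', h₄ hd', he', hf', hp', hq', hr']
  -- The summand vanishes at `X < 0`, in particular off the range of `shift`.
  refine (shift_injective.hasSum_iff fun X hX => ?_).mp
    (hasSum_sixJExt_spin a' b' c' d' e' f' p' q' r')
  by_contra h
  have hX' := (nonneg_of_sixJExt_ne_zero
    (right_ne_zero_of_mul (left_ne_zero_of_mul (left_ne_zero_of_mul h)))).1
  obtain ⟨X', hX'⟩ := X.exists_spin_of_nonneg hX'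
  exact hX ⟨X', Subtype.ext hX'.symm⟩

end

end SU11

theorem mainTheorem2 :
    SU11.IsClebschGordan SU11.cg ∧
    (∀ W : SU11.Spin → SU11.Spin → SU11.Spin → SU11.Spin → SU11.Spin → SU11.Spin → ℝ,
      SU11.IsSixJ W ↔ W = SU11.sixJ) ∧
    (∀ a b c d e f p q r : SU11.Spin,
      HasSum
        (fun X : SU11.Spin =>
          SU11.sgn ((a : ℚ) + b + c + d + e + f + p + q + r + X) * ((2 * (X : ℚ) - 1 : ℚ) : ℝ) *
            SU11.sixJ b c X d f e * SU11.sixJ a X q d r f * SU11.sixJ a b p c q X)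
        (SU11.sixJ a b p e r f * SU11.sixJ p c q d r e)) ∧
    (∀ a b c d e f p q r : SU11.HalfInt,
      HasSum
        (fun X : SU11.HalfInt =>
          SU11.sgn ((f : ℚ) + q - r + X + 1) * ((2 * (X : ℚ) + 1 : ℚ) : ℝ) *
            SU11.sixJExt b c X d f e * SU11.sixJExt a X q d r f * SU11.sixJExt a b p c q X)
        (SU11.sixJExt a b p e r f * SU11.sixJExt p c q d r e)) := by
  exact ⟨SU11.isClebschGordan_cg, SU11.isSixJ_iff, SU11.hasSum_sixJ,
    SU11.hasSum_sixJExt⟩
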